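/- Let $p,d$ be integers with $3\le d\le p$. A map is a connected planar graph (loops and multiple edges allowed) embedded in the oriented sphere, considered up to orientation-preserving deformation; its girth is the minimal length of its cycles. A $p$-annular $d$-angulation is a map with a boundary face of degree $p$ whose contour is simple (its $p$ vertices are distinct) and a root-face different from the boundary face, such that all faces other than the boundary face have degree $d$. It is marked if a vertex incident to the boundary face is marked. A simple cycle $C$ of a $p$-annular $d$-angulation $A$ is separating if the boundary face and the root-face are on different sides of $C$ and $C$ is not the contour of the root-face; it is pseudo-separating if it is separating or is the contour of the root-face. $A$ is non-separated if it has no separating cycle of length $d$. If $A$ has girth $d$, a pseudo-separating cycle $C$ of length $d$ of $A$ defines a $p$-annular $d$-angulation $A_C$ of girth $d$, the map on the side of $C$ containing the boundary face (with $C$ as the contour of its root-face), and a $d$-annular $d$-angulation $A'_C$ of girth $d$, the map on the side of $C$ containing the root-face (with $C$ as the contour of its boundary face). Fix an arbitrary convention that distinguishes, for each marked $p$-annular $d$-angulation, one of the vertices incident to its root-face, called co-marked. For a marked $p$-annular $d$-angulation $A^\bullet$ of girth $d$ and a pseudo-separating cycle $C$ of length $d$, let $A_C^\bullet$ be $A_C$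 marked at the marked vertex of $A^\bullet$, and let ${A_C^\bullet}'$ be $A'_C$ marked at the co-marked vertex of $A_C^\bullet$. **Proposition.** Every $p$-annular $d$-angulation $A$ of girth $d$ has a unique pseudo-separating cycle $C$ of length $d$ such that $A_C$ is non-separated. Moreover, whatever the convention, the mapping $\Delta$ that associates with a marked $p$-annular $d$-angulation $A^\bullet$ of girth $d$ the pair $(A_C^\bullet,{A_C^\bullet}')$, for this cycle $C$, is a bijection from the set of marked $p$-annular $d$-angulations of girth $d$ to the set of pairs made of a marked non-separated $p$-annular $d$-angulation of girth $d$ and a marked $d$-annular $d$-angulation of girth $d$. -/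

import Mathlib

/-! # Planar maps as combinatorial maps (rotation systems)

A connected graph embedded in the oriented sphere, considered up to deformation, is the same thing as
an isomorphism class of the following data: the finite set of half-edges (darts), the permutation that
rotates counterclockwise around the vertices, and the fixed-point-free involution exchanging the two
halves of an edge, such that the generated group is transitive and Euler's relation holds.
(The map reduced to one vertex has no dart and is the only one not covered; it has no face of
positive degree, so that it is not an annular map.) -/

/-- A finite graph embedded in an oriented closed surface, given by its darts. A dart is directed from
its origin towards the middle of its edge. -/
structure CombMap where
  /-- The darts, that is, the half-edges. -/
  Dart : Type
  finite : Finite Dart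
  /-- `rot x` is the next dart after `x` in counterclockwise order around the origin of `x`. -/
  rot : Equiv.Perm Dart
  /-- `opp x` is the other half of the edge of `x`. -/
  opp : Equiv.Perm Dart
  opp_opp : ∀ x, opp (opp x) = x
  opp_ne : ∀ x, opp x ≠ x

theorem exists_pow_mem {α : Type} [Finite α] (σ : Equiv.Perm α) (S : Set α) (x : S) :
    ∃ n : ℕ, 0 < n ∧ (σ ^ n) x.1 ∈ S := by
  refine ⟨orderOf σ, orderOf_pos σ, ?_⟩
  rw [pow_orderOf_eq_one]
  exact x.2

open Classical in
/-- The number of steps of the first return of `x` to `S` under `σ`. -/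
noncomputable def returnTime {α : Type} [Finite α] (σ : Equiv.Perm α) (S : Set α) (x : S) : ℕ :=
  Nat.find (exists_pow_mem σ S x)

/-- The first point of `S` on the forward orbit of `x` under `σ`, after `x` itself. -/
noncomputable def firstReturnFun {α : Type} [Finite α] (σ : Equiv.Perm α) (S : Set α) (x : S) : S :=
  ⟨(σ ^ returnTime σ S x) x.1, by
    classical exact (Nat.find_spec (exists_pow_mem σ S x)).2⟩

theorem firstReturnFun_injective {α : Type} [Finite α] (σ : Equiv.Perm α) (S : Set α) :
    Function.Injective (firstReturnFun σ S) := by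
  classical
  have key : ∀ x y : S, returnTime σ S x ≤ returnTime σ S y →
      firstReturnFun σ S x = firstReturnFun σ S y → x = y := by
    intro x y hle h
    have h1 : (σ ^ returnTime σ S x) x.1 = (σ ^ returnTime σ S y) y.1 := congrArg Subtype.val h
    obtain ⟨k, hk⟩ := Nat.exists_eq_add_of_le hle
    rw [hk, pow_add, Equiv.Perm.mul_apply] at h1
    have h2 : x.1 = (σ ^ k) y.1 := (σ ^ returnTime σ S x).injective h1
    rcases Nat.eq_zero_or_pos k with h0 | h0
    · subst h0
      exact Subtype.ext (by simpa using h2)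
    · exfalso
      have hx : 0 < returnTime σ S x := (Nat.find_spec (exists_pow_mem σ S x)).1
      have hlt : k < Nat.find (exists_pow_mem σ S y) := by
        have : returnTime σ S y = Nat.find (exists_pow_mem σ S y) := rfl
        omega
      exact Nat.find_min (exists_pow_mem σ S y) hlt ⟨h0, h2 ▸ x.2⟩
  intro x y h
  rcases le_total (returnTime σ S x) (returnTime σ S y) with hle | hle
  · exact key x y hle h
  · exact (key y x hle h.symm).symm

/-- The first-return permutation of `σ` on `S`: it sends `x ∈ S` to the first of
`σ x, σ (σ x), …` that belongs to `S`. -/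
noncomputable def firstReturn {α : Type} [Finite α] (σ : Equiv.Perm α) (S : Set α) : Equiv.Perm S :=
  Equiv.ofBijective (firstReturnFun σ S)
    (Finite.injective_iff_bijective.mp (firstReturnFun_injective σ S))

namespace CombMap

/-- The face permutation: `x` is followed by `face x` when walking along `x` with the face on the left.
A dart is regarded as incident to the face on its left; the darts of a face are thus in bijection
with its corners. -/
def face (M : CombMap) : Equiv.Perm M.Dart := M.rot⁻¹ * M.opp

/-- Two darts have the same origin. -/
def SameOrigin (M : CombMap) (x y : M.Dart) : Prop := M.rot.SameCycle x y

/-- A vertex, as the set of darts of which it is the origin. -/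
def IsVertex (M : CombMap) (v : Set M.Dart) : Prop := ∃ x, v = {y | M.rot.SameCycle x y}

/-- A face, as the set of darts that have it on their left. Its degree is the number of these darts. -/
def IsFace (M : CombMap) (f : Set M.Dart) : Prop := ∃ x, f = {y | M.face.SameCycle x y}

/-- The underlying graph is connected. -/
def IsConnected (M : CombMap) : Prop :=
  ∀ x y : M.Dart, ∃ g ∈ Subgroup.closure ({M.rot, M.opp} : Set (Equiv.Perm M.Dart)), g x = y

/-- Euler's relation `V - E + F = 2`: for a connected map, the surface is the sphere. -/
def IsEuler (M : CombMap) : Prop :=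
  Nat.card (Quotient (Equiv.Perm.SameCycle.setoid M.rot)) + Nat.card (Quotient (Equiv.Perm.SameCycle.setoid M.face)) =
    Nat.card (Quotient (Equiv.Perm.SameCycle.setoid M.opp)) + 2

/-- `M` is a planar map. -/
def IsPlanarMap (M : CombMap) : Prop := M.IsConnected ∧ M.IsEuler

/-- `C` is (the set of darts of) a simple cycle of length `k`: it consists of the two halves of `k`
distinct edges, which can be directed and cyclically ordered so that each one ends where the next
one starts, the origins being pairwise distinct. Loops (`k = 1`) and pairs of parallel edges
(`k = 2`) are simple cycles. -/
def IsCycle (M : CombMap) (C : Set M.Dart) (k : ℕ) : Prop :=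
  0 < k ∧ ∃ c : ZMod k → M.Dart,
    (∀ i j, M.SameOrigin (c i) (c j) → i = j) ∧
    (∀ i j, M.opp (c i) ≠ c j) ∧
    (∀ i, M.SameOrigin (M.opp (c i)) (c (i + 1))) ∧
    C = Set.range c ∪ M.opp '' Set.range c

/-- The minimal length of a cycle of `M` is `d`. -/
def HasGirth (M : CombMap) (d : ℕ) : Prop :=
  (∃ C, M.IsCycle C d) ∧ ∀ C k, M.IsCycle C k → d ≤ k

/-- The faces on the left of `x` and of `y` are on the same side of the cycle `C`: one goes from one to
the other through faces, crossing only edges that are not in `C`. -/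
def SameSide (M : CombMap) (C : Set M.Dart) : M.Dart → M.Dart → Prop :=
  Relation.EqvGen fun x y => y = M.face x ∨ (x ∉ C ∧ y = M.opp x)

/-- The side of `C` that contains the face `f`, as a set of darts (it is a union of faces). -/
def side (M : CombMap) (C f : Set M.Dart) : Set M.Dart := {x | ∃ y ∈ f, M.SameSide C y x}

/-- The darts of the edges incident to at least one face of `R`. -/
def edgesOf (M : CombMap) (R : Set M.Dart) : Set M.Dart := {x | x ∈ R ∨ M.opp x ∈ R}

theorem opp_mem_edgesOf (M : CombMap) (R : Set M.Dart) (x : M.Dart) :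
    M.opp x ∈ M.edgesOf R ↔ x ∈ M.edgesOf R := by
  simp only [edgesOf, Set.mem_ofPred_eq, M.opp_opp]
  exact or_comm

/-- The map obtained from `M` by keeping only the edges incident to at least one face of the region
`R` (and their end vertices), with the cyclic orders around vertices inherited from `M`. -/
noncomputable def sub (M : CombMap) (R : Set M.Dart) : CombMap :=
  haveI := M.finite
  { Dart := M.edgesOf R
    finite := inferInstance
    rot := firstReturn M.rot (M.edgesOf R)
    opp := M.opp.subtypePerm (M.opp_mem_edgesOf R)
    opp_opp := fun x => Subtype.ext (M.opp_opp x.1)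
    opp_ne := fun x h => M.opp_ne x.1 (congrArg Subtype.val h) }

/-- The inclusion of the darts of `M.sub R` into those of `M`. -/
def subIncl (M : CombMap) (R : Set M.Dart) : (M.sub R).Dart → M.Dart :=
  fun x => (show M.edgesOf R from x).1

end CombMap

/-- A map with two distinguished sets of darts, meant to be the boundary face and the root-face. -/
structure AnnMap extends CombMap where
  bdry : Set Dart
  root : Set Dart

namespace AnnMap

/-- `A` is a `p`-annular `d`-angulation: a planar map with a boundary face of degree `p` whose contour
is simple (its `p` vertices are distinct), and a root-face different from the boundary face, all
the faces other than the boundary face having degree `d`. -/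
structure IsAnnular (A : AnnMap) (p d : ℕ) : Prop where
  planar : A.IsPlanarMap
  bdry_face : A.IsFace A.bdry
  bdry_card : A.bdry.ncard = p
  bdry_simple : ∀ x ∈ A.bdry, ∀ y ∈ A.bdry, A.SameOrigin x y → x = y
  root_face : A.IsFace A.root
  root_ne : A.root ≠ A.bdry
  face_card : ∀ f, A.IsFace f → f ≠ A.bdry → f.ncard = d

/-- The set of darts of the edges incident to the root-face. -/
def rootContour (A : AnnMap) : Set A.Dart := A.root ∪ A.opp '' A.root

/-- The cycle `C` is separating: the boundary face and the root-face are on different sides of `C`, and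
`C` is not the contour of the root-face. -/
def IsSeparating (A : AnnMap) (C : Set A.Dart) : Prop :=
  (∀ x ∈ A.bdry, ∀ y ∈ A.root, ¬ A.SameSide C x y) ∧ C ≠ A.rootContour

/-- `C` is a pseudo-separating (simple) cycle of length `k`: a simple cycle that is separating or is the
contour of the root-face. -/
def IsPseudoSeparating (A : AnnMap) (C : Set A.Dart) (k : ℕ) : Prop :=
  A.IsCycle C k ∧ (A.IsSeparating C ∨ C = A.rootContour)

/-- There is no separating cycle of length `d`. -/
def NonSeparated (A : AnnMap) (d : ℕ) : Prop := ∀ C, A.IsCycle C d → ¬ A.IsSeparating C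

/-- The part `A_C` of `A` on the side of `C` that contains the boundary face. Its boundary face is that
of `A`; its root-face replaces the other side of `C`. -/
noncomputable def bdryPart (A : AnnMap) (C : Set A.Dart) : AnnMap where
  toCombMap := A.toCombMap.sub (A.side C A.bdry)
  bdry := {x | A.subIncl _ x ∈ A.bdry}
  root := {x | A.subIncl _ x ∉ A.side C A.bdry}

/-- The part `A'_C` of `A` on the side of `C` that contains the root-face. Its root-face is that of `A`;
its boundary face replaces the other side of `C`. -/
noncomputable def rootPart (A : AnnMap) (C : Set A.Dart) : AnnMap where
  toCombMap := A.toCombMap.sub (A.side C A.root)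
  bdry := {x | A.subIncl _ x ∉ A.side C A.root}
  root := {x | A.subIncl _ x ∈ A.root}

end AnnMap

/-- An annular map with a further distinguished set of darts, meant to be the marked vertex. -/
structure MarkedMap extends AnnMap where
  mark : Set Dart

namespace MarkedMap

/-- `A` is a marked `p`-annular `d`-angulation: the mark is a vertex incident to the boundary face. -/
structure IsMarkedAnnular (A : MarkedMap) (p d : ℕ) : Prop where
  annular : A.IsAnnular p d
  mark_vertex : A.IsVertex A.mark
  mark_bdry : (A.mark ∩ A.bdry).Nonempty

/-- An isomorphism of marked annular maps, that is, an orientation-preserving homeomorphism of the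
sphere up to deformation. -/
structure Iso (A B : MarkedMap) where
  toEquiv : A.Dart ≃ B.Dart
  map_rot : ∀ x, toEquiv (A.rot x) = B.rot (toEquiv x)
  map_opp : ∀ x, toEquiv (A.opp x) = B.opp (toEquiv x)
  map_bdry : toEquiv '' A.bdry = B.bdry
  map_root : toEquiv '' A.root = B.root
  map_mark : toEquiv '' A.mark = B.mark

def Iso.refl (A : MarkedMap) : Iso A A where
  toEquiv := Equiv.refl _
  map_rot _ := rfl
  map_opp _ := rfl
  map_bdry := by simp
  map_root := by simp
  map_mark := by simp

def Iso.symm {A B : MarkedMap} (e : Iso A B) : Iso B A where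
  toEquiv := e.toEquiv.symm
  map_rot x := by rw [Equiv.symm_apply_eq, e.map_rot, Equiv.apply_symm_apply]
  map_opp x := by rw [Equiv.symm_apply_eq, e.map_opp, Equiv.apply_symm_apply]
  map_bdry := by rw [← e.map_bdry, Equiv.symm_image_image]
  map_root := by rw [← e.map_root, Equiv.symm_image_image]
  map_mark := by rw [← e.map_mark, Equiv.symm_image_image]

def Iso.trans {A B D : MarkedMap} (e : Iso A B) (f : Iso B D) : Iso A D where
  toEquiv := e.toEquiv.trans f.toEquiv
  map_rot x := by simp [e.map_rot, f.map_rot]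
  map_opp x := by simp [e.map_opp, f.map_opp]
  map_bdry := by rw [← f.map_bdry, ← e.map_bdry, Set.image_image]; rfl
  map_root := by rw [← f.map_root, ← e.map_root, Set.image_image]; rfl
  map_mark := by rw [← f.map_mark, ← e.map_mark, Set.image_image]; rfl

instance isoSetoid : Setoid MarkedMap where
  r A B := Nonempty (Iso A B)
  iseqv := ⟨fun A => ⟨Iso.refl A⟩, fun ⟨e⟩ => ⟨e.symm⟩, fun ⟨e⟩ ⟨f⟩ => ⟨e.trans f⟩⟩

/-- A co-marking convention for marked `p`-annular `d`-angulations: an arbitrary choice, for each of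
them, of a vertex `κ A` incident to the root-face. As maps are considered up to isomorphism, the
choice is compatible with isomorphisms. (The values of `κ` on other objects are irrelevant.) -/
structure IsCoMarking (p d : ℕ) (κ : (A : MarkedMap) → Set A.Dart) : Prop where
  vertex : ∀ A : MarkedMap, A.IsMarkedAnnular p d → A.IsVertex (κ A)
  outer : ∀ A : MarkedMap, A.IsMarkedAnnular p d → (κ A ∩ A.root).Nonempty
  natural : ∀ (A B : MarkedMap) (e : Iso A B), A.IsMarkedAnnular p d → e.toEquiv '' κ A = κ B

/-- The part `A_C`, marked at the marked vertex of `A`. -/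
noncomputable def bdryPartMarked (A : MarkedMap) (C : Set A.Dart) : MarkedMap where
  toAnnMap := A.toAnnMap.bdryPart C
  mark := {x | A.subIncl (A.side C A.bdry) x ∈ A.mark}

/-- The part `A'_C`, marked at the co-marked vertex of the marked map `A_C`: the darts of `A'_C` whose
origin in `A` is the vertex of `A` that contains the co-marked vertex of `A_C`. -/
noncomputable def rootPartMarked (κ : (A : MarkedMap) → Set A.Dart) (A : MarkedMap)
    (C : Set A.Dart) : MarkedMap where
  toAnnMap := A.toAnnMap.rootPart C
  mark := {x | ∃ y ∈ κ (A.bdryPartMarked C),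
    A.SameOrigin (A.subIncl (A.side C A.bdry) y) (A.subIncl (A.side C A.root) x)}

/-- Marked annular maps up to isomorphism. -/
abbrev Class : Type 1 := Quotient isoSetoid

/-- The set of (isomorphism classes of) marked `p`-annular `d`-angulations of girth `d`. -/
def annularClasses (p d : ℕ) : Set Class :=
  {q | ∃ A : MarkedMap, A.IsMarkedAnnular p d ∧ A.HasGirth d ∧ q = Quotient.mk _ A}

/-- The set of (isomorphism classes of) marked non-separated `p`-annular `d`-angulations of
girth `d`. -/
def nonSeparatedClasses (p d : ℕ) : Set Class :=
  {q | ∃ A : MarkedMap, A.IsMarkedAnnular p d ∧ A.HasGirth d ∧ A.NonSeparated d ∧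
    q = Quotient.mk _ A}

end MarkedMap

/-!
# Decomposition of annular maps along a distinguished cycle

The darts on one side of a cycle form a *region*, that is, a union of faces, and a region `S` is
handled through the set `M.bd S` of the darts of the edges that separate it from its complement. A
walk on the boundary never gets stuck at a vertex, since no vertex meets the boundary exactly once,
so that a nonempty boundary contains a simple cycle (`CombMap.FaceInv.exists_isCycle`). In a map of
girth `d`, a region whose boundary has at most `d` edges, and is not empty, is therefore bounded by
a simple cycle of length `d` (`CombMap.FaceInv.isCycle_bd`).

**Planarity.** For a connected map, Euler's relation is equivalent to the vanishing of the first
cohomology modulo 2 (`CombMap.Exact`, `CombMap.exact_iff_isEuler`). In this form planarity gives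
Jordan's theorem, each simple cycle being the boundary of a region (`CombMap.Exact.exists_region`),
and passes from a map to the part cut out by a side of a cycle (`CombMap.IsPart.exact`) and from the
two parts back to the map (`CombMap.exact_of_parts`).

**The distinguished cycle.** Pseudo-separating cycles of length `d` thus correspond to the regions
bounded by such a cycle that contain the boundary face and not the root-face (`AnnMap.IsRegion`,
`AnnMap.IsAnnular.isPseudoSeparating_iff`). The number of boundary edges is a submodular function of
the region; since the union of two such regions also has at least `d` boundary edges, their
intersection is again such a region (`AnnMap.IsRegion.inter`). Hence there is a least one, and the
part on the side of the boundary face is non-separated exactly for this one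
(`AnnMap.IsAnnular.existsUnique_cycle`), because the separating cycles of the part are the
pseudo-separating cycles of the map that bound a smaller region.

**The bijection.** A part is characterised up to isomorphism, without reference to the construction
by first returns, by the way its darts sit in the map (`CombMap.IsPart`). Conversely a map is
determined by its two parts together with the identification of their boundaries
(`CombMap.exists_iso_of_parts`). This identification is a rotation of a `d`-gon, and the equality of
the co-marked vertex of the first part with the marked vertex of the second one fixes it; this gives
injectivity. For surjectivity the two maps are glued along the face that is to disappear in each of
them, in the rotation that matches these two vertices (`CombMap.Seam`). The glued map has girth `d`
(`AnnMap.hasGirth_of_parts`): a cycle that crosses the seam bounds a region, and by submodularity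
against the region of the seam it is at least as long as a cycle in one of the two parts.
-/

/-! ### Propagation along the cycles of a permutation -/

theorem Equiv.Perm.apply_inv_apply {α : Type*} (σ : Equiv.Perm α) (x : α) : σ (σ⁻¹ x) = x :=
  σ.apply_symm_apply x

theorem Equiv.Perm.inv_apply_apply {α : Type*} (σ : Equiv.Perm α) (x : α) : σ⁻¹ (σ x) = x :=
  σ.symm_apply_apply x

theorem exists_mem_of_pow_mem {α : Type*} (σ : Equiv.Perm α) {T : Set α} {Q : α → Prop}
    (step : ∀ z, Q z → z ∉ T → Q (σ z)) (n : ℕ) :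
    ∀ x, Q x → (σ ^ n) x ∈ T → ∃ z ∈ T, Q z ∧ σ.SameCycle x z := by
  induction n with
  | zero => exact fun x hx h => ⟨x, by simpa using h, hx, .refl _ _⟩
  | succ n ih =>
    intro x hx h
    by_cases hT : x ∈ T
    · exact ⟨x, hT, hx, .refl _ _⟩
    · rw [pow_succ, Equiv.Perm.mul_apply] at h
      obtain ⟨z, hz, hQ, hs⟩ := ih (σ x) (step x hx hT) h
      exact ⟨z, hz, hQ, Equiv.Perm.sameCycle_apply_left.mp hs⟩

/-- A property that propagates along `σ` until the set `T` is met holds at some point of `T`. -/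
theorem Equiv.Perm.SameCycle.exists_first_mem {α : Type*} [Finite α] {σ : Equiv.Perm α}
    {T : Set α} {Q : α → Prop} {x y : α} (h : σ.SameCycle x y) (hx : Q x) (hy : y ∈ T)
    (step : ∀ z, Q z → z ∉ T → Q (σ z)) : ∃ z ∈ T, Q z ∧ σ.SameCycle x z := by
  obtain ⟨n, -, hn⟩ := h.exists_pow_eq'
  exact exists_mem_of_pow_mem σ step n x hx (hn ▸ hy)

/-- A property that holds at `σ x` and propagates along `σ`, except possibly through `x` and `y`,
holds at `y` if `y ≠ x` belongs to the cycle of `x`. -/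
theorem Equiv.Perm.SameCycle.induction_until {α : Type*} [Finite α] {σ : Equiv.Perm α}
    {Q : α → Prop} {x y : α} (h : σ.SameCycle x y) (hne : x ≠ y) (hx : Q (σ x))
    (step : ∀ z, σ.SameCycle x z → z ≠ x → z ≠ y → Q z → Q (σ z)) : Q y := by
  classical
  have hex : ∃ n : ℕ, (σ ^ n) x = y := by
    obtain ⟨n, -, hn⟩ := h.exists_pow_eq'
    exact ⟨n, hn⟩
  have key : ∀ m : ℕ, m < Nat.find hex → Q ((σ ^ (m + 1)) x) := by
    intro m
    induction m with
    | zero => intro _; simpa using hx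
    | succ m ih =>
      intro hm
      rw [pow_succ', Equiv.Perm.mul_apply]
      refine step _ ⟨(m + 1 : ℕ), by rw [zpow_natCast]⟩ ?_ (Nat.find_min hex hm) (ih (by omega))
      intro hxx
      refine Nat.find_min hex (m := Nat.find hex - (m + 1)) (by omega) ?_
      have h1 := Nat.find_spec hex
      have h2 : Nat.find hex = (Nat.find hex - (m + 1)) + (m + 1) := by omega
      rw [h2, pow_add, Equiv.Perm.mul_apply, hxx] at h1
      exact h1
  have hpos : 0 < Nat.find hex := by
    rw [Nat.find_pos]
    simpa using hne
  have := key (Nat.find hex - 1) (by omega)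
  rwa [Nat.sub_add_cancel hpos, Nat.find_spec hex] at this

theorem ZMod.induction_add_one {k : ℕ} [NeZero k] {P : ZMod k → Prop} (i₀ : ZMod k) (h0 : P i₀)
    (hs : ∀ i, P i → P (i + 1)) (i : ZMod k) : P i := by
  have key : ∀ n : ℕ, P (i₀ + n) := by
    intro n
    induction n with
    | zero => simpa using h0
    | succ n ih =>
      have := hs _ ih
      rwa [add_assoc, ← Nat.cast_succ] at this
  have := key (i - i₀).val
  rwa [ZMod.natCast_zmod_val, add_sub_cancel] at this

namespace CombMap

/-! ### Darts of a map -/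

instance (M : CombMap) : Finite M.Dart := M.finite

noncomputable instance (M : CombMap) : Fintype M.Dart := Fintype.ofFinite _

variable {M : CombMap}

theorem rot_face (x : M.Dart) : M.rot (M.face x) = M.opp x := by simp [face]

theorem face_opp (x : M.Dart) : M.face (M.opp x) = M.rot⁻¹ x := by simp [face, M.opp_opp]

theorem opp_face_symm (x : M.Dart) : M.opp (M.face⁻¹ x) = M.rot x := by
  rw [← rot_face, Equiv.Perm.apply_inv_apply]

theorem sameOrigin_opp_face (x : M.Dart) : M.SameOrigin (M.opp x) (M.face x) := by
  rw [← rot_face]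
  exact Equiv.Perm.sameCycle_apply_left.mpr (.refl _ _)

theorem SameOrigin.symm {x y : M.Dart} (h : M.SameOrigin x y) : M.SameOrigin y x :=
  Equiv.Perm.SameCycle.symm h

theorem SameOrigin.trans {x y z : M.Dart} (h : M.SameOrigin x y) (h' : M.SameOrigin y z) :
    M.SameOrigin x z :=
  Equiv.Perm.SameCycle.trans h h'

theorem SameOrigin.refl (x : M.Dart) : M.SameOrigin x x := Equiv.Perm.SameCycle.refl _ _

/-- Membership in a set that is stable under the rotation depends only on the origin. -/
theorem SameOrigin.mem_iff {X : Set M.Dart} (hX : ∀ x, M.rot x ∈ X ↔ x ∈ X) {x y : M.Dart}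
    (h : M.SameOrigin x y) : y ∈ X ↔ x ∈ X := by
  obtain ⟨n, -, rfl⟩ := Equiv.Perm.SameCycle.exists_pow_eq' h
  clear h
  induction n with
  | zero => simp
  | succ n ih => rw [pow_succ', Equiv.Perm.mul_apply, hX, ih]

/-! ### Unions of faces and their boundaries -/

/-- The set of darts `X` is a union of faces. -/
def FaceInv (M : CombMap) (X : Set M.Dart) : Prop := ∀ x, M.face x ∈ X ↔ x ∈ X

/-- The boundary of a region `X`: the darts of the edges that have `X` on exactly one side. -/
def bd (M : CombMap) (X : Set M.Dart) : Set M.Dart := {x | ¬ (x ∈ X ↔ M.opp x ∈ X)}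

theorem mem_bd {X : Set M.Dart} {x : M.Dart} : x ∈ M.bd X ↔ ¬ (x ∈ X ↔ M.opp x ∈ X) := Iff.rfl

theorem opp_mem_bd {X : Set M.Dart} {x : M.Dart} : M.opp x ∈ M.bd X ↔ x ∈ M.bd X := by
  rw [mem_bd, mem_bd, M.opp_opp, not_iff_not]
  exact iff_comm

theorem bd_compl (X : Set M.Dart) : M.bd Xᶜ = M.bd X := by
  ext x
  simp only [mem_bd, Set.mem_compl_iff]
  tauto

theorem FaceInv.compl {X : Set M.Dart} (h : M.FaceInv X) : M.FaceInv Xᶜ :=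
  fun x => not_congr (h x)

theorem FaceInv.inter {X Y : Set M.Dart} (h : M.FaceInv X) (h' : M.FaceInv Y) :
    M.FaceInv (X ∩ Y) := fun x => and_congr (h x) (h' x)

theorem FaceInv.union {X Y : Set M.Dart} (h : M.FaceInv X) (h' : M.FaceInv Y) :
    M.FaceInv (X ∪ Y) := fun x => or_congr (h x) (h' x)

theorem FaceInv.sameCycle {X : Set M.Dart} (h : M.FaceInv X) {x y : M.Dart}
    (hxy : M.face.SameCycle x y) : y ∈ X ↔ x ∈ X := by
  obtain ⟨n, -, rfl⟩ := hxy.exists_pow_eq'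
  clear hxy
  induction n with
  | zero => simp
  | succ n ih => rw [pow_succ', Equiv.Perm.mul_apply, h, ih]

theorem FaceInv.inv {X : Set M.Dart} (h : M.FaceInv X) (x : M.Dart) : M.face⁻¹ x ∈ X ↔ x ∈ X := by
  rw [← h, Equiv.Perm.apply_inv_apply]

theorem IsFace.faceInv {f : Set M.Dart} (h : M.IsFace f) : M.FaceInv f := by
  obtain ⟨x, rfl⟩ := h
  exact fun y => Equiv.Perm.sameCycle_apply_right

theorem IsFace.nonempty {f : Set M.Dart} (h : M.IsFace f) : f.Nonempty := by
  obtain ⟨x, rfl⟩ := h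
  exact ⟨x, .refl _ _⟩

theorem IsFace.subset {f X : Set M.Dart} (h : M.IsFace f) (hX : M.FaceInv X) {x : M.Dart}
    (hf : x ∈ f) (hx : x ∈ X) : f ⊆ X := by
  obtain ⟨z, rfl⟩ := h
  intro y hy
  rw [hX.sameCycle (Equiv.Perm.SameCycle.trans (Equiv.Perm.SameCycle.symm hf) hy)]
  exact hx

theorem IsFace.eq {f g : Set M.Dart} (hf : M.IsFace f) (hg : M.IsFace g) {x : M.Dart}
    (hxf : x ∈ f) (hxg : x ∈ g) : f = g :=
  (hf.subset hg.faceInv hxf hxg).antisymm (hg.subset hf.faceInv hxg hxf)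

theorem opp_mem_iff_rot {X : Set M.Dart} (h : M.FaceInv X) (x : M.Dart) :
    M.opp x ∈ X ↔ M.rot⁻¹ x ∈ X := by
  rw [← face_opp, h]

/-- `M` is connected if and only if no proper nonempty set of darts is stable under both
permutations. -/
theorem isConnected_iff : M.IsConnected ↔ ∀ X : Set M.Dart,
    (∀ x, M.rot x ∈ X ↔ x ∈ X) → (∀ x, M.opp x ∈ X ↔ x ∈ X) → X = ∅ ∨ X = Set.univ := by
  constructor
  · intro hM X hr ho
    have key : ∀ g ∈ Subgroup.closure ({M.rot, M.opp} : Set (Equiv.Perm M.Dart)),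
        ∀ x, g x ∈ X ↔ x ∈ X := by
      intro g hg
      induction hg using Subgroup.closure_induction with
      | mem g hg =>
        rcases hg with rfl | rfl
        · exact hr
        · exact ho
      | one => simp
      | mul a b _ _ ha hb => intro x; rw [Equiv.Perm.mul_apply, ha, hb]
      | inv a _ ha => intro x; rw [← ha, Equiv.Perm.apply_inv_apply]
    rcases X.eq_empty_or_nonempty with h | ⟨x, hx⟩
    · exact .inl h
    · right
      ext y
      obtain ⟨g, hg, rfl⟩ := hM x y
      simp [key g hg, hx]
  · intro h x
    set X : Set M.Dart :=
      {y | ∃ g ∈ Subgroup.closure ({M.rot, M.opp} : Set (Equiv.Perm M.Dart)), g x = y} with hX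
    have key : ∀ s ∈ ({M.rot, M.opp} : Set (Equiv.Perm M.Dart)), ∀ y, s y ∈ X ↔ y ∈ X := by
      intro s hs y
      have hs := Subgroup.subset_closure hs
      constructor
      · rintro ⟨g, hg, h⟩
        exact ⟨s⁻¹ * g, mul_mem (inv_mem hs) hg, by simp [h]⟩
      · rintro ⟨g, hg, rfl⟩
        exact ⟨s * g, mul_mem hs hg, rfl⟩
    have hx : x ∈ X := ⟨1, one_mem _, rfl⟩
    rcases h X (key _ (by simp)) (key _ (by simp)) with h | h
    · simp [h] at hx
    · intro y
      have : y ∈ X := h ▸ Set.mem_univ y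
      exact this

theorem IsConnected.eq_empty_or_univ (hM : M.IsConnected) {X : Set M.Dart} (hX : M.FaceInv X)
    (hb : M.bd X = ∅) : X = ∅ ∨ X = Set.univ := by
  have ho : ∀ x, M.opp x ∈ X ↔ x ∈ X := by
    intro x
    have : x ∉ M.bd X := by simp [hb]
    rw [mem_bd, not_not] at this
    exact this.symm
  refine isConnected_iff.mp hM X (fun x => ?_) ho
  rw [← opp_face_symm, ho, hX.inv]

theorem IsConnected.bd_nonempty (hM : M.IsConnected) {X : Set M.Dart} (hX : M.FaceInv X)
    (h0 : X.Nonempty) (h1 : Xᶜ.Nonempty) : (M.bd X).Nonempty := by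
  by_contra h
  rcases hM.eq_empty_or_univ hX (Set.not_nonempty_iff_eq_empty.mp h) with h | h
  · exact h0.ne_empty h
  · simp [h] at h1

/-- The boundary of a region has no vertex of degree one: along the rotation around a vertex, one
enters the region as often as one leaves it. -/
theorem FaceInv.exists_other {X : Set M.Dart} (hX : M.FaceInv X) {x : M.Dart} (hx : x ∈ M.bd X) :
    ∃ y ∈ M.bd X, y ≠ x ∧ M.SameOrigin x y := by
  have h : M.rot.SameCycle (M.rot x) x := Equiv.Perm.sameCycle_apply_left.mpr (.refl _ _)
  obtain ⟨z, hz, hQ, hs⟩ := h.exists_first_mem (T := M.bd X)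
    (Q := fun z => M.rot⁻¹ z ∈ X ↔ x ∈ X) (by simp) hx (by
      intro z hz hzb
      rw [mem_bd, not_not, opp_mem_iff_rot hX] at hzb
      rw [Equiv.Perm.inv_apply_apply, hzb, hz])
  refine ⟨z, hz, ?_, Equiv.Perm.sameCycle_apply_left.mp hs⟩
  rintro rfl
  rw [mem_bd, opp_mem_iff_rot hX] at hx
  exact hx hQ.symm

/-- The boundary of a region, if it is not empty, contains a simple cycle: a walk that does not
turn back can be continued until it meets itself. -/
theorem FaceInv.exists_isCycle {X : Set M.Dart} (hX : M.FaceInv X) (hne : (M.bd X).Nonempty) :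
    ∃ C k, M.IsCycle C k ∧ C ⊆ M.bd X := by
  classical
  obtain ⟨x0, hx0⟩ := hne
  choose nx hnx_mem hnx_ne hnx_so using fun x : M.bd X => hX.exists_other (opp_mem_bd.mpr x.2)
  let w : ℕ → M.bd X := Nat.rec ⟨x0, hx0⟩ (fun _ x => ⟨nx x, hnx_mem x⟩)
  have hstep : ∀ n, M.SameOrigin (M.opp (w n).1) (w (n + 1)).1 := fun n => hnx_so (w n)
  have hback : ∀ n, M.opp (w n).1 ≠ (w (n + 1)).1 := fun n => (hnx_ne (w n)).symm
  have hex : ∃ k, 0 < k ∧ ∃ i, M.SameOrigin (w i).1 (w (i + k)).1 := by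
    obtain ⟨i, j, hij, h⟩ := Finite.exists_ne_map_eq_of_infinite w
    rcases Nat.lt_or_gt_of_ne hij with hlt | hlt
    · exact ⟨j - i, by omega, i, by rw [Nat.add_sub_cancel' hlt.le, h]; exact .refl _⟩
    · exact ⟨i - j, by omega, j, by rw [Nat.add_sub_cancel' hlt.le, h]; exact .refl _⟩
  obtain ⟨k, ⟨hk, i, hi⟩, hmin⟩ : ∃ k, (0 < k ∧ ∃ i, M.SameOrigin (w i).1 (w (i + k)).1) ∧
      ∀ l, 0 < l → l < k → ∀ i, ¬ M.SameOrigin (w i).1 (w (i + l)).1 :=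
    ⟨Nat.find hex, Nat.find_spec hex, fun l hl hlt i h => Nat.find_min hex hlt ⟨hl, i, h⟩⟩
  have : NeZero k := ⟨hk.ne'⟩
  have hinj : ∀ a b : ℕ, a < k → b < k → M.SameOrigin (w (i + a)).1 (w (i + b)).1 → a = b := by
    intro a b ha hb h
    rcases lt_trichotomy a b with hlt | heq | hlt
    · exact absurd (by rwa [add_assoc, Nat.add_sub_cancel' hlt.le])
        (hmin (b - a) (by omega) (by omega) (i + a))
    · exact heq
    · exact absurd (by rw [add_assoc, Nat.add_sub_cancel' hlt.le]; exact h.symm)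
        (hmin (a - b) (by omega) (by omega) (i + b))
  have hnext : ∀ a : ℕ, a < k → M.SameOrigin (M.opp (w (i + a)).1) (w (i + (a + 1) % k)).1 := by
    intro a ha
    rcases Nat.lt_or_ge (a + 1) k with h | h
    · rw [Nat.mod_eq_of_lt h]; exact hstep _
    · obtain rfl : k = a + 1 := by omega
      rw [Nat.mod_self]
      exact (hstep _).trans hi.symm
  refine ⟨_, k, ⟨hk, fun a => (w (i + a.val)).1, ?_, ?_, ?_, rfl⟩, ?_⟩
  · intro a b h
    exact ZMod.val_injective k (hinj _ _ a.val_lt b.val_lt h)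
  · intro a b hab
    beta_reduce at hab
    have hab' : M.opp (w (i + b.val)).1 = (w (i + a.val)).1 := by rw [← hab, M.opp_opp]
    have h1 : (a.val + 1) % k = b.val :=
      hinj _ _ (Nat.mod_lt _ hk) b.val_lt ((hab ▸ hnext a.val a.val_lt).symm)
    have h2 : (b.val + 1) % k = a.val :=
      hinj _ _ (Nat.mod_lt _ hk) a.val_lt ((hab' ▸ hnext b.val b.val_lt).symm)
    have ha := a.val_lt
    have hb := b.val_lt
    rcases Nat.lt_or_ge (a.val + 1) k with h | h
    · rw [Nat.mod_eq_of_lt h] at h1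
      exact hback (i + a.val) (by rw [hab, ← h1, add_assoc])
    · rcases Nat.lt_or_ge (b.val + 1) k with h' | h'
      · rw [Nat.mod_eq_of_lt h'] at h2
        exact hback (i + b.val) (by rw [hab', ← h2, add_assoc])
      · have : a.val = b.val := by omega
        rw [this] at hab
        exact M.opp_ne _ hab
  · intro a
    have := hnext a.val a.val_lt
    beta_reduce
    rwa [ZMod.val_add, ZMod.val_one_eq_one_mod, Nat.add_mod_mod]
  · rintro y (⟨a, rfl⟩ | ⟨_, ⟨a, rfl⟩, rfl⟩)
    · exact (w _).2
    · exact opp_mem_bd.mpr (w _).2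

theorem IsCycle.ncard_eq {C : Set M.Dart} {k : ℕ} (h : M.IsCycle C k) : C.ncard = 2 * k := by
  obtain ⟨hk, c, hc, hopp, -, rfl⟩ := h
  have : NeZero k := ⟨hk.ne'⟩
  have hinj : Function.Injective c := fun i j hij => hc i j (hij ▸ .refl _)
  rw [Set.ncard_union_eq, Set.ncard_image_of_injective _ M.opp.injective, ← Set.image_univ,
    Set.ncard_image_of_injective _ hinj, Set.ncard_univ, Nat.card_zmod]
  · omega
  · rw [Set.disjoint_left]
    rintro _ ⟨i, rfl⟩ ⟨_, ⟨j, rfl⟩, h⟩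
    exact hopp _ _ h

theorem FaceInv.two_mul_le_ncard_bd {d : ℕ} (hg : ∀ C k, M.IsCycle C k → d ≤ k) {X : Set M.Dart}
    (hX : M.FaceInv X) (hne : (M.bd X).Nonempty) : 2 * d ≤ (M.bd X).ncard := by
  obtain ⟨C, k, hC, hsub⟩ := hX.exists_isCycle hne
  have := Set.ncard_le_ncard hsub
  have := hC.ncard_eq
  have := hg C k hC
  omega

/-- In a map of girth at least `d`, a region with at most `d` boundary edges is bounded by a
simple cycle of length `d`. -/
theorem FaceInv.isCycle_bd {d : ℕ} (hg : ∀ C k, M.IsCycle C k → d ≤ k) {X : Set M.Dart}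
    (hX : M.FaceInv X) (hne : (M.bd X).Nonempty) (hle : (M.bd X).ncard ≤ 2 * d) :
    M.IsCycle (M.bd X) d := by
  obtain ⟨C, k, hC, hsub⟩ := hX.exists_isCycle hne
  have h1 := Set.ncard_le_ncard hsub
  have h2 := hC.ncard_eq
  have h3 := hg C k hC
  obtain rfl : k = d := by omega
  rwa [← Set.eq_of_subset_of_ncard_le hsub (by omega)]

theorem ncard_bd_inter_add_union (X Y : Set M.Dart) :
    (M.bd (X ∩ Y)).ncard + (M.bd (X ∪ Y)).ncard ≤ (M.bd X).ncard + (M.bd Y).ncard := by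
  rw [← Set.ncard_union_add_ncard_inter (M.bd (X ∩ Y)), ← Set.ncard_union_add_ncard_inter (M.bd X)]
  refine add_le_add (Set.ncard_le_ncard ?_) (Set.ncard_le_ncard ?_) <;> intro x <;>
    simp only [Set.mem_union, Set.mem_inter_iff, mem_bd] <;> tauto

theorem FaceInv.bd_inter_isCycle {d : ℕ} (hg : ∀ C k, M.IsCycle C k → d ≤ k)
    {X Y : Set M.Dart} (hX : M.FaceInv X) (hY : M.FaceInv Y)
    (hXc : M.IsCycle (M.bd X) d) (hYc : M.IsCycle (M.bd Y) d)
    (h1 : (M.bd (X ∩ Y)).Nonempty) (h2 : (M.bd (X ∪ Y)).Nonempty) : M.IsCycle (M.bd (X ∩ Y)) d := by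
  refine (hX.inter hY).isCycle_bd hg h1 ?_
  have := ncard_bd_inter_add_union X Y
  have := (hX.union hY).two_mul_le_ncard_bd hg h2
  have := hXc.ncard_eq
  have := hYc.ncard_eq
  omega

end CombMap

namespace CombMap

variable {M : CombMap}

/-! ### Contours -/

/-- `c` runs cyclically along the boundary of the region `X`, with `X` on its left, and this
boundary is a simple cycle. -/
structure Contour (M : CombMap) (X : Set M.Dart) {k : ℕ} (c : ZMod k → M.Dart) : Prop where
  simple : ∀ i j, M.SameOrigin (c i) (c j) → i = j
  next : ∀ i, M.SameOrigin (M.opp (c i)) (c (i + 1))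
  mem : ∀ i, c i ∈ X
  opp_notMem : ∀ i, M.opp (c i) ∉ X
  surj : ∀ x ∈ X, M.opp x ∉ X → ∃ i, c i = x

theorem Contour.compl {X : Set M.Dart} {k : ℕ} {c : ZMod k → M.Dart} (h : M.Contour X c) :
    M.Contour Xᶜ (fun i => M.opp (c (-i))) where
  simple i j hij := by
    have h1 := h.simple _ _ ((h.next (-i)).symm.trans (hij.trans (h.next (-j))))
    simpa using h1
  next i := by
    rw [M.opp_opp]
    have := (h.next (-(i + 1))).symm
    rwa [show -(i + 1) + 1 = -i by ring] at this
  mem i := h.opp_notMem _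
  opp_notMem i := by
    rw [M.opp_opp, Set.notMem_compl_iff]
    exact h.mem _
  surj x hx hx' := by
    rw [Set.notMem_compl_iff] at hx'
    obtain ⟨i, hi⟩ := h.surj (M.opp x) hx' (by rwa [M.opp_opp])
    exact ⟨-i, by rw [neg_neg, hi, M.opp_opp]⟩

theorem Contour.injective {X : Set M.Dart} {k : ℕ} {c : ZMod k → M.Dart} (h : M.Contour X c) :
    Function.Injective c := fun i j hij => h.simple i j (hij ▸ .refl _)

theorem Contour.bd_eq {X : Set M.Dart} {k : ℕ} {c : ZMod k → M.Dart} (h : M.Contour X c) :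
    M.bd X = Set.range c ∪ M.opp '' Set.range c := by
  ext x
  constructor
  · intro hx
    by_cases hxX : x ∈ X
    · exact .inl (h.surj x hxX fun h' => hx (iff_of_true hxX h'))
    · have h' : M.opp x ∈ X := by
        by_contra h'
        exact hx (iff_of_false hxX h')
      exact .inr ⟨M.opp x, h.surj _ h' (by rwa [M.opp_opp]), M.opp_opp x⟩
  · have key : ∀ i, c i ∈ M.bd X := fun i hi => h.opp_notMem i (hi.mp (h.mem i))
    rintro (⟨i, rfl⟩ | ⟨_, ⟨i, rfl⟩, rfl⟩)
    · exact key i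
    · exact opp_mem_bd.mpr (key i)

theorem Contour.isCycle {X : Set M.Dart} {k : ℕ} (hk : 0 < k) {c : ZMod k → M.Dart}
    (h : M.Contour X c) : M.IsCycle (M.bd X) k :=
  ⟨hk, c, h.simple, fun i j hij => h.opp_notMem i (hij ▸ h.mem j), h.next, h.bd_eq⟩

/-- At each vertex at most one boundary edge leaves with the region `X` on its left. -/
theorem Contour.eq_of_sameOrigin {X : Set M.Dart} {k : ℕ} {c : ZMod k → M.Dart}
    (h : M.Contour X c) {x y : M.Dart} (hx : x ∈ X) (hx' : M.opp x ∉ X) (hy : y ∈ X)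
    (hy' : M.opp y ∉ X) (hxy : M.SameOrigin x y) : x = y := by
  obtain ⟨i, rfl⟩ := h.surj x hx hx'
  obtain ⟨j, rfl⟩ := h.surj y hy hy'
  rw [h.simple i j hxy]

theorem Contour.eq_of_sameOrigin' {X : Set M.Dart} {k : ℕ} {c : ZMod k → M.Dart}
    (h : M.Contour X c) {x y : M.Dart} (hx : x ∉ X) (hx' : M.opp x ∈ X) (hy : y ∉ X)
    (hy' : M.opp y ∈ X) (hxy : M.SameOrigin x y) : x = y :=
  h.compl.eq_of_sameOrigin hx (Set.notMem_compl_iff.mpr hx') hy (Set.notMem_compl_iff.mpr hy') hxy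

/-! ### The sides of a cycle -/

theorem SameSide.refl (C : Set M.Dart) (x : M.Dart) : M.SameSide C x x := Relation.EqvGen.refl x

theorem SameSide.symm {C : Set M.Dart} {x y : M.Dart} (h : M.SameSide C x y) : M.SameSide C y x :=
  Relation.EqvGen.symm _ _ h

theorem SameSide.trans {C : Set M.Dart} {x y z : M.Dart} (h : M.SameSide C x y)
    (h' : M.SameSide C y z) : M.SameSide C x z :=
  Relation.EqvGen.trans _ _ _ h h'

theorem sameSide_face (C : Set M.Dart) (x : M.Dart) : M.SameSide C x (M.face x) :=
  Relation.EqvGen.rel _ _ (.inl rfl)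

theorem sameSide_opp {C : Set M.Dart} {x : M.Dart} (hx : x ∉ C) : M.SameSide C x (M.opp x) :=
  Relation.EqvGen.rel _ _ (.inr ⟨hx, rfl⟩)

theorem SameSide.mem_iff {C X : Set M.Dart} (hX : M.FaceInv X) (hb : M.bd X ⊆ C) {x y : M.Dart}
    (h : M.SameSide C x y) : x ∈ X ↔ y ∈ X := by
  induction h with
  | rel x y h =>
    rcases h with rfl | ⟨hx, rfl⟩
    · exact (hX x).symm
    · by_contra h
      exact hx (hb h)
  | refl x => rfl
  | symm x y _ ih => exact ih.symm
  | trans x y z _ _ ih ih' => exact ih.trans ih'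

theorem faceInv_sameSide (C : Set M.Dart) (x : M.Dart) : M.FaceInv {y | M.SameSide C x y} :=
  fun y => ⟨fun h => SameSide.trans h (sameSide_face C y).symm,
    fun h => SameSide.trans h (sameSide_face C y)⟩

theorem bd_sameSide_subset (C : Set M.Dart) (x : M.Dart) :
    M.bd {y | M.SameSide C x y} ⊆ C := by
  intro y hy
  by_contra hyC
  exact hy ⟨fun h => SameSide.trans h (sameSide_opp hyC),
    fun h => SameSide.trans h (sameSide_opp hyC).symm⟩

/-- If exactly two darts of `C` leave a vertex, the faces that follow one of them clockwise up to
the other one are on the same side of `C`. -/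
theorem sameSide_of_sameOrigin {C : Set M.Dart} {u v : M.Dart} (hne : u ≠ v)
    (huv : M.SameOrigin u v) (honly : ∀ z ∈ C, M.SameOrigin u z → z = u ∨ z = v) :
    M.SameSide C (M.opp u) v := by
  have h : (M.rot⁻¹).SameCycle u v := Equiv.Perm.sameCycle_inv.mpr huv
  refine h.induction_until (Q := fun z => M.SameSide C (M.opp u) z) hne ?_ ?_
  · rw [← face_opp]
    exact sameSide_face _ _
  · intro z hz hzu hzv hQ
    have hzC : z ∉ C := fun hC => by
      rcases honly z hC (Equiv.Perm.sameCycle_inv.mp hz) with h | h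
      · exact hzu h
      · exact hzv h
    rw [← face_opp]
    exact hQ.trans ((sameSide_opp hzC).trans (sameSide_face _ _))

theorem sameSide_of_cycle {k : ℕ} {c : ZMod k → M.Dart}
    (hs : ∀ i j, M.SameOrigin (c i) (c j) → i = j) (ho : ∀ i j, M.opp (c i) ≠ c j)
    (hn : ∀ i, M.SameOrigin (M.opp (c i)) (c (i + 1))) (i : ZMod k) :
    M.SameSide (Set.range c ∪ M.opp '' Set.range c) (c i) (c (i + 1)) ∧
      M.SameSide (Set.range c ∪ M.opp '' Set.range c) (M.opp (c i)) (M.opp (c (i + 1))) := by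
  have honly : ∀ z ∈ Set.range c ∪ M.opp '' Set.range c, M.SameOrigin (c (i + 1)) z →
      z = c (i + 1) ∨ z = M.opp (c i) := by
    rintro z (⟨j, rfl⟩ | ⟨_, ⟨j, rfl⟩, rfl⟩) h
    · exact .inl (by rw [hs _ _ h])
    · have := hs _ _ (h.trans (hn j))
      exact .inr (by rw [add_right_cancel this])
  constructor
  · have := sameSide_of_sameOrigin (ho i (i + 1)) (hn i)
      (fun z hz h => (honly z hz ((hn i).symm.trans h)).symm)
    rwa [M.opp_opp] at this
  · exact (sameSide_of_sameOrigin (ho i (i + 1)).symm (hn i).symm honly).symm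

/-- A simple cycle that bounds a region can be directed so as to have this region on its left. -/
theorem IsCycle.exists_contour {X : Set M.Dart} {k : ℕ} (h : M.IsCycle (M.bd X) k)
    (hX : M.FaceInv X) : ∃ c : ZMod k → M.Dart, M.Contour X c := by
  obtain ⟨hk, c, hs, ho, hn, hC⟩ := h
  have : NeZero k := ⟨hk.ne'⟩
  have hmem : ∀ i, c i ∈ M.bd X := fun i => hC ▸ .inl ⟨i, rfl⟩
  have hstep := sameSide_of_cycle hs ho hn
  rw [← hC] at hstep
  have h1 : ∀ i, c i ∈ X ↔ c 0 ∈ X := ZMod.induction_add_one 0 Iff.rfl fun i hi =>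
    ((hstep i).1.mem_iff hX subset_rfl).symm.trans hi
  have key : ∀ Y : Set M.Dart, M.bd X = M.bd Y → (∀ i, c i ∈ Y ↔ c 0 ∈ Y) → c 0 ∈ Y →
      M.Contour Y c := by
    intro Y hXY h1 h0
    have hmemY : ∀ i, c i ∈ Y := fun i => (h1 i).mpr h0
    have hopp : ∀ i, M.opp (c i) ∉ Y := fun i hi =>
      (hXY ▸ hmem i : c i ∈ M.bd Y) (iff_of_true (hmemY i) hi)
    refine ⟨hs, hn, hmemY, hopp, ?_⟩
    intro x hx hx'
    have : x ∈ M.bd X := hXY ▸ fun h => hx' (h.mp hx)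
    rw [hC] at this
    rcases this with h | ⟨_, ⟨i, rfl⟩, rfl⟩
    · exact h
    · exact absurd hx (hopp i)
  by_cases h0 : c 0 ∈ X
  · exact ⟨c, key X rfl h1 h0⟩
  · have := (key Xᶜ (bd_compl X).symm (fun i => not_congr (h1 i)) h0).compl
    rw [compl_compl] at this
    exact ⟨_, this⟩

/-- In a connected map, a region bounded by a simple cycle is a side of this cycle. -/
theorem FaceInv.sameSide (hM : M.IsConnected) {X : Set M.Dart} (hX : M.FaceInv X) {k : ℕ}
    (hC : M.IsCycle (M.bd X) k) {x y : M.Dart} (hx : x ∈ X) :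
    M.SameSide (M.bd X) x y ↔ y ∈ X := by
  refine ⟨fun h => (h.mem_iff hX subset_rfl).mp hx, fun hy => ?_⟩
  by_contra hxy
  obtain ⟨c, hc⟩ := hC.exists_contour hX
  have : NeZero k := ⟨hC.1.ne'⟩
  have hstep := sameSide_of_cycle hc.simple (fun i j hij => hc.opp_notMem i (hij ▸ hc.mem j))
    hc.next
  rw [← hc.bd_eq] at hstep
  have key : ∀ z ∈ X, M.SameSide (M.bd X) z (c 0) := by
    intro z hz
    have hne : (M.bd {y | M.SameSide (M.bd X) z y}).Nonempty := by
      refine hM.bd_nonempty (faceInv_sameSide _ _) ⟨z, SameSide.refl _ _⟩ ⟨M.opp (c 0), fun h => ?_⟩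
      exact hc.opp_notMem 0 ((SameSide.mem_iff hX subset_rfl h).mp hz)
    obtain ⟨w, hw⟩ := hne
    have hw' := bd_sameSide_subset _ _ hw
    have hi : ∃ i, M.SameSide (M.bd X) z (c i) := by
      rw [hc.bd_eq] at hw'
      rcases hw' with ⟨i, rfl⟩ | ⟨_, ⟨i, rfl⟩, rfl⟩
      · refine ⟨i, by_contra fun h => hw (iff_of_false h fun h' => ?_)⟩
        exact hc.opp_notMem i ((SameSide.mem_iff hX subset_rfl h').mp hz)
      · refine ⟨i, by_contra fun h => hw (iff_of_false (fun h' => ?_) fun h' => ?_)⟩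
        · exact hc.opp_notMem i ((SameSide.mem_iff hX subset_rfl h').mp hz)
        · have h'' : M.SameSide (M.bd X) z (M.opp (M.opp (c i))) := h'
          rw [M.opp_opp] at h''
          exact h h''
    obtain ⟨i, hi⟩ := hi
    have hall : ∀ j, M.SameSide (M.bd X) z (c j) := ZMod.induction_add_one i hi fun j hj =>
      hj.trans (hstep j).1
    exact hall 0
  exact hxy ((key x hx).trans (key y hy).symm)

theorem FaceInv.side_eq (hM : M.IsConnected) {X f : Set M.Dart} (hX : M.FaceInv X) {k : ℕ}
    (hC : M.IsCycle (M.bd X) k) (hf : f.Nonempty) (hfX : f ⊆ X) : M.side (M.bd X) f = X := by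
  ext y
  constructor
  · rintro ⟨x, hx, h⟩
    exact (hX.sameSide hM hC (hfX hx)).mp h
  · intro hy
    obtain ⟨x, hx⟩ := hf
    exact ⟨x, hx, (hX.sameSide hM hC (hfX hx)).mpr hy⟩

end CombMap

namespace CombMap

variable {M : CombMap}

/-! ### Euler's relation and exactness modulo 2 -/

/-- The first cohomology modulo 2 of the surface vanishes: every function on the edges whose sum along
each face is zero is the coboundary of a function on the vertices. The sums along the faces are
encoded as the pairings with the functions of the darts that are constant on the faces. -/
def Exact (M : CombMap) : Prop :=
  ∀ w : M.Dart → ZMod 2, (∀ x, w (M.opp x) = w x) →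
    (∀ F : M.Dart → ZMod 2, (∀ x, F (M.face x) = F x) → ∑ z, F z * w z = 0) →
    ∃ f : M.Dart → ZMod 2, (∀ x, f (M.rot x) = f x) ∧ ∀ x, w x = f x + f (M.opp x)

theorem sum_opp_eq_zero (w : M.Dart → ZMod 2) (hw : ∀ x, w (M.opp x) = w x) : ∑ z, w z = 0 := by
  refine Finset.sum_involution (fun x _ => M.opp x) (fun x _ => ?_) (fun x _ _ => M.opp_ne x)
    (fun _ _ => Finset.mem_univ _) (fun x _ => M.opp_opp x)
  rw [hw, CharTwo.add_self_eq_zero]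

/-- Coboundaries are orthogonal to the functions of the faces. -/
theorem sum_mul_coboundary (F f : M.Dart → ZMod 2) (hF : ∀ x, F (M.face x) = F x)
    (hf : ∀ x, f (M.rot x) = f x) : ∑ z, F z * (f z + f (M.opp z)) = 0 := by
  have h1 : ∑ z, F z * f (M.opp z) = ∑ z, F z * f z := by
    rw [← Equiv.sum_comp M.face (fun z => F z * f z)]
    refine Finset.sum_congr rfl fun z _ => ?_
    rw [hF, ← rot_face, hf]
  simp only [mul_add, Finset.sum_add_distrib, h1, CharTwo.add_self_eq_zero]

open Classical in
theorem sum_mul_single_edge (F : M.Dart → ZMod 2) (x : M.Dart) :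
    ∑ z, F z * ((Pi.single x 1 + Pi.single (M.opp x) 1 : M.Dart → ZMod 2) z) =
      F x + F (M.opp x) := by
  simp [mul_add, Finset.sum_add_distrib, Pi.single_apply]

open Classical in
theorem single_edge_opp (x z : M.Dart) :
    (Pi.single x 1 + Pi.single (M.opp x) 1 : M.Dart → ZMod 2) (M.opp z) =
      (Pi.single x 1 + Pi.single (M.opp x) 1 : M.Dart → ZMod 2) z := by
  have h : M.opp z = x ↔ z = M.opp x := by
    constructor
    · rintro rfl; rw [M.opp_opp]
    · rintro rfl; rw [M.opp_opp]
  simp [Pi.single_apply, h, add_comm]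

/-- The space of the functions modulo 2 that are constant on the cycles of `σ`. -/
def invariants {α : Type} (σ : Equiv.Perm α) : Submodule (ZMod 2) (α → ZMod 2) where
  carrier := {f | ∀ x, f (σ x) = f x}
  add_mem' hf hg x := by simp [hf x, hg x]
  zero_mem' _ := rfl
  smul_mem' c f hf x := by simp [hf x]

theorem finrank_invariants {α : Type} [Finite α] (σ : Equiv.Perm α) :
    Module.finrank (ZMod 2) (invariants σ) =
      Nat.card (Quotient (Equiv.Perm.SameCycle.setoid σ)) := by
  classical
  have := Fintype.ofFinite (Quotient (Equiv.Perm.SameCycle.setoid σ))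
  let q : α → Quotient (Equiv.Perm.SameCycle.setoid σ) := Quotient.mk _
  let L : (Quotient (Equiv.Perm.SameCycle.setoid σ) → ZMod 2) →ₗ[ZMod 2] (α → ZMod 2) :=
    LinearMap.funLeft _ _ q
  have hinj : Function.Injective L :=
    LinearMap.funLeft_injective_of_surjective _ _ _ Quotient.mk_surjective
  have hrange : LinearMap.range L = invariants σ := by
    ext f
    constructor
    · rintro ⟨g, rfl⟩ x
      exact congrArg g (Quotient.sound (Equiv.Perm.sameCycle_apply_left.mpr (.refl _ _)))
    · intro hf
      refine ⟨Quotient.lift f ?_, rfl⟩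
      intro a b hab
      obtain ⟨n, -, rfl⟩ := Equiv.Perm.SameCycle.exists_pow_eq' hab
      clear hab
      induction n with
      | zero => simp
      | succ n ih => rw [pow_succ', Equiv.Perm.mul_apply, hf, ih]
  rw [← hrange, LinearMap.finrank_range_of_inj hinj, Module.finrank_fintype_fun_eq_card,
    Nat.card_eq_fintype_card]

/-- `f ↦ f + f ∘ opp`. -/
noncomputable def edgeSum (M : CombMap) : (M.Dart → ZMod 2) →ₗ[ZMod 2] (M.Dart → ZMod 2) :=
  LinearMap.id + LinearMap.funLeft _ _ M.opp

theorem edgeSum_apply (f : M.Dart → ZMod 2) (x : M.Dart) :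
    M.edgeSum f x = f x + f (M.opp x) := rfl

/-- The pairing of the functions of the edges with the functions of the faces. -/
noncomputable def pairing (M : CombMap) :
    invariants M.opp →ₗ[ZMod 2] invariants M.face →ₗ[ZMod 2] ZMod 2 :=
  LinearMap.mk₂ (ZMod 2) (fun w F => ∑ z, F.1 z * w.1 z)
    (by intros; simp [mul_add, Finset.sum_add_distrib])
    (by intros; simp [Finset.mul_sum, mul_left_comm])
    (by intros; simp [add_mul, Finset.sum_add_distrib])
    (by intros; simp [Finset.mul_sum, mul_assoc])

theorem finrank_range_flip {K V W : Type*} [Field K] [AddCommGroup V] [Module K V]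
    [AddCommGroup W] [Module K W] [FiniteDimensional K V] [FiniteDimensional K W]
    (P : V →ₗ[K] W →ₗ[K] K) :
    Module.finrank K (LinearMap.range P.flip) = Module.finrank K (LinearMap.range P) := by
  have h : P.flip = (LinearMap.dualMap P) ∘ₗ (Module.evalEquiv K W).toLinearMap := by
    ext w v
    rfl
  rw [h, LinearMap.range_comp, LinearEquiv.range, Submodule.map_top,
    LinearMap.finrank_range_dualMap_eq_finrank_range]

theorem IsConnected.eq_const (hM : M.IsConnected) {f : M.Dart → ZMod 2}
    (h1 : ∀ x, f (M.rot x) = f x) (h2 : ∀ x, f x + f (M.opp x) = 0) (x y : M.Dart) :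
    f x = f y := by
  have h2' : ∀ x, f (M.opp x) = f x := fun x => (CharTwo.add_eq_zero.mp (h2 x)).symm
  rcases isConnected_iff.mp hM {z | f z = f y} (fun z => by simp [h1]) (fun z => by simp [h2'])
    with h | h
  · exact absurd (show y ∈ {z | f z = f y} from rfl) (by simp [h])
  · exact (h ▸ Set.mem_univ x : x ∈ {z | f z = f y})

theorem finrank_eq_one_of_const {α : Type} [Nonempty α] {V : Type*} [AddCommGroup V]
    [Module (ZMod 2) V] (φ : V →ₗ[ZMod 2] (α → ZMod 2)) (hφ : Function.Injective φ)
    (h1 : ∃ v, φ v = 1) (hc : ∀ v x y, φ v x = φ v y) : Module.finrank (ZMod 2) V = 1 := by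
  obtain ⟨v, hv⟩ := h1
  obtain ⟨x⟩ := ‹Nonempty α›
  have hv0 : v ≠ 0 := by
    rintro rfl
    have := congrFun hv x
    simp at this
  rw [finrank_eq_one_iff_of_nonzero' v hv0]
  refine fun w => ⟨φ w x, hφ ?_⟩
  ext y
  simp [hv, hc w x y]

/-- For a connected map, Euler's relation says that the first cohomology modulo 2 vanishes: the
coboundaries have dimension `V - 1`, the cocycles `E - (F - 1)`. -/
theorem exact_iff_isEuler (hM : M.IsConnected) [Nonempty M.Dart] : M.Exact ↔ M.IsEuler := by
  classical
  set B : Submodule (ZMod 2) (M.Dart → ZMod 2) := (invariants M.rot).map M.edgeSum with hB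
  set Z : Submodule (ZMod 2) (M.Dart → ZMod 2) :=
    (LinearMap.ker M.pairing).map (invariants M.opp).subtype with hZ
  have hBZ : B ≤ Z := by
    rintro _ ⟨f, hf, rfl⟩
    refine ⟨⟨M.edgeSum f, fun x => ?_⟩, ?_, rfl⟩
    · rw [edgeSum_apply, edgeSum_apply, M.opp_opp, add_comm]
    · refine LinearMap.ext fun F => ?_
      exact sum_mul_coboundary F.1 f F.2 hf
  have hexact : M.Exact ↔ Z ≤ B := by
    constructor
    · rintro h _ ⟨w, hw, rfl⟩
      obtain ⟨f, hf, hwf⟩ := h w.1 w.2 (fun F hF => LinearMap.congr_fun hw ⟨F, hF⟩)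
      exact ⟨f, hf, funext fun x => (hwf x).symm⟩
    · intro h w hw hwF
      obtain ⟨f, hf, hwf⟩ := h (show w ∈ Z from
        ⟨⟨w, hw⟩, LinearMap.ext fun F => hwF F.1 F.2, rfl⟩)
      exact ⟨f, hf, fun x => (congrFun hwf x).symm⟩
  have hdB : Module.finrank (ZMod 2) B + 1 = Module.finrank (ZMod 2) (invariants M.rot) := by
    rw [← LinearMap.finrank_range_add_finrank_ker (M.edgeSum.domRestrict (invariants M.rot)),
      LinearMap.range_domRestrict]
    congr 1
    symm
    refine finrank_eq_one_of_const
      (V := LinearMap.ker (M.edgeSum.domRestrict (invariants M.rot))) ((invariants M.rot).subtype ∘ₗ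
      Submodule.subtype _)
      ((Submodule.subtype_injective _).comp (Submodule.subtype_injective _))
      ⟨⟨⟨1, fun _ => rfl⟩, ?_⟩, rfl⟩ ?_
    · ext x
      exact CharTwo.add_self_eq_zero _
    · intro v
      exact hM.eq_const v.1.2 (fun x => congrFun v.2 x)
  have hdF : Module.finrank (ZMod 2) (LinearMap.range M.pairing) + 1 =
      Module.finrank (ZMod 2) (invariants M.face) := by
    rw [← finrank_range_flip, ← LinearMap.finrank_range_add_finrank_ker M.pairing.flip]
    congr 1
    symm
    refine finrank_eq_one_of_const
      (V := LinearMap.ker M.pairing.flip) ((invariants M.face).subtype ∘ₗ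
      Submodule.subtype _)
      ((Submodule.subtype_injective _).comp (Submodule.subtype_injective _))
      ⟨⟨⟨1, fun _ => rfl⟩, ?_⟩, rfl⟩ ?_
    · refine LinearMap.ext fun w => ?_
      have := sum_opp_eq_zero w.1 w.2
      simpa [pairing] using this
    · intro v
      have h2 : ∀ x, v.1.1 x + v.1.1 (M.opp x) = 0 := fun x =>
        (sum_mul_single_edge v.1.1 x).symm.trans
          (LinearMap.congr_fun v.2 ⟨_, fun z => single_edge_opp x z⟩)
      refine hM.eq_const (fun x => ?_) h2
      have h3 := v.1.2 (M.face⁻¹ x)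
      rw [Equiv.Perm.apply_inv_apply] at h3
      rw [← opp_face_symm]
      exact (CharTwo.add_eq_zero.mp (h2 _)).symm.trans h3.symm
  have hdZ : Module.finrank (ZMod 2) (LinearMap.range M.pairing) + Module.finrank (ZMod 2) Z =
      Module.finrank (ZMod 2) (invariants M.opp) := by
    rw [← LinearMap.finrank_range_add_finrank_ker M.pairing, hZ, Submodule.finrank_map_subtype_eq]
  rw [finrank_invariants] at hdB hdF hdZ
  have hle := Submodule.finrank_mono hBZ
  rw [hexact, IsEuler, ← hdB, ← hdF, ← hdZ]
  constructor
  · intro h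
    have := Submodule.finrank_mono h
    omega
  · intro h
    exact (Submodule.eq_of_le_of_finrank_eq hBZ (by omega)).ge

/-! ### Jordan's theorem -/

/-- A path through faces that avoids `C` crosses a set of edges whose indicator function pairs with
the functions of the faces as the difference of the two ends does. -/
theorem SameSide.exists_dual_path {C : Set M.Dart} {x y : M.Dart} (h : M.SameSide C x y)
    (hC : ∀ z, M.opp z ∈ C ↔ z ∈ C) :
    ∃ w : M.Dart → ZMod 2, (∀ z, w (M.opp z) = w z) ∧ (∀ z ∈ C, w z = 0) ∧
      ∀ F : M.Dart → ZMod 2, (∀ z, F (M.face z) = F z) → ∑ z, F z * w z = F x + F y := by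
  classical
  induction h with
  | rel x y h =>
    rcases h with rfl | ⟨hx, rfl⟩
    · exact ⟨0, fun _ => rfl, fun _ _ => rfl,
        fun F hF => by simp [hF, CharTwo.add_self_eq_zero]⟩
    · refine ⟨_, single_edge_opp x, fun z hz => ?_, fun F _ => sum_mul_single_edge F x⟩
      have h1 : z ≠ x := fun h => hx (h ▸ hz)
      have h2 : z ≠ M.opp x := fun h => hx ((hC x).mp (h ▸ hz))
      simp [h1, h2]
  | refl x => exact ⟨0, fun _ => rfl, fun _ _ => rfl, fun F _ => by simp [CharTwo.add_self_eq_zero]⟩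
  | symm x y _ ih =>
    obtain ⟨w, h1, h2, h3⟩ := ih
    exact ⟨w, h1, h2, fun F hF => by rw [h3 F hF, add_comm]⟩
  | trans x y z _ _ ih ih' =>
    obtain ⟨w, h1, h2, h3⟩ := ih
    obtain ⟨w', h1', h2', h3'⟩ := ih'
    refine ⟨w + w', fun z => by simp [h1, h1'], fun z hz => by simp [h2 z hz, h2' z hz],
      fun F hF => ?_⟩
    simp only [Pi.add_apply, mul_add, Finset.sum_add_distrib, h3 F hF, h3' F hF]
    rw [add_assoc, ← add_assoc (F y), CharTwo.add_self_eq_zero, zero_add]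

/-- Jordan's theorem: in a planar map, every simple cycle bounds a region. Otherwise a closed dual
curve would cross it exactly once, and its cocycle would not be a coboundary. -/
theorem Exact.exists_region (hM : M.Exact) {C : Set M.Dart} {k : ℕ} (hC : M.IsCycle C k) :
    ∃ X, M.FaceInv X ∧ M.bd X = C := by
  classical
  obtain ⟨hk, c, hs, ho, hn, rfl⟩ := hC
  have : NeZero k := ⟨hk.ne'⟩
  set C := Set.range c ∪ M.opp '' Set.range c with hCdef
  have hmem : ∀ i, c i ∈ C := fun i => .inl ⟨i, rfl⟩
  have hmem' : ∀ i, M.opp (c i) ∈ C := fun i => .inr ⟨c i, ⟨i, rfl⟩, rfl⟩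
  have hCopp : ∀ z, M.opp z ∈ C ↔ z ∈ C := by
    have h1 : ∀ z ∈ C, M.opp z ∈ C := by
      rintro _ (⟨i, rfl⟩ | ⟨_, ⟨i, rfl⟩, rfl⟩)
      · exact hmem' i
      · rw [M.opp_opp]; exact hmem i
    exact fun z => ⟨fun h => by simpa [M.opp_opp] using h1 _ h, h1 z⟩
  have hinj : Function.Injective c := fun i j hij => hs i j (hij ▸ .refl _)
  have hstep := sameSide_of_cycle hs ho hn
  rw [← hCdef] at hstep
  have hJ : ¬ M.SameSide C (c 0) (M.opp (c 0)) := by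
    intro h
    obtain ⟨w, h1, h2, h3⟩ := h.exists_dual_path hCopp
    set e : M.Dart → ZMod 2 := Pi.single (c 0) 1 + Pi.single (M.opp (c 0)) 1 with he
    obtain ⟨f, hf, hwf⟩ := hM (w + e)
      (fun z => by rw [Pi.add_apply, Pi.add_apply, h1, he, single_edge_opp])
      (fun F hF => by
        simp only [Pi.add_apply, mul_add, Finset.sum_add_distrib, h3 F hF]
        rw [← CharTwo.add_self_eq_zero (F (c 0) + F (M.opp (c 0)))]
        congr 1
        exact sum_mul_single_edge F (c 0))
    have hsum : ∑ i, (w + e) (c i) = 1 := by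
      have : ∀ i, (w + e) (c i) = if i = 0 then 1 else 0 := by
        intro i
        have h4 : c i ≠ M.opp (c 0) := (ho 0 i).symm
        simp [h2 _ (hmem i), he, Pi.single_apply, h4, hinj.eq_iff]
      simp [this]
    have hsum' : ∑ i, (w + e) (c i) = 0 := by
      have h5 : ∀ i, f (M.opp (c i)) = f (c (i + 1)) := by
        intro i
        have := (hn i).mem_iff (X := {z | f z = f (M.opp (c i))}) (fun z => by simp [hf])
        exact (this.mpr rfl).symm
      have h6 : ∑ i, f (c (i + 1)) = ∑ i, f (c i) :=
        Equiv.sum_comp (Equiv.addRight (1 : ZMod k)) (fun i => f (c i))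
      simp only [hwf, h5, Finset.sum_add_distrib, h6]
      exact CharTwo.add_self_eq_zero _
    rw [hsum] at hsum'
    exact one_ne_zero hsum'
  refine ⟨{y | M.SameSide C (c 0) y}, faceInv_sameSide _ _, (bd_sameSide_subset _ _).antisymm ?_⟩
  have hc : ∀ i, M.SameSide C (c 0) (c i) := ZMod.induction_add_one 0 (.refl _ _)
    fun i hi => hi.trans (hstep i).1
  have hc' : ∀ i, M.SameSide C (M.opp (c 0)) (M.opp (c i)) := ZMod.induction_add_one 0 (.refl _ _)
    fun i hi => hi.trans (hstep i).2
  have key : ∀ i, c i ∈ M.bd {y | M.SameSide C (c 0) y} := fun i h =>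
    hJ ((h.mp (hc i)).trans (hc' i).symm)
  rintro _ (⟨i, rfl⟩ | ⟨_, ⟨i, rfl⟩, rfl⟩)
  · exact key i
  · exact opp_mem_bd.mpr (key i)

end CombMap

namespace CombMap

variable {M N : CombMap}

/-! ### Parts of a map -/

/-- `φ` identifies `N` with the map cut out of `M` by the region `R`: the darts of `N` are those of
the edges incident to `R`, the faces of `R` are faces of `N`, and the other darts of `N` (the outer
ones) follow each other around the faces of `N` so that vertices match. -/
structure IsPart (N M : CombMap) (R : Set M.Dart) (φ : N.Dart → M.Dart) : Prop where
  faceInv : M.FaceInv R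
  inj : Function.Injective φ
  map_opp : ∀ x, φ (N.opp x) = M.opp (φ x)
  edge : ∀ x, φ x ∈ R ∨ M.opp (φ x) ∈ R
  surj : ∀ z ∈ R, ∃ x, φ x = z
  map_face : ∀ x, φ x ∈ R → φ (N.face x) = M.face (φ x)
  face_notMem : ∀ x, φ x ∉ R → φ (N.face x) ∉ R
  face_sameOrigin : ∀ x, φ x ∉ R → M.SameOrigin (M.opp (φ x)) (φ (N.face x))

theorem firstReturn_eq_of_mem {α : Type} [Finite α] (σ : Equiv.Perm α) (S : Set α) (x : S)
    (h : σ x.1 ∈ S) : (firstReturn σ S x).1 = σ x.1 := by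
  classical
  have h1 : returnTime σ S x = 1 :=
    le_antisymm (Nat.find_min' _ ⟨one_pos, by simpa using h⟩)
      (Nat.find_spec (exists_pow_mem σ S x)).1
  change (σ ^ returnTime σ S x) x.1 = _
  rw [h1, pow_one]

theorem firstReturn_sameCycle {α : Type} [Finite α] (σ : Equiv.Perm α) (S : Set α) (x : S) :
    σ.SameCycle x.1 (firstReturn σ S x).1 :=
  ⟨(returnTime σ S x : ℕ), by rw [zpow_natCast]; rfl⟩

theorem subIncl_rot_of_mem {R : Set M.Dart} (x : (M.sub R).Dart)
    (h : M.rot (M.subIncl R x) ∈ M.edgesOf R) :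
    M.subIncl R ((M.sub R).rot x) = M.rot (M.subIncl R x) :=
  firstReturn_eq_of_mem M.rot (M.edgesOf R) x h

theorem FaceInv.isPart_sub {R : Set M.Dart} (hR : M.FaceInv R) :
    IsPart (M.sub R) M R (M.subIncl R) where
  faceInv := hR
  inj := Subtype.val_injective
  map_opp _ := rfl
  edge x := x.2
  surj z hz := ⟨⟨z, .inl hz⟩, rfl⟩
  map_face x hx := by
    let f : (M.sub R).Dart := ⟨M.face (M.subIncl R x), .inl ((hR _).mpr hx)⟩
    have h1 : M.rot (M.subIncl R f) = M.opp (M.subIncl R x) := rot_face _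
    have h2 : (M.sub R).rot f = (M.sub R).opp x := by
      apply Subtype.val_injective
      refine (subIncl_rot_of_mem f ?_).trans h1
      rw [h1]
      exact (M.opp_mem_edgesOf R _).mpr x.2
    have h3 : f = (M.sub R).face x := (M.sub R).rot.injective (h2.trans (rot_face x).symm)
    rw [← h3]
    rfl
  face_notMem x hx hf := by
    have h1 : M.rot (M.subIncl R ((M.sub R).face x)) ∈ M.edgesOf R := by
      refine .inr ?_
      rw [opp_mem_iff_rot hR, Equiv.Perm.inv_apply_apply]
      exact hf
    have h2 := subIncl_rot_of_mem _ h1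
    rw [rot_face] at h2
    have h3 : M.opp (M.subIncl R x) = M.rot (M.subIncl R ((M.sub R).face x)) := h2
    have h4 : M.subIncl R ((M.sub R).face x) = M.face (M.subIncl R x) := by
      rw [← rot_face] at h3
      exact (M.rot.injective h3).symm
    rw [h4, hR] at hf
    exact hx hf
  face_sameOrigin x _ := by
    have := firstReturn_sameCycle M.rot (M.edgesOf R) ((M.sub R).face x)
    have h2 : (firstReturn M.rot (M.edgesOf R) ((M.sub R).face x)) = (M.sub R).opp x := rot_face x
    rw [h2] at this
    exact this.symm

namespace IsPart

variable {R : Set M.Dart} {φ : N.Dart → M.Dart}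

theorem exists_of_opp_mem (h : IsPart N M R φ) {z : M.Dart} (hz : M.opp z ∈ R) :
    ∃ x, φ x = z := by
  obtain ⟨x, hx⟩ := h.surj _ hz
  exact ⟨N.opp x, by rw [h.map_opp, hx, M.opp_opp]⟩

theorem opp_mem (h : IsPart N M R φ) {x : N.Dart} (hx : φ x ∉ R) : M.opp (φ x) ∈ R :=
  (h.edge x).resolve_left hx

theorem mem_range_of_mem_bd (h : IsPart N M R φ) {X : Set M.Dart} (hX : X ⊆ R) {z : M.Dart}
    (hz : z ∈ M.bd X) : ∃ x, φ x = z := by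
  by_cases h1 : z ∈ X
  · exact h.surj z (hX h1)
  · refine h.exists_of_opp_mem (hX ?_)
    by_contra h2
    exact hz (iff_of_false h1 h2)

theorem faceInv_preimage_self (h : IsPart N M R φ) : N.FaceInv (φ ⁻¹' R) := by
  intro x
  by_cases hx : φ x ∈ R
  · simp only [Set.mem_preimage, h.map_face x hx, h.faceInv (φ x)]
  · exact iff_of_false (h.face_notMem x hx) hx

theorem faceInv_preimage (h : IsPart N M R φ) {X : Set M.Dart} (hX : M.FaceInv X) (hXR : X ⊆ R) :
    N.FaceInv (φ ⁻¹' X) := by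
  intro x
  by_cases hx : φ x ∈ R
  · simp only [Set.mem_preimage, h.map_face x hx, hX (φ x)]
  · exact iff_of_false (fun h' => h.face_notMem x hx (hXR h')) (fun h' => hx (hXR h'))

theorem faceInv_image (h : IsPart N M R φ) {Y : Set N.Dart} (hY : N.FaceInv Y)
    (hYR : φ '' Y ⊆ R) : M.FaceInv (φ '' Y) := by
  intro z
  constructor
  · rintro ⟨y, hy, hyz⟩
    have hzR : z ∈ R := by
      rw [← h.faceInv, ← hyz]
      exact hYR ⟨y, hy, rfl⟩
    obtain ⟨x, rfl⟩ := h.surj z hzR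
    rw [← h.map_face x hzR] at hyz
    rw [h.inj hyz, hY] at hy
    exact ⟨x, hy, rfl⟩
  · rintro ⟨y, hy, rfl⟩
    exact ⟨N.face y, (hY y).mpr hy, h.map_face y (hYR ⟨y, hy, rfl⟩)⟩

theorem bd_preimage (h : IsPart N M R φ) (X : Set M.Dart) : N.bd (φ ⁻¹' X) = φ ⁻¹' M.bd X := by
  ext x
  simp only [mem_bd, Set.mem_preimage, h.map_opp]

theorem image_bd_preimage (h : IsPart N M R φ) {X : Set M.Dart} (hXR : X ⊆ R) :
    φ '' N.bd (φ ⁻¹' X) = M.bd X := by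
  rw [h.bd_preimage, Set.image_preimage_eq_of_subset]
  exact fun z hz => h.mem_range_of_mem_bd hXR hz

theorem rot_of_mem (h : IsPart N M R φ) {x : N.Dart} (hx : φ x ∈ R) :
    φ (N.rot x) = M.rot (φ x) := by
  have hx' : φ (N.face⁻¹ x) ∈ R := (h.faceInv_preimage_self.inv x).mpr hx
  have := h.map_face _ hx'
  rw [Equiv.Perm.apply_inv_apply] at this
  rw [← opp_face_symm, h.map_opp, this, rot_face]

theorem sameOrigin_rot (h : IsPart N M R φ) (x : N.Dart) : M.SameOrigin (φ x) (φ (N.rot x)) := by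
  obtain ⟨y, rfl⟩ : ∃ y, N.face y = x := ⟨N.face⁻¹ x, Equiv.Perm.apply_inv_apply _ _⟩
  rw [rot_face, h.map_opp]
  by_cases hy : φ y ∈ R
  · rw [h.map_face y hy]
    exact (sameOrigin_opp_face _).symm
  · exact (h.face_sameOrigin y hy).symm

theorem sameOrigin (h : IsPart N M R φ) {x y : N.Dart} (hxy : N.SameOrigin x y) :
    M.SameOrigin (φ x) (φ y) := by
  obtain ⟨n, -, rfl⟩ := Equiv.Perm.SameCycle.exists_pow_eq' hxy
  clear hxy
  induction n with
  | zero => exact .refl _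
  | succ n ih =>
    rw [pow_succ', Equiv.Perm.mul_apply]
    exact ih.trans (h.sameOrigin_rot _)

variable {k : ℕ} {c : ZMod k → M.Dart}

/-- The vertices of a part bounded by a simple cycle are vertices of the map: a vertex whose
rotation leaves the region comes back to it only once. -/
theorem sameOrigin_iff (h : IsPart N M R φ) (hc : M.Contour R c) {x y : N.Dart} :
    N.SameOrigin x y ↔ M.SameOrigin (φ x) (φ y) := by
  refine ⟨h.sameOrigin, fun hxy => ?_⟩
  have key : ∀ x y, (∀ x', N.SameOrigin x x' → φ x' ∈ R) → M.SameOrigin (φ x) (φ y) →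
      N.SameOrigin x y := by
    intro x y hx hxy
    have hpow : ∀ n : ℕ, φ ((N.rot ^ n) x) = (M.rot ^ n) (φ x) := by
      intro n
      induction n with
      | zero => simp
      | succ n ih =>
        rw [pow_succ', pow_succ', Equiv.Perm.mul_apply, Equiv.Perm.mul_apply, ← ih]
        exact h.rot_of_mem (hx _ ⟨(n : ℕ), by rw [zpow_natCast]⟩)
    obtain ⟨n, -, hn⟩ := Equiv.Perm.SameCycle.exists_pow_eq' hxy
    rw [← hpow] at hn
    exact ⟨(n : ℕ), by rw [zpow_natCast]; exact h.inj hn⟩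
  by_cases hx : ∀ x', N.SameOrigin x x' → φ x' ∈ R
  · exact key x y hx hxy
  by_cases hy : ∀ y', N.SameOrigin y y' → φ y' ∈ R
  · exact (key y x hy hxy.symm).symm
  push Not at hx hy
  obtain ⟨x', hxx', hx'⟩ := hx
  obtain ⟨y', hyy', hy'⟩ := hy
  have h1 : M.SameOrigin (φ x') (φ y') :=
    (h.sameOrigin hxx').symm.trans (hxy.trans (h.sameOrigin hyy'))
  rw [h.inj (hc.eq_of_sameOrigin' hx' (h.opp_mem hx') hy' (h.opp_mem hy') h1)] at hxx'
  exact hxx'.trans hyy'.symm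

theorem isCycle_image (h : IsPart N M R φ) (hc : M.Contour R c) {C : Set N.Dart} {l : ℕ}
    (hC : N.IsCycle C l) : M.IsCycle (φ '' C) l := by
  obtain ⟨hl, a, h1, h2, h3, rfl⟩ := hC
  refine ⟨hl, φ ∘ a, fun i j hij => h1 i j ((h.sameOrigin_iff hc).mpr hij), fun i j hij => ?_,
    fun i => ?_, ?_⟩
  · rw [Function.comp_apply, ← h.map_opp] at hij
    exact h2 i j (h.inj hij)
  · rw [Function.comp_apply, ← h.map_opp]
    exact h.sameOrigin (h3 i)
  · rw [Set.image_union, Set.range_comp, ← Set.image_comp, ← Set.image_comp]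
    congr 1
    exact Set.image_congr fun x _ => h.map_opp x

theorem isCycle_preimage (h : IsPart N M R φ) (hc : M.Contour R c) {D : Set M.Dart} {l : ℕ}
    (hD : M.IsCycle D l) (hsub : D ⊆ Set.range φ) : N.IsCycle (φ ⁻¹' D) l := by
  obtain ⟨hl, a, h1, h2, h3, rfl⟩ := hD
  choose b hb using fun i => hsub (Or.inl ⟨i, rfl⟩ : a i ∈ Set.range a ∪ M.opp '' Set.range a)
  obtain rfl : φ ∘ b = a := funext hb
  refine ⟨hl, b, fun i j hij => h1 i j (h.sameOrigin hij), fun i j hij => ?_, fun i => ?_, ?_⟩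
  · exact h2 i j (by rw [Function.comp_apply, Function.comp_apply, ← h.map_opp, hij])
  · rw [h.sameOrigin_iff hc, h.map_opp]
    exact h3 i
  · have h4 : Set.range (φ ∘ b) ∪ M.opp '' Set.range (φ ∘ b) =
        φ '' (Set.range b ∪ N.opp '' Set.range b) := by
      rw [Set.image_union, Set.range_comp, ← Set.image_comp, ← Set.image_comp]
      congr 1
      exact Set.image_congr fun x _ => (h.map_opp x).symm
    rw [h4, Set.preimage_image_eq _ h.inj]

/-! ### Faces of a part -/

theorem image_isFace (h : IsPart N M R φ) {f : Set N.Dart} (hf : N.IsFace f) (hfR : φ '' f ⊆ R) :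
    M.IsFace (φ '' f) := by
  obtain ⟨a, ha⟩ := id hf
  have haf : a ∈ f := ha ▸ .refl _ _
  set g : Set M.Dart := {z | M.face.SameCycle (φ a) z} with hg
  have hgf : M.IsFace g := ⟨φ a, rfl⟩
  have hag : φ a ∈ g := .refl _ _
  have h1 : g ⊆ φ '' f := hgf.subset (h.faceInv_image hf.faceInv hfR) hag ⟨a, haf, rfl⟩
  have h2 : f ⊆ φ ⁻¹' g :=
    hf.subset (h.faceInv_preimage hgf.faceInv (h1.trans hfR)) haf hag
  rwa [h1.antisymm (Set.image_subset_iff.mpr h2)] at hgf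

theorem preimage_isFace (h : IsPart N M R φ) {g : Set M.Dart} (hg : M.IsFace g) (hgR : g ⊆ R) :
    N.IsFace (φ ⁻¹' g) := by
  obtain ⟨z, hz⟩ := hg.nonempty
  obtain ⟨a, rfl⟩ := h.surj z (hgR hz)
  have hf : N.IsFace {y | N.face.SameCycle a y} := ⟨a, rfl⟩
  have haf : a ∈ {y | N.face.SameCycle a y} := .refl _ _
  have hsub := hf.subset (h.faceInv_preimage hg.faceInv hgR) haf hz
  have h1 := h.image_isFace hf ((Set.image_subset_iff.mpr hsub).trans hgR)
  rw [hg.eq h1 hz ⟨a, haf, rfl⟩, Set.preimage_image_eq _ h.inj]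
  exact hf

theorem ncard_preimage (h : IsPart N M R φ) {X : Set M.Dart} (hX : X ⊆ R) :
    (φ ⁻¹' X).ncard = X.ncard :=
  Set.ncard_preimage_of_injective_subset_range h.inj fun z hz => h.surj z (hX hz)

/-- The face of the part that replaces the complement of the region. -/
theorem exists_outer (h : IsPart N M R φ) (hc : M.Contour R c) [NeZero k] :
    ∃ o : ZMod k → N.Dart, (∀ i, φ (o i) = M.opp (c i)) ∧ Function.Injective o ∧
      Set.range o = φ ⁻¹' Rᶜ ∧ ∀ i, N.face (o (i + 1)) = o i := by
  choose o ho using fun i => h.exists_of_opp_mem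
    (z := M.opp (c i)) (by rw [M.opp_opp]; exact hc.mem i)
  refine ⟨o, ho, fun i j hij => hc.injective (M.opp.injective (by rw [← ho, ← ho, hij])), ?_, ?_⟩
  · ext x
    constructor
    · rintro ⟨i, rfl⟩ hi
      rw [ho] at hi
      exact hc.opp_notMem i hi
    · intro hx
      obtain ⟨i, hi⟩ := hc.surj _ (h.opp_mem hx) (by rwa [M.opp_opp])
      exact ⟨i, h.inj (by rw [ho, hi, M.opp_opp])⟩
  · intro i
    have h1 : φ (o (i + 1)) ∉ R := by rw [ho]; exact hc.opp_notMem _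
    apply h.inj
    refine hc.eq_of_sameOrigin' (h.face_notMem _ h1) (h.opp_mem (h.face_notMem _ h1)) ?_ ?_ ?_
    · rw [ho]; exact hc.opp_notMem _
    · rw [ho, M.opp_opp]; exact hc.mem _
    · have h2 := (h.face_sameOrigin _ h1).symm
      rw [ho, M.opp_opp] at h2
      rw [ho i]
      exact h2.trans (hc.next i).symm

theorem outer_isFace (h : IsPart N M R φ) (hc : M.Contour R c) [NeZero k] :
    N.IsFace (φ ⁻¹' Rᶜ) := by
  obtain ⟨o, ho, -, hr, hf⟩ := h.exists_outer hc
  refine ⟨o 0, Set.Subset.antisymm ?_ ?_⟩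
  · rw [← hr]
    rintro _ ⟨i, rfl⟩
    refine ZMod.induction_add_one (P := fun i => N.face.SameCycle (o 0) (o i)) 0 (.refl _ _) ?_ i
    intro i hi
    rw [← hf i] at hi
    exact Equiv.Perm.sameCycle_apply_right.mp hi
  · intro y hy
    have h0 : o 0 ∈ φ ⁻¹' Rᶜ := hr ▸ ⟨0, rfl⟩
    exact (h.faceInv_preimage_self.compl.sameCycle hy).mpr h0

theorem ncard_outer (h : IsPart N M R φ) (hc : M.Contour R c) [NeZero k] :
    (φ ⁻¹' Rᶜ).ncard = k := by
  obtain ⟨o, -, hi, hr, -⟩ := h.exists_outer hc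
  rw [← hr, ← Set.image_univ, Set.ncard_image_of_injective _ hi, Set.ncard_univ, Nat.card_zmod]

theorem outer_simple (h : IsPart N M R φ) (hc : M.Contour R c) {x y : N.Dart} (hx : φ x ∉ R)
    (hy : φ y ∉ R) (hxy : N.SameOrigin x y) : x = y :=
  h.inj (hc.eq_of_sameOrigin' hx (h.opp_mem hx) hy (h.opp_mem hy) (h.sameOrigin hxy))

theorem isFace_cases (h : IsPart N M R φ) (hc : M.Contour R c) [NeZero k] {f : Set N.Dart}
    (hf : N.IsFace f) : f = φ ⁻¹' Rᶜ ∨ φ '' f ⊆ R := by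
  obtain ⟨x, hx⟩ := hf.nonempty
  by_cases hxR : φ x ∈ R
  · exact .inr (Set.image_subset_iff.mpr (hf.subset h.faceInv_preimage_self hx hxR))
  · exact .inl (hf.eq (h.outer_isFace hc) hx hxR)

/-! ### Planarity of a part -/

theorem isConnected (h : IsPart N M R φ) (hM : M.IsConnected) (hk : 0 < k) (hc : M.Contour R c) :
    N.IsConnected := by
  rw [isConnected_iff]
  intro X hr ho
  rcases X.eq_empty_or_nonempty with hX | ⟨a, ha⟩
  · exact .inl hX
  right
  have hface : N.FaceInv X := by
    intro x
    rw [← hr, rot_face, ho]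
  have hY : M.FaceInv (φ '' (X ∩ φ ⁻¹' R)) :=
    h.faceInv_image (hface.inter h.faceInv_preimage_self)
      (Set.image_subset_iff.mpr fun x hx => hx.2)
  have hb : M.bd (φ '' (X ∩ φ ⁻¹' R)) ⊆ M.bd R := by
    intro z hz hzR
    refine hz ?_
    constructor
    · rintro ⟨x, ⟨hx, hxR⟩, rfl⟩
      exact ⟨N.opp x, ⟨(ho x).mpr hx, by rw [Set.mem_preimage, h.map_opp]; exact hzR.mp hxR⟩,
        h.map_opp x⟩
    · rintro ⟨x, ⟨hx, hxR⟩, hxz⟩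
      refine ⟨N.opp x, ⟨(ho x).mpr hx, ?_⟩, by rw [h.map_opp, hxz, M.opp_opp]⟩
      rw [Set.mem_preimage, h.map_opp, hxz, M.opp_opp]
      exact hzR.mpr (hxz ▸ hxR)
  have hex : ∀ b, ∃ b', φ b' ∈ R ∧ (b' ∈ X ↔ b ∈ X) := by
    intro b
    rcases h.edge b with hb | hb
    · exact ⟨b, hb, Iff.rfl⟩
    · exact ⟨N.opp b, by rwa [h.map_opp], ho b⟩
  obtain ⟨a', ha'R, ha'⟩ := hex a
  ext b
  obtain ⟨b', hb'R, hb'⟩ := hex b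
  have hs := (h.faceInv.sameSide hM (hc.isCycle hk) ha'R).mpr hb'R
  have := (hs.mem_iff hY hb).mp ⟨a', ⟨ha'.mpr ha, ha'R⟩, rfl⟩
  obtain ⟨b'', hb''X, hb''⟩ := this
  rw [h.inj hb''] at hb''X
  simpa using hb'.mp hb''X.1

end IsPart

theorem SameOrigin.apply_eq {x y : M.Dart} (h : M.SameOrigin x y) {f : M.Dart → ZMod 2}
    (hf : ∀ x, f (M.rot x) = f x) : f y = f x :=
  (h.mem_iff (X := {z | f z = f x}) (fun z => by simp [hf])).mpr rfl

theorem exists_cyclic_potential {k : ℕ} [NeZero k] (u : ZMod k → ZMod 2) (hu : ∑ i, u i = 0) :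
    ∃ g : ZMod k → ZMod 2, ∀ i, u i = g i + g (i + 1) := by
  refine ⟨fun i => ∑ n ∈ Finset.range i.val, u n, fun i => ?_⟩
  have hlt := i.val_lt
  have h1 : (i + 1).val = (i.val + 1) % k := by
    rw [ZMod.val_add, ZMod.val_one_eq_one_mod, Nat.add_mod_mod]
  have h2 : ∑ n ∈ Finset.range (i.val + 1), u n = ∑ n ∈ Finset.range i.val, u n + u i := by
    rw [Finset.sum_range_succ, ZMod.natCast_zmod_val]
  beta_reduce
  rcases Nat.lt_or_ge (i.val + 1) k with h | h
  · rw [h1, Nat.mod_eq_of_lt h, h2, ← add_assoc, CharTwo.add_self_eq_zero, zero_add]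
  · have h3 : i.val + 1 = k := by omega
    have h4 : ∑ n ∈ Finset.range k, u n = ∑ i, u i := by
      refine Finset.sum_nbij' (fun n => (n : ZMod k)) ZMod.val (by simp) (fun i _ => ?_)
        (fun n hn => ?_) (fun i _ => ZMod.natCast_zmod_val i) (by simp)
      · exact Finset.mem_range.mpr i.val_lt
      · exact ZMod.val_cast_of_lt (Finset.mem_range.mp hn)
    rw [h3, h4, hu] at h2
    rw [h1, h3, Nat.mod_self, Finset.range_zero, Finset.sum_empty, add_zero]
    exact (CharTwo.add_eq_zero.mp h2.symm).symm

theorem Contour.exists_extension {X : Set M.Dart} {k : ℕ} [NeZero k] {c : ZMod k → M.Dart}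
    (hc : M.Contour X c) (g : ZMod k → ZMod 2) :
    ∃ G : M.Dart → ZMod 2, (∀ x, G (M.rot x) = G x) ∧ ∀ i, G (c i) = g i := by
  classical
  refine ⟨fun z => ∑ i, if M.SameOrigin z (c i) then g i else 0, fun x => ?_, fun i => ?_⟩
  · have : ∀ i, M.SameOrigin (M.rot x) (c i) ↔ M.SameOrigin x (c i) := fun i =>
      Equiv.Perm.sameCycle_apply_left
    simp only [this]
  · have : ∀ j, M.SameOrigin (c i) (c j) ↔ i = j := fun j =>
      ⟨hc.simple i j, fun h => h ▸ .refl _⟩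
    simp [this]

namespace IsPart

variable {R : Set M.Dart} {φ : N.Dart → M.Dart} {k : ℕ} [NeZero k] {c : ZMod k → M.Dart}

open Classical in
theorem sum_outer {o : ZMod k → N.Dart} (ho : Function.Injective o) (hr : Set.range o = φ ⁻¹' Rᶜ)
    (w : N.Dart → ZMod 2) :
    ∑ x, (if φ x ∈ R then 0 else w x) = ∑ i, w (o i) := by
  refine (Fintype.sum_of_injective o ho _ _ (fun x hx => ?_) (fun i => ?_)).symm
  · rw [hr] at hx
    rw [if_pos (not_not.mp hx)]
  · have : o i ∈ φ ⁻¹' Rᶜ := hr ▸ ⟨i, rfl⟩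
    rw [if_neg this]

/-- A cocycle of a part extends to the whole map: on the cycle that bounds the part it is the
coboundary of a potential, whose coboundary can be used on the other side. -/
theorem exact (h : IsPart N M R φ) (hM : M.Exact) (hc : M.Contour R c) : N.Exact := by
  classical
  intro w hw hwF
  obtain ⟨o, ho, hoi, hor, -⟩ := h.exists_outer hc
  have hsum : ∑ i, w (o i) = 0 := by
    rw [← sum_outer hoi hor]
    refine Eq.trans ?_ (hwF (fun x => if φ x ∈ R then 0 else 1) ?_)
    · refine Finset.sum_congr rfl fun x _ => ?_
      split_ifs <;> simp
    · intro x
      have := h.faceInv_preimage_self x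
      simp only [Set.mem_preimage] at this
      simp only [this]
  obtain ⟨g, hg⟩ := exists_cyclic_potential _ hsum
  obtain ⟨G, hG, hGg⟩ := hc.exists_extension g
  have hGo : ∀ i, w (o i) = G (M.opp (c i)) + G (c i) := fun i => by
    rw [hg, ← (hc.next i).apply_eq hG, hGg, hGg, add_comm]
  let w' : M.Dart → ZMod 2 := fun z =>
    if hz : ∃ x, φ x = z then w hz.choose else G z + G (M.opp z)
  have hw1 : ∀ x, w' (φ x) = w x := by
    intro x
    have hx : ∃ y, φ y = φ x := ⟨x, rfl⟩
    simp only [w', dif_pos hx]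
    rw [h.inj hx.choose_spec]
  have hw2 : ∀ z ∉ R, w' z = G z + G (M.opp z) := by
    intro z hz
    by_cases hx : ∃ x, φ x = z
    · obtain ⟨x, rfl⟩ := hx
      obtain ⟨i, rfl⟩ : x ∈ Set.range o := hor ▸ hz
      rw [hw1, hGo, ho, M.opp_opp]
    · simp only [w', dif_neg hx]
  have hw3 : ∀ z, w' (M.opp z) = w' z := by
    intro z
    by_cases hx : ∃ x, φ x = z
    · obtain ⟨x, rfl⟩ := hx
      rw [← h.map_opp, hw1, hw1, hw]
    · have hx' : ¬ ∃ x, φ x = M.opp z := by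
        rintro ⟨x, hxz⟩
        exact hx ⟨N.opp x, by rw [h.map_opp, hxz, M.opp_opp]⟩
      simp only [w', dif_neg hx, dif_neg hx']
      rw [M.opp_opp, add_comm]
  obtain ⟨f, hf, hwf⟩ := hM w' hw3 (by
    intro F hF
    have hR : ∀ z, M.face z ∈ R ↔ z ∈ R := h.faceInv
    have h1 : ∑ z, (if z ∈ R then F z else 0) * w' z = 0 := by
      refine Eq.trans ?_ (hwF (fun x => if φ x ∈ R then F (φ x) else 0) ?_)
      · refine (Fintype.sum_of_injective φ h.inj _ _ (fun z hz => ?_) (fun x => ?_)).symm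
        · rw [if_neg fun hzR => hz (h.surj z hzR), zero_mul]
        · rw [hw1]
      · intro x
        by_cases hx : φ x ∈ R
        · rw [h.map_face x hx, if_pos hx, if_pos ((hR _).mpr hx), hF]
        · rw [if_neg hx, if_neg (h.face_notMem x hx)]
    have h2 : ∑ z, (if z ∈ R then 0 else F z) * w' z = 0 := by
      refine Eq.trans ?_ (sum_mul_coboundary (fun z => if z ∈ R then 0 else F z) G
        (fun z => by simp only [hR, hF]) hG)
      refine Finset.sum_congr rfl fun z _ => ?_
      by_cases hz : z ∈ R
      · simp [hz]
      · rw [hw2 z hz]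
    calc ∑ z, F z * w' z
        = ∑ z, ((if z ∈ R then F z else 0) * w' z + (if z ∈ R then 0 else F z) * w' z) := by
          refine Finset.sum_congr rfl fun z _ => ?_
          split_ifs <;> simp
      _ = 0 := by rw [Finset.sum_add_distrib, h1, h2, add_zero])
  refine ⟨f ∘ φ, fun x => (h.sameOrigin_rot x).apply_eq hf, fun x => ?_⟩
  rw [← hw1, hwf, Function.comp_apply, Function.comp_apply, h.map_opp]

/-- The restriction of a cocycle to a part is a cocycle. -/
theorem pullback_closed (h : IsPart N M R φ) (hc : M.Contour R c) {w : M.Dart → ZMod 2}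
    (hw : ∀ x, w (M.opp x) = w x)
    (hwF : ∀ F : M.Dart → ZMod 2, (∀ x, F (M.face x) = F x) → ∑ z, F z * w z = 0)
    (F : N.Dart → ZMod 2) (hF : ∀ x, F (N.face x) = F x) : ∑ x, F x * w (φ x) = 0 := by
  classical
  obtain ⟨o, ho, hoi, hor, hface⟩ := h.exists_outer hc
  have hR : ∀ z, M.face z ∈ R ↔ z ∈ R := h.faceInv
  have hsum : ∑ i, w (c i) = 0 := by
    have h1 := hwF (fun z => if z ∈ R then 1 else 0) (fun z => by simp only [hR])
    have h2 := sum_opp_eq_zero (M := M)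
      (fun z => if z ∈ R ∧ M.opp z ∈ R then w z else 0) (fun z => by
        simp only [M.opp_opp, hw, and_comm])
    have h3 : ∑ z, (if z ∈ R ∧ M.opp z ∉ R then w z else 0) = ∑ i, w (c i) := by
      refine (Fintype.sum_of_injective c hc.injective _ _ (fun z hz => ?_) (fun i => ?_)).symm
      · exact if_neg fun h' => hz (hc.surj z h'.1 h'.2)
      · rw [if_pos ⟨hc.mem i, hc.opp_notMem i⟩]
    have h4 : ∑ z, ((if z ∈ R ∧ M.opp z ∈ R then w z else 0) +
        if z ∈ R ∧ M.opp z ∉ R then w z else 0) = ∑ z, (if z ∈ R then 1 else 0) * w z := by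
      refine Finset.sum_congr rfl fun z _ => ?_
      by_cases hz : z ∈ R <;> by_cases hz' : M.opp z ∈ R <;> simp [hz, hz']
    rwa [Finset.sum_add_distrib, h2, h3, zero_add, h1] at h4
  have h1 : ∑ x, (if φ x ∈ R then F x else 0) * w (φ x) = 0 := by
    let F' : M.Dart → ZMod 2 := fun z => if hz : z ∈ R then F (h.surj z hz).choose else 0
    have hF' : ∀ x, F' (φ x) = if φ x ∈ R then F x else 0 := by
      intro x
      by_cases hx : φ x ∈ R
      · simp only [F', dif_pos hx, if_pos hx]
        rw [h.inj (h.surj _ hx).choose_spec]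
      · simp only [F', dif_neg hx, if_neg hx]
    refine Eq.trans ?_ (hwF F' ?_)
    · refine Fintype.sum_of_injective φ h.inj _ _ (fun z hz => ?_) (fun x => ?_)
      · simp only [F']
        rw [dif_neg fun hzR => hz (h.surj z hzR), zero_mul]
      · rw [hF']
    · intro z
      by_cases hz : z ∈ R
      · obtain ⟨x, rfl⟩ := h.surj z hz
        rw [← h.map_face x hz, hF', hF', h.map_face x hz, if_pos hz, if_pos ((hR _).mpr hz), hF]
      · simp only [F', dif_neg hz, dif_neg (mt (hR z).mp hz)]
  have h2 : ∑ x, (if φ x ∈ R then 0 else F x * w (φ x)) = 0 := by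
    rw [sum_outer hoi hor (fun x => F x * w (φ x))]
    have hconst : ∀ i, F (o i) = F (o 0) := ZMod.induction_add_one 0 rfl fun i hi => by
      rw [← hi, ← hface i, hF]
    simp only [hconst, ho, hw, ← Finset.mul_sum, hsum, mul_zero]
  calc ∑ x, F x * w (φ x)
      = ∑ x, ((if φ x ∈ R then F x else 0) * w (φ x) + if φ x ∈ R then 0 else F x * w (φ x)) := by
        refine Finset.sum_congr rfl fun z _ => ?_
        split_ifs <;> simp
    _ = 0 := by rw [Finset.sum_add_distrib, h1, h2, add_zero]

end IsPart

/-! ### Planarity of a map cut along a cycle into two planar parts -/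

section Gluing

variable {N₁ N₂ : CombMap} {R : Set M.Dart} {φ₁ : N₁.Dart → M.Dart} {φ₂ : N₂.Dart → M.Dart}
  {k : ℕ} [NeZero k] {c : ZMod k → M.Dart}

omit [NeZero k] in
theorem isConnected_of_parts (h₁ : IsPart N₁ M R φ₁) (h₂ : IsPart N₂ M Rᶜ φ₂)
    (hc : M.Contour R c) (hN₁ : N₁.IsConnected) (hN₂ : N₂.IsConnected) : M.IsConnected := by
  rw [isConnected_iff]
  intro X hr ho
  have key : ∀ {N : CombMap} {S : Set M.Dart} {φ : N.Dart → M.Dart}, IsPart N M S φ →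
      N.IsConnected → φ ⁻¹' X = ∅ ∨ φ ⁻¹' X = Set.univ := by
    intro N S φ h hN
    refine isConnected_iff.mp hN _ (fun x => (h.sameOrigin_rot x).mem_iff hr) (fun x => ?_)
    rw [Set.mem_preimage, h.map_opp, ho, Set.mem_preimage]
  obtain ⟨x, hx⟩ := h₁.surj _ (hc.mem 0)
  obtain ⟨y, hy⟩ := h₂.exists_of_opp_mem (z := c 0) (hc.opp_notMem 0)
  have hcov : ∀ z, (∃ x, φ₁ x = z) ∨ ∃ y, φ₂ y = z := fun z => by
    by_cases hz : z ∈ R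
    · exact .inl (h₁.surj z hz)
    · exact .inr (h₂.surj z hz)
  rcases key h₁ hN₁ with e₁ | e₁ <;> rcases key h₂ hN₂ with e₂ | e₂
  · left
    rw [Set.eq_empty_iff_forall_notMem]
    intro z hz
    rcases hcov z with ⟨a, rfl⟩ | ⟨a, rfl⟩
    · exact (e₁ ▸ hz : a ∈ (∅ : Set _))
    · exact (e₂ ▸ hz : a ∈ (∅ : Set _))
  · have h1 : y ∈ φ₂ ⁻¹' X := e₂ ▸ Set.mem_univ y
    have h2 : x ∈ φ₁ ⁻¹' X := by rwa [Set.mem_preimage, hx, ← hy]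
    simp [e₁] at h2
  · have h1 : x ∈ φ₁ ⁻¹' X := e₁ ▸ Set.mem_univ x
    have h2 : y ∈ φ₂ ⁻¹' X := by rwa [Set.mem_preimage, hy, ← hx]
    simp [e₂] at h2
  · right
    ext z
    refine iff_of_true ?_ (Set.mem_univ z)
    rcases hcov z with ⟨a, rfl⟩ | ⟨a, rfl⟩
    · exact (e₁ ▸ Set.mem_univ a : a ∈ φ₁ ⁻¹' X)
    · exact (e₂ ▸ Set.mem_univ a : a ∈ φ₂ ⁻¹' X)

/-- The primitives of a cocycle on the two parts differ by a constant on the common cycle. -/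
theorem exact_of_parts (h₁ : IsPart N₁ M R φ₁) (h₂ : IsPart N₂ M Rᶜ φ₂)
    (hc : M.Contour R c) (hN₁ : N₁.Exact) (hN₂ : N₂.Exact) : M.Exact := by
  classical
  intro w hw hwF
  obtain ⟨f₁, hf₁, hw₁⟩ := hN₁ (w ∘ φ₁) (fun x => by simp [h₁.map_opp, hw])
    (h₁.pullback_closed hc hw hwF)
  obtain ⟨f₂, hf₂, hw₂⟩ := hN₂ (w ∘ φ₂) (fun x => by simp [h₂.map_opp, hw])
    (h₂.pullback_closed hc.compl hw hwF)
  simp only [Function.comp_apply] at hw₁ hw₂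
  choose x hx using fun i => h₁.surj _ (hc.mem i)
  choose y hy using fun i => h₂.exists_of_opp_mem (z := c i) (hc.opp_notMem i)
  have e₁ : ∀ i, f₁ (N₁.opp (x i)) = w (c i) + f₁ (x i) := fun i => by
    rw [← hx, hw₁, add_comm (f₁ (x i)), add_assoc, CharTwo.add_self_eq_zero, add_zero]
  have e₂ : ∀ i, f₂ (N₂.opp (y i)) = w (c i) + f₂ (y i) := fun i => by
    rw [← hy, hw₂, add_comm (f₂ (y i)), add_assoc, CharTwo.add_self_eq_zero, add_zero]
  have n₁ : ∀ i, f₁ (x (i + 1)) = f₁ (N₁.opp (x i)) := fun i => by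
    refine SameOrigin.apply_eq ?_ hf₁
    rw [h₁.sameOrigin_iff hc, h₁.map_opp, hx, hx]
    exact hc.next i
  have n₂ : ∀ i, f₂ (y (i + 1)) = f₂ (N₂.opp (y i)) := fun i => by
    refine SameOrigin.apply_eq ?_ hf₂
    rw [h₂.sameOrigin_iff hc.compl, h₂.map_opp, hy, hy]
    exact hc.next i
  set a : ZMod 2 := f₁ (x 0) + f₂ (y 0) with ha
  have hconst : ∀ i, f₁ (x i) = f₂ (y i) + a := by
    refine ZMod.induction_add_one 0 ?_ fun i hi => ?_
    · rw [ha, add_comm (f₁ (x 0)), ← add_assoc, CharTwo.add_self_eq_zero, zero_add]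
    · rw [n₁, n₂, e₁, e₂, hi, add_assoc]
  have hagree : ∀ u v, φ₁ u = φ₂ v → f₁ u = f₂ v + a := by
    intro u v huv
    by_cases hu : φ₁ u ∈ R
    · have hv : M.opp (φ₂ v) ∈ Rᶜ := h₂.opp_mem (not_not.mpr (huv ▸ hu))
      obtain ⟨i, hi⟩ := hc.surj _ hu (huv ▸ hv)
      rw [← h₁.inj (hx i |>.trans hi), ← h₂.inj (hy i |>.trans (hi.trans huv)), hconst]
    · obtain ⟨i, hi⟩ := hc.surj _ (h₁.opp_mem hu) (by rwa [M.opp_opp])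
      have hu' : u = N₁.opp (x i) := h₁.inj (by rw [h₁.map_opp, hx, hi, M.opp_opp])
      have hv' : v = N₂.opp (y i) := h₂.inj (by rw [h₂.map_opp, hy, hi, M.opp_opp, huv])
      rw [hu', hv', e₁, e₂, hconst, add_assoc]
  let f : M.Dart → ZMod 2 := fun z =>
    if hz : ∃ u, φ₁ u = z then f₁ hz.choose else
      if hz : ∃ v, φ₂ v = z then f₂ hz.choose + a else 0
  have hfφ₁ : ∀ u, f (φ₁ u) = f₁ u := by
    intro u
    have hu : ∃ u', φ₁ u' = φ₁ u := ⟨u, rfl⟩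
    simp only [f, dif_pos hu]
    rw [h₁.inj hu.choose_spec]
  have hfφ₂ : ∀ v, f (φ₂ v) = f₂ v + a := by
    intro v
    by_cases hu : ∃ u, φ₁ u = φ₂ v
    · obtain ⟨u, hu⟩ := hu
      rw [← hu, hfφ₁, hagree u v hu]
    · have hv : ∃ v', φ₂ v' = φ₂ v := ⟨v, rfl⟩
      simp only [f, dif_neg hu, dif_pos hv]
      rw [h₂.inj hv.choose_spec]
  refine ⟨f, fun z => ?_, fun z => ?_⟩ <;> by_cases hz : z ∈ R
  · obtain ⟨u, rfl⟩ := h₁.surj z hz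
    rw [← h₁.rot_of_mem hz, hfφ₁, hfφ₁, hf₁]
  · obtain ⟨v, rfl⟩ := h₂.surj z hz
    rw [← h₂.rot_of_mem hz, hfφ₂, hfφ₂, hf₂]
  · obtain ⟨u, rfl⟩ := h₁.surj z hz
    rw [← h₁.map_opp, hfφ₁, hfφ₁, hw₁]
  · obtain ⟨v, rfl⟩ := h₂.surj z hz
    rw [← h₂.map_opp, hfφ₂, hfφ₂, hw₂, add_add_add_comm, CharTwo.add_self_eq_zero, add_zero]

end Gluing

end CombMap

namespace CombMap

variable {M : CombMap}

/-! ### Regions between the boundary face and the root-face -/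

theorem FaceInv.isPart_sub' {R T : Set M.Dart} (hR : M.FaceInv R) (hT : T = R) :
    IsPart (M.sub T) M R (M.subIncl T) := by
  subst hT
  exact hR.isPart_sub

theorem union_image_opp_eq_bd {f : Set M.Dart} (h : ∀ x ∈ f, M.opp x ∉ f) :
    f ∪ M.opp '' f = M.bd f := by
  ext x
  constructor
  · rintro (hx | ⟨y, hy, rfl⟩)
    · exact fun h' => h x hx (h'.mp hx)
    · exact opp_mem_bd.mpr fun h' => h y hy (h'.mp hy)
  · intro hx
    by_cases hxf : x ∈ f
    · exact .inl hxf
    · refine .inr ⟨M.opp x, ?_, M.opp_opp x⟩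
      by_contra h'
      exact hx (iff_of_false hxf h')

/-- In a connected map of girth at least `d`, the contour of a face of degree `d` is a simple
cycle. -/
theorem IsFace.exists_contour (hM : M.IsConnected) {d : ℕ} (hg : ∀ C k, M.IsCycle C k → d ≤ k)
    {f : Set M.Dart} (hf : M.IsFace f) (hd : f.ncard = d) (hne : fᶜ.Nonempty) :
    M.IsCycle (M.bd f) d ∧ (∀ x ∈ f, M.opp x ∉ f) ∧ ∃ c : ZMod d → M.Dart, M.Contour f c := by
  have hb := hM.bd_nonempty hf.faceInv hf.nonempty hne
  have hsub : M.bd f ⊆ f ∪ M.opp '' f := by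
    intro x hx
    by_contra h
    rw [Set.mem_union, not_or] at h
    exact hx (iff_of_false h.1 fun h' => h.2 ⟨_, h', M.opp_opp x⟩)
  have hle : (M.bd f).ncard ≤ 2 * d := by
    have h1 := Set.ncard_le_ncard hsub
    have h2 := Set.ncard_union_le f (M.opp '' f)
    rw [Set.ncard_image_of_injective _ M.opp.injective] at h2
    omega
  have hC := hf.faceInv.isCycle_bd hg hb hle
  obtain ⟨c, hc⟩ := hC.exists_contour hf.faceInv
  refine ⟨hC, ?_, c, hc⟩
  have : NeZero d := ⟨hC.1.ne'⟩
  have h1 : Set.range c = f := by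
    refine Set.eq_of_subset_of_ncard_le (Set.range_subset_iff.mpr hc.mem) ?_
    rw [← Set.image_univ, Set.ncard_image_of_injective _ hc.injective, Set.ncard_univ,
      Nat.card_zmod, hd]
  intro x hx
  obtain ⟨i, rfl⟩ := h1 ▸ hx
  exact hc.opp_notMem i

end CombMap

namespace AnnMap

open CombMap

variable {A N : AnnMap} {p d : ℕ} {S : Set A.Dart}

/-- `S` is a region of `A`, bounded by a simple cycle of length `d`, that contains the boundary face
but not the root-face. -/
structure IsRegion (A : AnnMap) (d : ℕ) (S : Set A.Dart) : Prop where
  faceInv : A.FaceInv S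
  bdry_subset : A.bdry ⊆ S
  root_subset : A.root ⊆ Sᶜ
  isCycle : A.IsCycle (A.bd S) d

theorem IsAnnular.bdry_nonempty (hA : A.IsAnnular p d) : A.bdry.Nonempty := hA.bdry_face.nonempty

theorem IsAnnular.root_nonempty (hA : A.IsAnnular p d) : A.root.Nonempty := hA.root_face.nonempty

theorem IsAnnular.exact (hA : A.IsAnnular p d) : A.Exact := by
  have : Nonempty A.Dart := ⟨hA.bdry_nonempty.some⟩
  exact (exact_iff_isEuler hA.planar.1).mpr hA.planar.2

theorem IsAnnular.bdry_subset_compl_root (hA : A.IsAnnular p d) : A.bdry ⊆ A.rootᶜ :=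
  fun _ hx hx' => hA.root_ne (hA.root_face.eq hA.bdry_face hx' hx)

theorem IsRegion.side_bdry (hS : A.IsRegion d S) (hA : A.IsAnnular p d) :
    A.side (A.bd S) A.bdry = S :=
  hS.faceInv.side_eq hA.planar.1 hS.isCycle hA.bdry_nonempty hS.bdry_subset

theorem IsRegion.side_root (hS : A.IsRegion d S) (hA : A.IsAnnular p d) :
    A.side (A.bd S) A.root = Sᶜ := by
  have h := hS.isCycle
  rw [← bd_compl] at h ⊢
  exact hS.faceInv.compl.side_eq hA.planar.1 h hA.root_nonempty hS.root_subset

theorem IsAnnular.root_contour (hA : A.IsAnnular p d) (hg : A.HasGirth d) :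
    A.IsCycle (A.bd A.root) d ∧ (∀ x ∈ A.root, A.opp x ∉ A.root) ∧
      ∃ c : ZMod d → A.Dart, A.Contour A.root c :=
  hA.root_face.exists_contour hA.planar.1 hg.2 (hA.face_card _ hA.root_face hA.root_ne)
    (hA.bdry_nonempty.mono hA.bdry_subset_compl_root)

theorem IsAnnular.rootContour_eq (hA : A.IsAnnular p d) (hg : A.HasGirth d) :
    A.rootContour = A.bd A.root :=
  union_image_opp_eq_bd (hA.root_contour hg).2.1

theorem IsAnnular.isRegion_compl_root (hA : A.IsAnnular p d) (hg : A.HasGirth d) :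
    A.IsRegion d A.rootᶜ where
  faceInv := hA.root_face.faceInv.compl
  bdry_subset := hA.bdry_subset_compl_root
  root_subset := by rw [compl_compl]
  isCycle := by
    rw [bd_compl]
    exact (hA.root_contour hg).1

/-- The pseudo-separating cycles of length `d` are the boundaries of the regions that contain the
boundary face but not the root-face. -/
theorem IsAnnular.isPseudoSeparating_iff (hA : A.IsAnnular p d) (hg : A.HasGirth d)
    {C : Set A.Dart} : A.IsPseudoSeparating C d ↔ ∃ S, A.IsRegion d S ∧ A.bd S = C := by
  constructor
  · rintro ⟨hC, hsep | rfl⟩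
    · obtain ⟨X, hX, rfl⟩ := hA.exact.exists_region hC
      obtain ⟨x, hx⟩ := hA.bdry_nonempty
      have key : ∀ Y : Set A.Dart, A.FaceInv Y → A.bd Y = A.bd X → x ∈ Y → A.IsRegion d Y := by
        intro Y hY hYX hxY
        refine ⟨hY, hA.bdry_face.subset hY hx hxY, fun y hy hyY => ?_, hYX ▸ hC⟩
        refine hsep.1 x hx y hy ?_
        rw [← hYX] at hC ⊢
        exact (hY.sameSide hA.planar.1 hC hxY).mpr hyY
      by_cases hxX : x ∈ X
      · exact ⟨X, key X hX rfl hxX, rfl⟩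
      · exact ⟨Xᶜ, key Xᶜ hX.compl (bd_compl X) hxX, bd_compl X⟩
    · exact ⟨A.rootᶜ, hA.isRegion_compl_root hg, by rw [bd_compl, hA.rootContour_eq hg]⟩
  · rintro ⟨S, hS, rfl⟩
    refine ⟨hS.isCycle, ?_⟩
    by_cases h : A.bd S = A.rootContour
    · exact .inr h
    · refine .inl ⟨fun x hx y hy hxy => ?_, h⟩
      exact hS.root_subset hy ((hxy.mem_iff hS.faceInv subset_rfl).mp (hS.bdry_subset hx))

theorem IsRegion.eq_of_bd_eq {S' : Set A.Dart} (hS : A.IsRegion d S) (hS' : A.IsRegion d S')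
    (hA : A.IsAnnular p d) (h : A.bd S = A.bd S') : S = S' := by
  rw [← hS.side_bdry hA, h, hS'.side_bdry hA]

/-- The regions are stable under intersection: the boundaries of the intersection and of the union
have at least the length `d`, and together at most the length `2 d`. -/
theorem IsRegion.inter {S' : Set A.Dart} (hS : A.IsRegion d S) (hS' : A.IsRegion d S')
    (hA : A.IsAnnular p d) (hg : A.HasGirth d) : A.IsRegion d (S ∩ S') where
  faceInv := hS.faceInv.inter hS'.faceInv
  bdry_subset := Set.subset_inter hS.bdry_subset hS'.bdry_subset
  root_subset _ hx hx' := hS.root_subset hx hx'.1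
  isCycle := by
    obtain ⟨x, hx⟩ := hA.bdry_nonempty
    obtain ⟨y, hy⟩ := hA.root_nonempty
    have hy1 := hS.root_subset hy
    have hy2 := hS'.root_subset hy
    refine hS.faceInv.bd_inter_isCycle hg.2 hS'.faceInv hS.isCycle hS'.isCycle
      (hA.planar.1.bd_nonempty (hS.faceInv.inter hS'.faceInv)
        ⟨x, hS.bdry_subset hx, hS'.bdry_subset hx⟩ ⟨y, fun h => hy1 h.1⟩)
      (hA.planar.1.bd_nonempty (hS.faceInv.union hS'.faceInv)
        ⟨x, .inl (hS.bdry_subset hx)⟩ ⟨y, fun h => h.elim hy1 hy2⟩)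

/-- There is a smallest region. -/
theorem IsAnnular.exists_least_region (hA : A.IsAnnular p d) (hg : A.HasGirth d) :
    ∃ S, A.IsRegion d S ∧ ∀ S', A.IsRegion d S' → S ⊆ S' := by
  obtain ⟨S, hS, hmin⟩ := (Set.toFinite {S | A.IsRegion d S}).exists_minimal
    ⟨_, hA.isRegion_compl_root hg⟩
  refine ⟨S, hS, fun S' hS' => ?_⟩
  exact (hmin (hS.inter hS' hA hg) Set.inter_subset_left).trans Set.inter_subset_right

/-! ### The two parts of an annular map -/

/-- `N` is the part of `A` cut out by a region `S` that contains the boundary face. -/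
structure IsBdryPart (N A : AnnMap) (S : Set A.Dart) (φ : N.Dart → A.Dart) : Prop where
  isPart : IsPart N.toCombMap A.toCombMap S φ
  bdry_eq : N.bdry = φ ⁻¹' A.bdry
  root_eq : N.root = φ ⁻¹' Sᶜ

/-- `N` is the part of `A` cut out by the complement of a region `S` that does not contain the
root-face. -/
structure IsRootPart (N A : AnnMap) (S : Set A.Dart) (φ : N.Dart → A.Dart) : Prop where
  isPart : IsPart N.toCombMap A.toCombMap Sᶜ φ
  bdry_eq : N.bdry = φ ⁻¹' S
  root_eq : N.root = φ ⁻¹' A.root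

theorem isPlanarMap_of_isPart {N A : CombMap} {S : Set A.Dart} {φ : N.Dart → A.Dart}
    (h : IsPart N A S φ) (hA : A.IsConnected) (hAe : A.Exact) [NeZero d] {c : ZMod d → A.Dart}
    (hc : A.Contour S c) : N.IsPlanarMap := by
  have h1 := h.isConnected hA (NeZero.pos d) hc
  have : Nonempty N.Dart := ⟨(h.surj _ (hc.mem 0)).choose⟩
  exact ⟨h1, (exact_iff_isEuler h1).mp (h.exact hAe hc)⟩

theorem hasGirth_of_isPart {N A : CombMap} {S : Set A.Dart} {φ : N.Dart → A.Dart}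
    (h : IsPart N A S φ) (hg : A.HasGirth d) (hd : 0 < d) {c : ZMod d → A.Dart}
    (hc : A.Contour S c) : N.HasGirth d :=
  ⟨⟨_, h.isCycle_preimage hc (hc.isCycle hd) fun _ hz => h.mem_range_of_mem_bd subset_rfl hz⟩,
    fun _ _ hC => hg.2 _ _ (h.isCycle_image hc hC)⟩

theorem IsBdryPart.isAnnular {φ : N.Dart → A.Dart} (h : IsBdryPart N A S φ)
    (hA : A.IsAnnular p d) (hS : A.IsRegion d S) : N.IsAnnular p d := by
  obtain ⟨c, hc⟩ := hS.isCycle.exists_contour hS.faceInv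
  have : NeZero d := ⟨hS.isCycle.1.ne'⟩
  have hb : N.IsFace N.bdry := by
    rw [h.bdry_eq]
    exact h.isPart.preimage_isFace hA.bdry_face hS.bdry_subset
  have hr : N.IsFace N.root := by
    rw [h.root_eq]
    exact h.isPart.outer_isFace hc
  refine ⟨isPlanarMap_of_isPart h.isPart hA.planar.1 hA.exact hc, hb, ?_, ?_, hr, ?_, ?_⟩
  · rw [h.bdry_eq, h.isPart.ncard_preimage hS.bdry_subset, hA.bdry_card]
  · rw [h.bdry_eq]
    exact fun x hx y hy hxy => h.isPart.inj (hA.bdry_simple _ hx _ hy (h.isPart.sameOrigin hxy))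
  · intro hrb
    obtain ⟨x, hx⟩ := hr.nonempty
    have h1 : φ x ∈ Sᶜ := (h.root_eq ▸ hx : x ∈ φ ⁻¹' Sᶜ)
    have h2 : φ x ∈ A.bdry := (h.bdry_eq ▸ hrb ▸ hx : x ∈ φ ⁻¹' A.bdry)
    exact h1 (hS.bdry_subset h2)
  · intro f hf hfb
    rcases h.isPart.isFace_cases hc hf with rfl | hfS
    · exact h.isPart.ncard_outer hc
    · rw [← Set.ncard_image_of_injective f h.isPart.inj]
      refine hA.face_card _ (h.isPart.image_isFace hf hfS) fun h' => hfb ?_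
      rw [h.bdry_eq, ← h', Set.preimage_image_eq _ h.isPart.inj]

theorem IsBdryPart.hasGirth {φ : N.Dart → A.Dart} (h : IsBdryPart N A S φ)
    (hg : A.HasGirth d) (hS : A.IsRegion d S) : N.HasGirth d := by
  obtain ⟨c, hc⟩ := hS.isCycle.exists_contour hS.faceInv
  exact hasGirth_of_isPart h.isPart hg hS.isCycle.1 hc

theorem IsRootPart.isAnnular {φ : N.Dart → A.Dart} (h : IsRootPart N A S φ)
    (hA : A.IsAnnular p d) (hS : A.IsRegion d S) : N.IsAnnular d d := by
  obtain ⟨c, hc⟩ := hS.isCycle.exists_contour hS.faceInv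
  have : NeZero d := ⟨hS.isCycle.1.ne'⟩
  have hb' : N.bdry = φ ⁻¹' Sᶜᶜ := by rw [compl_compl, h.bdry_eq]
  have hb : N.IsFace N.bdry := by
    rw [hb']
    exact h.isPart.outer_isFace hc.compl
  have hr : N.IsFace N.root := by
    rw [h.root_eq]
    exact h.isPart.preimage_isFace hA.root_face hS.root_subset
  refine ⟨isPlanarMap_of_isPart h.isPart hA.planar.1 hA.exact hc.compl, hb, ?_, ?_, hr, ?_, ?_⟩
  · rw [hb', h.isPart.ncard_outer hc.compl]
  · rw [hb']
    exact fun x hx y hy hxy => h.isPart.outer_simple hc.compl hx hy hxy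
  · intro hrb
    obtain ⟨x, hx⟩ := hr.nonempty
    have h1 : φ x ∈ A.root := (h.root_eq ▸ hx : x ∈ φ ⁻¹' A.root)
    have h2 : φ x ∈ S := (h.bdry_eq ▸ hrb ▸ hx : x ∈ φ ⁻¹' S)
    exact hS.root_subset h1 h2
  · intro f hf hfb
    rcases h.isPart.isFace_cases hc.compl hf with rfl | hfS
    · exact h.isPart.ncard_outer hc.compl
    · rw [← Set.ncard_image_of_injective f h.isPart.inj]
      refine hA.face_card _ (h.isPart.image_isFace hf hfS) fun h' => ?_
      obtain ⟨x, hx⟩ := hA.bdry_nonempty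
      exact hfS (h' ▸ hx) (hS.bdry_subset hx)

theorem IsRootPart.hasGirth {φ : N.Dart → A.Dart} (h : IsRootPart N A S φ)
    (hg : A.HasGirth d) (hS : A.IsRegion d S) : N.HasGirth d := by
  obtain ⟨c, hc⟩ := hS.isCycle.exists_contour hS.faceInv
  exact hasGirth_of_isPart h.isPart hg hS.isCycle.1 hc.compl

/-- The part cut out by a region is non-separated if and only if the region is minimal. -/
theorem IsBdryPart.nonSeparated_iff {φ : N.Dart → A.Dart} (h : IsBdryPart N A S φ)
    (hA : A.IsAnnular p d) (hg : A.HasGirth d) (hS : A.IsRegion d S) :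
    N.NonSeparated d ↔ ∀ S', A.IsRegion d S' → S ⊆ S' := by
  have hN := h.isAnnular hA hS
  have hNg := h.hasGirth hg hS
  obtain ⟨c, hc⟩ := hS.isCycle.exists_contour hS.faceInv
  have hrc : N.rootContour = φ ⁻¹' A.bd S := by
    rw [hN.rootContour_eq hNg, h.root_eq, h.isPart.bd_preimage, bd_compl]
  have hmem : ∀ {X}, X ⊆ S → A.bd X ⊆ Set.range φ := fun hX _ hz =>
    h.isPart.mem_range_of_mem_bd hX hz
  constructor
  · intro hns S' hS'
    have hSS := hS.inter hS' hA hg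
    have hsub : S ∩ S' ⊆ S := Set.inter_subset_left
    have hcyc := h.isPart.isCycle_preimage hc hSS.isCycle (hmem hsub)
    have heq : φ ⁻¹' A.bd (S ∩ S') = N.rootContour := by
      by_contra hne
      refine hns _ hcyc ⟨fun x hx y hy hxy => ?_, hne⟩
      have h1 := hxy.mem_iff (h.isPart.faceInv_preimage hSS.faceInv hsub)
        (by rw [h.isPart.bd_preimage])
      rw [h.bdry_eq] at hx
      rw [h.root_eq] at hy
      exact hy (h1.mp (hSS.bdry_subset hx)).1
    rw [hrc] at heq
    have h2 : A.bd (S ∩ S') = A.bd S := by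
      rw [← Set.image_preimage_eq_of_subset (hmem hsub), heq,
        Set.image_preimage_eq_of_subset (hmem subset_rfl)]
    have h3 := hSS.eq_of_bd_eq hS hA h2
    exact h3 ▸ Set.inter_subset_right
  · rintro hmin C hC hsep
    obtain ⟨Y, hY, rfl⟩ := (hN.isPseudoSeparating_iff hNg).mp ⟨hC, .inl hsep⟩
    have hYS : φ '' Y ⊆ S := by
      rintro _ ⟨y, hy, rfl⟩
      by_contra hyS
      exact hY.root_subset (h.root_eq ▸ hyS : y ∈ N.root) hy
    have hpre : φ ⁻¹' (φ '' Y) = Y := Set.preimage_image_eq _ h.isPart.inj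
    have hreg : A.IsRegion d (φ '' Y) := by
      refine ⟨h.isPart.faceInv_image hY.faceInv hYS, fun z hz => ?_, fun z hz hz' => ?_, ?_⟩
      · obtain ⟨x, rfl⟩ := h.isPart.surj z (hS.bdry_subset hz)
        exact ⟨x, hY.bdry_subset (h.bdry_eq ▸ hz), rfl⟩
      · exact hS.root_subset hz (hYS hz')
      · rw [← h.isPart.image_bd_preimage hYS, hpre]
        exact h.isPart.isCycle_image hc hC
    have h1 : φ '' Y = S := hYS.antisymm (hmin _ hreg)
    refine hsep.2 ?_
    rw [hrc, ← h1, ← h.isPart.bd_preimage, hpre]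

theorem IsRegion.isBdryPart (hS : A.IsRegion d S) (hA : A.IsAnnular p d) :
    IsBdryPart (A.bdryPart (A.bd S)) A S (A.subIncl (A.side (A.bd S) A.bdry)) := by
  have h := hS.side_bdry hA
  exact ⟨hS.faceInv.isPart_sub' h, rfl, Set.ext fun x => not_congr (Set.ext_iff.mp h _)⟩

theorem IsRegion.isRootPart (hS : A.IsRegion d S) (hA : A.IsAnnular p d) :
    IsRootPart (A.rootPart (A.bd S)) A S (A.subIncl (A.side (A.bd S) A.root)) := by
  have h := hS.side_root hA
  exact ⟨hS.faceInv.compl.isPart_sub' h,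
    Set.ext fun x => (not_congr (Set.ext_iff.mp h _)).trans Set.notMem_compl_iff, rfl⟩

/-- The distinguished cycle is the boundary of the smallest region. -/
theorem IsAnnular.existsUnique_cycle (hA : A.IsAnnular p d) (hg : A.HasGirth d) :
    ∃! C : Set A.Dart, A.IsPseudoSeparating C d ∧ (A.bdryPart C).NonSeparated d := by
  obtain ⟨S, hS, hmin⟩ := hA.exists_least_region hg
  refine ⟨A.bd S, ⟨(hA.isPseudoSeparating_iff hg).mpr ⟨S, hS, rfl⟩,
    ((hS.isBdryPart hA).nonSeparated_iff hA hg hS).mpr hmin⟩, ?_⟩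
  rintro C ⟨hC, hns⟩
  obtain ⟨S', hS', rfl⟩ := (hA.isPseudoSeparating_iff hg).mp hC
  have hmin' := ((hS'.isBdryPart hA).nonSeparated_iff hA hg hS').mp hns
  rw [(hmin' S hS).antisymm (hmin S' hS')]

end AnnMap

namespace CombMap

variable {M M' N N' : CombMap}

/-! ### Isomorphisms and parts -/

/-- `e` is an isomorphism of maps. -/
structure IsIso (M M' : CombMap) (e : M.Dart ≃ M'.Dart) : Prop where
  map_rot : ∀ x, e (M.rot x) = M'.rot (e x)
  map_opp : ∀ x, e (M.opp x) = M'.opp (e x)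

namespace IsIso

variable {e : M.Dart ≃ M'.Dart}

theorem symm (h : IsIso M M' e) : IsIso M' M e.symm where
  map_rot x := by rw [Equiv.symm_apply_eq, h.map_rot, Equiv.apply_symm_apply]
  map_opp x := by rw [Equiv.symm_apply_eq, h.map_opp, Equiv.apply_symm_apply]

theorem map_face (h : IsIso M M' e) (x : M.Dart) : e (M.face x) = M'.face (e x) := by
  apply M'.rot.injective
  rw [← h.map_rot, rot_face, rot_face, h.map_opp]

theorem of_map_face (hf : ∀ x, e (M.face x) = M'.face (e x))
    (ho : ∀ x, e (M.opp x) = M'.opp (e x)) : IsIso M M' e where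
  map_opp := ho
  map_rot x := by
    obtain ⟨y, rfl⟩ : ∃ y, M.face y = x := ⟨M.face⁻¹ x, Equiv.Perm.apply_inv_apply _ _⟩
    rw [rot_face, hf, rot_face, ho]

theorem sameOrigin (h : IsIso M M' e) {x y : M.Dart} (hxy : M.SameOrigin x y) :
    M'.SameOrigin (e x) (e y) := by
  obtain ⟨n, -, rfl⟩ := Equiv.Perm.SameCycle.exists_pow_eq' hxy
  clear hxy
  induction n with
  | zero => exact .refl _
  | succ n ih =>
    rw [pow_succ', Equiv.Perm.mul_apply, h.map_rot]
    exact Equiv.Perm.sameCycle_apply_right.mpr ih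

theorem sameOrigin_iff (h : IsIso M M' e) {x y : M.Dart} :
    M'.SameOrigin (e x) (e y) ↔ M.SameOrigin x y :=
  ⟨fun hxy => by simpa using h.symm.sameOrigin hxy, h.sameOrigin⟩

theorem faceInv_image (h : IsIso M M' e) {X : Set M.Dart} (hX : M.FaceInv X) :
    M'.FaceInv (e '' X) := by
  intro z
  obtain ⟨x, rfl⟩ := e.surjective z
  rw [← h.map_face, e.injective.mem_set_image, e.injective.mem_set_image, hX]

theorem bd_image (h : IsIso M M' e) (X : Set M.Dart) : M'.bd (e '' X) = e '' M.bd X := by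
  ext z
  obtain ⟨x, rfl⟩ := e.surjective z
  rw [e.injective.mem_set_image, mem_bd, mem_bd, ← h.map_opp, e.injective.mem_set_image,
    e.injective.mem_set_image]

theorem isCycle_image (h : IsIso M M' e) {C : Set M.Dart} {k : ℕ} (hC : M.IsCycle C k) :
    M'.IsCycle (e '' C) k := by
  obtain ⟨hk, a, h1, h2, h3, rfl⟩ := hC
  refine ⟨hk, e ∘ a, fun i j hij => h1 i j (h.sameOrigin_iff.mp hij), fun i j hij => ?_,
    fun i => ?_, ?_⟩
  · rw [Function.comp_apply, ← h.map_opp] at hij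
    exact h2 i j (e.injective hij)
  · rw [Function.comp_apply, ← h.map_opp]
    exact h.sameOrigin (h3 i)
  · rw [Set.image_union, Set.range_comp, ← Set.image_comp, ← Set.image_comp]
    congr 1
    exact Set.image_congr fun x _ => h.map_opp x

end IsIso

theorem IsPart.comp_iso {R : Set M.Dart} {φ : N.Dart → M.Dart} (h : IsPart N M R φ)
    {e : N'.Dart ≃ N.Dart} (he : IsIso N' N e) : IsPart N' M R (φ ∘ e) where
  faceInv := h.faceInv
  inj := h.inj.comp e.injective
  map_opp x := by rw [Function.comp_apply, he.map_opp, h.map_opp, Function.comp_apply]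
  edge x := h.edge _
  surj z hz := by
    obtain ⟨x, hx⟩ := h.surj z hz
    exact ⟨e.symm x, by simpa using hx⟩
  map_face x hx := by
    rw [Function.comp_apply, he.map_face]
    exact h.map_face _ hx
  face_notMem x hx := by
    rw [Function.comp_apply, he.map_face]
    exact h.face_notMem _ hx
  face_sameOrigin x hx := by
    rw [Function.comp_apply, Function.comp_apply, he.map_face]
    exact h.face_sameOrigin _ hx

theorem IsPart.iso_comp {R : Set M.Dart} {φ : N.Dart → M.Dart} (h : IsPart N M R φ)
    {e : M.Dart ≃ M'.Dart} (he : IsIso M M' e) : IsPart N M' (e '' R) (e ∘ φ) where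
  faceInv := he.faceInv_image h.faceInv
  inj := e.injective.comp h.inj
  map_opp x := by rw [Function.comp_apply, h.map_opp, he.map_opp, Function.comp_apply]
  edge x := by
    rw [Function.comp_apply, ← he.map_opp, e.injective.mem_set_image, e.injective.mem_set_image]
    exact h.edge x
  surj := by
    rintro _ ⟨z, hz, rfl⟩
    obtain ⟨x, rfl⟩ := h.surj z hz
    exact ⟨x, rfl⟩
  map_face x hx := by
    rw [Function.comp_apply, e.injective.mem_set_image] at hx
    rw [Function.comp_apply, h.map_face x hx, he.map_face, Function.comp_apply]
  face_notMem x hx := by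
    rw [Function.comp_apply, e.injective.mem_set_image] at hx ⊢
    exact h.face_notMem x hx
  face_sameOrigin x hx := by
    rw [Function.comp_apply, e.injective.mem_set_image] at hx
    rw [Function.comp_apply, Function.comp_apply, ← he.map_opp]
    exact he.sameOrigin (h.face_sameOrigin x hx)

/-- The part of a map cut out by a given region is unique up to isomorphism. -/
theorem IsPart.exists_iso {R : Set M.Dart} {φ : N.Dart → M.Dart} {φ' : N'.Dart → M.Dart}
    (h : IsPart N M R φ) (h' : IsPart N' M R φ') {k : ℕ} {c : ZMod k → M.Dart}
    (hc : M.Contour R c) : ∃ e : N.Dart ≃ N'.Dart, IsIso N N' e ∧ ∀ x, φ' (e x) = φ x := by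
  have key : ∀ {N N' : CombMap} {φ : N.Dart → M.Dart} {φ' : N'.Dart → M.Dart},
      IsPart N M R φ → IsPart N' M R φ' → ∀ x, ∃ y, φ' y = φ x := by
    intro N N' φ φ' h h' x
    rcases h.edge x with hx | hx
    · exact h'.surj _ hx
    · exact h'.exists_of_opp_mem hx
  choose f hf using key h h'
  choose g hg using key h' h
  let e : N.Dart ≃ N'.Dart := ⟨f, g, fun x => h.inj (by rw [hg, hf]),
    fun x => h'.inj (by rw [hf, hg])⟩
  have he : ∀ x, φ' (e x) = φ x := hf
  refine ⟨e, IsIso.of_map_face (fun x => h'.inj ?_) (fun x => h'.inj ?_), he⟩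
  · by_cases hx : φ x ∈ R
    · have hx' : φ' (e x) ∈ R := by rwa [he]
      rw [he, h.map_face x hx, h'.map_face _ hx', he]
    · have hx' : φ' (e x) ∉ R := by rwa [he]
      have h1 := h.face_notMem x hx
      have h2 := h'.face_notMem _ hx'
      rw [he]
      refine hc.eq_of_sameOrigin' h1 (h.opp_mem h1) h2 (h'.opp_mem h2) ?_
      have h3 := h'.face_sameOrigin _ hx'
      rw [he] at h3
      exact (h.face_sameOrigin x hx).symm.trans h3
  · rw [he, h.map_opp, h'.map_opp, he]

section Assemble

variable {N₁ N₂ : CombMap} {R : Set M.Dart} {R' : Set M'.Dart} {φ₁ : N₁.Dart → M.Dart}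
  {φ₂ : N₂.Dart → M.Dart} {ψ₁ : N₁.Dart → M'.Dart} {ψ₂ : N₂.Dart → M'.Dart}
  {k : ℕ} {c : ZMod k → M.Dart}

/-- The successor, along the cycle that separates two parts, of a common dart `φ₁ x = φ₂ y`. -/
theorem IsPart.common_face (h₁ : IsPart N₁ M R φ₁) (h₂ : IsPart N₂ M Rᶜ φ₂) (hc : M.Contour R c)
    {x : N₁.Dart} {y : N₂.Dart} (hx : φ₁ x ∉ R) (hxy : φ₁ x = φ₂ y) :
    φ₁ (N₁.face x) = φ₂ (N₂.opp (N₂.face⁻¹ (N₂.opp y))) := by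
  set u := N₂.face⁻¹ (N₂.opp y) with hu
  have hfu : N₂.face u = N₂.opp y := Equiv.Perm.apply_inv_apply _ _
  have h1 : φ₂ (N₂.opp y) ∈ R := by
    rw [h₂.map_opp, ← hxy]
    exact h₁.opp_mem hx
  have h2 : φ₂ u ∈ R := by
    have := h₂.faceInv_preimage_self.inv (N₂.opp y)
    rw [← hu] at this
    exact not_not.mp (mt this.mp (not_not.mpr h1))
  have h3 : φ₂ (N₂.opp u) ∉ R := by
    rw [h₂.map_opp]
    exact h₂.opp_mem (not_not.mpr h2)
  have h4 := h₁.face_notMem x hx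
  refine hc.eq_of_sameOrigin' h4 (h₁.opp_mem h4) h3 (by rwa [h₂.map_opp, M.opp_opp]) ?_
  have h5 := h₂.face_sameOrigin u (not_not.mpr h2)
  rw [hfu, ← h₂.map_opp, h₂.map_opp y, ← hxy] at h5
  exact (h₁.face_sameOrigin x hx).symm.trans h5.symm

/-- Two ways of gluing the same parts agree as soon as they agree at one dart. -/
theorem IsPart.common_iff [NeZero k] {k' : ℕ} {c' : ZMod k' → M'.Dart} (h₁ : IsPart N₁ M R φ₁)
    (h₂ : IsPart N₂ M Rᶜ φ₂) (g₁ : IsPart N₁ M' R' ψ₁) (g₂ : IsPart N₂ M' R'ᶜ ψ₂)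
    (hc : M.Contour R c) (hc' : M'.Contour R' c') (hR : ∀ x, φ₁ x ∈ R ↔ ψ₁ x ∈ R')
    {x₀ : N₁.Dart} {y₀ : N₂.Dart} (hx₀ : φ₁ x₀ ∉ R) (hφ : φ₁ x₀ = φ₂ y₀) (hψ : ψ₁ x₀ = ψ₂ y₀)
    (x : N₁.Dart) (y : N₂.Dart) : φ₁ x = φ₂ y ↔ ψ₁ x = ψ₂ y := by
  have key : ∀ x, φ₁ x ∉ R → ∃ y, φ₁ x = φ₂ y ∧ ψ₁ x = ψ₂ y := by
    intro x hx
    obtain ⟨a, ha⟩ := h₁.outer_isFace hc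
    have h1 : x₀ ∈ φ₁ ⁻¹' Rᶜ := hx₀
    have h2 : x ∈ φ₁ ⁻¹' Rᶜ := hx
    rw [ha] at h1 h2
    obtain ⟨n, -, rfl⟩ := Equiv.Perm.SameCycle.exists_pow_eq'
      (Equiv.Perm.SameCycle.trans (Equiv.Perm.SameCycle.symm h1) h2)
    clear h2 hx
    suffices h : φ₁ ((N₁.face ^ n) x₀) ∉ R ∧ ∃ y, φ₁ ((N₁.face ^ n) x₀) = φ₂ y ∧
        ψ₁ ((N₁.face ^ n) x₀) = ψ₂ y from h.2
    induction n with
    | zero => exact ⟨hx₀, y₀, hφ, hψ⟩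
    | succ n ih =>
      obtain ⟨hn, y, hy, hy'⟩ := ih
      rw [pow_succ', Equiv.Perm.mul_apply]
      exact ⟨h₁.face_notMem _ hn, _, h₁.common_face h₂ hc hn hy,
        g₁.common_face g₂ hc' (mt (hR _).mpr hn) hy'⟩
  by_cases hx : φ₁ x ∈ R
  · have hx' : ψ₁ x ∈ R' := (hR x).mp hx
    -- the common darts with the region on the left are the opposites of the other ones
    have key' : (φ₁ x = φ₂ y ∨ ψ₁ x = ψ₂ y) → φ₁ (N₁.opp x) ∉ R := by
      rintro (h | h)
      · rw [h₁.map_opp, h]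
        exact h₂.opp_mem (not_not.mpr (h ▸ hx))
      · rw [hR, g₁.map_opp, h]
        exact g₂.opp_mem (not_not.mpr (h ▸ hx'))
    have key'' : (φ₁ x = φ₂ y ∨ ψ₁ x = ψ₂ y) → ∃ y', φ₁ x = φ₂ y' ∧ ψ₁ x = ψ₂ y' := by
      intro h
      obtain ⟨y', h1, h2⟩ := key _ (key' h)
      refine ⟨N₂.opp y', ?_, ?_⟩
      · rw [h₂.map_opp, ← h1, h₁.map_opp, M.opp_opp]
      · rw [g₂.map_opp, ← h2, g₁.map_opp, M'.opp_opp]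
    constructor
    · intro h
      obtain ⟨y', h1, h2⟩ := key'' (.inl h)
      rwa [h₂.inj (h.symm.trans h1)]
    · intro h
      obtain ⟨y', h1, h2⟩ := key'' (.inr h)
      rwa [g₂.inj (h.symm.trans h2)]
  · obtain ⟨y', h1, h2⟩ := key x hx
    constructor
    · intro h
      rwa [h₂.inj (h.symm.trans h1)]
    · intro h
      rwa [g₂.inj (h.symm.trans h2)]

/-- A map is determined by its two parts and by the way they are glued. -/
theorem exists_iso_of_parts (h₁ : IsPart N₁ M R φ₁)
    (h₂ : IsPart N₂ M Rᶜ φ₂) (g₁ : IsPart N₁ M' R' ψ₁) (g₂ : IsPart N₂ M' R'ᶜ ψ₂)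
    (hR : ∀ x, φ₁ x ∈ R ↔ ψ₁ x ∈ R') (hR₂ : ∀ y, φ₂ y ∈ R ↔ ψ₂ y ∈ R')
    (hcomm : ∀ x y, φ₁ x = φ₂ y ↔ ψ₁ x = ψ₂ y) :
    ∃ e : M.Dart ≃ M'.Dart, IsIso M M' e ∧ (∀ x, e (φ₁ x) = ψ₁ x) ∧ ∀ y, e (φ₂ y) = ψ₂ y := by
  classical
  have hcov : ∀ z, (∃ x, φ₁ x = z) ∨ ∃ y, φ₂ y = z := fun z => by
    by_cases hz : z ∈ R
    · exact .inl (h₁.surj z hz)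
    · exact .inr (h₂.surj z hz)
  let f : M.Dart → M'.Dart := fun z =>
    if hz : z ∈ R then ψ₁ (h₁.surj z hz).choose else ψ₂ (h₂.surj z hz).choose
  have hf₁ : ∀ x, f (φ₁ x) = ψ₁ x := by
    intro x
    by_cases hx : φ₁ x ∈ R
    · simp only [f, dif_pos hx]
      rw [h₁.inj (h₁.surj _ hx).choose_spec]
    · simp only [f, dif_neg hx]
      exact ((hcomm _ _).mp (h₂.surj _ hx).choose_spec.symm).symm
  have hf₂ : ∀ y, f (φ₂ y) = ψ₂ y := by
    intro y
    by_cases hy : φ₂ y ∈ R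
    · simp only [f, dif_pos hy]
      exact (hcomm _ _).mp (h₁.surj _ hy).choose_spec
    · simp only [f, dif_neg hy]
      rw [h₂.inj (h₂.surj _ hy).choose_spec]
  have hbij : Function.Bijective f := by
    constructor
    · intro z z' hzz
      rcases hcov z with ⟨x, rfl⟩ | ⟨x, rfl⟩ <;> rcases hcov z' with ⟨x', rfl⟩ | ⟨x', rfl⟩ <;>
        simp only [hf₁, hf₂] at hzz
      · rw [g₁.inj hzz]
      · exact (hcomm _ _).mpr hzz
      · exact ((hcomm _ _).mpr hzz.symm).symm
      · rw [g₂.inj hzz]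
    · intro z
      by_cases hz : z ∈ R'
      · obtain ⟨x, rfl⟩ := g₁.surj z hz
        exact ⟨φ₁ x, hf₁ x⟩
      · obtain ⟨y, rfl⟩ := g₂.surj z hz
        exact ⟨φ₂ y, hf₂ y⟩
  refine ⟨Equiv.ofBijective f hbij, IsIso.of_map_face (fun z => ?_) (fun z => ?_), hf₁, hf₂⟩ <;>
    simp only [Equiv.ofBijective_apply]
  · by_cases hz : z ∈ R
    · obtain ⟨x, rfl⟩ := h₁.surj z hz
      rw [← h₁.map_face x hz, hf₁, hf₁, g₁.map_face x ((hR x).mp hz)]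
    · obtain ⟨y, rfl⟩ := h₂.surj z hz
      rw [← h₂.map_face y hz, hf₂, hf₂, g₂.map_face y (mt (hR₂ y).mpr hz)]
  · rcases hcov z with ⟨x, rfl⟩ | ⟨y, rfl⟩
    · rw [← h₁.map_opp, hf₁, hf₁, g₁.map_opp]
    · rw [← h₂.map_opp, hf₂, hf₂, g₂.map_opp]

end Assemble

end CombMap

namespace MarkedMap

open CombMap AnnMap

variable {κ : (A : MarkedMap) → Set A.Dart} {p d : ℕ} {A B N₁ N₂ N₁' N₂' : MarkedMap}
  {S : Set A.Dart} {S' : Set B.Dart} {φ₁ : N₁.Dart → A.Dart} {φ₂ : N₂.Dart → A.Dart}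
  {ψ₁ : N₁.Dart → B.Dart} {ψ₂ : N₂.Dart → B.Dart}

/-! ### Decompositions of marked maps -/

theorem Iso.isIso (e : Iso A B) : IsIso A.toCombMap B.toCombMap e.toEquiv := ⟨e.map_rot, e.map_opp⟩

/-- `A` is decomposed by the region `S` into the marked maps `N₁` (on the side of the boundary face)
and `N₂` (on the side of the root-face). -/
structure Decomp (κ : (A : MarkedMap) → Set A.Dart) (d : ℕ) (A N₁ N₂ : MarkedMap) (S : Set A.Dart)
    (φ₁ : N₁.Dart → A.Dart) (φ₂ : N₂.Dart → A.Dart) : Prop where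
  region : A.IsRegion d S
  bdryPart : IsBdryPart N₁.toAnnMap A.toAnnMap S φ₁
  rootPart : IsRootPart N₂.toAnnMap A.toAnnMap S φ₂
  mark₁ : N₁.mark = φ₁ ⁻¹' A.mark
  mark₂ : N₂.mark = {y | ∃ x ∈ κ N₁, A.SameOrigin (φ₁ x) (φ₂ y)}

theorem decomp_parts (hA : A.IsAnnular p d) (hS : A.IsRegion d S) :
    Decomp κ d A (A.bdryPartMarked (A.bd S)) (A.rootPartMarked κ (A.bd S)) S
      (A.subIncl (A.side (A.bd S) A.bdry)) (A.subIncl (A.side (A.bd S) A.root)) :=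
  ⟨hS, hS.isBdryPart hA, hS.isRootPart hA, rfl, rfl⟩

theorem _root_.AnnMap.IsRegion.image (hS : A.IsRegion d S) (e : Iso A B) :
    B.IsRegion d (e.toEquiv '' S) where
  faceInv := e.isIso.faceInv_image hS.faceInv
  bdry_subset := by
    rw [← e.map_bdry]
    exact Set.image_mono hS.bdry_subset
  root_subset := by
    rw [← e.map_root, ← Set.image_compl_eq e.toEquiv.bijective]
    exact Set.image_mono hS.root_subset
  isCycle := by
    rw [e.isIso.bd_image]
    exact e.isIso.isCycle_image hS.isCycle

theorem Decomp.map (h : Decomp κ d A N₁ N₂ S φ₁ φ₂) (e : Iso A B) :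
    Decomp κ d B N₁ N₂ (e.toEquiv '' S) (e.toEquiv ∘ φ₁) (e.toEquiv ∘ φ₂) where
  region := h.region.image e
  bdryPart := by
    refine ⟨h.bdryPart.isPart.iso_comp e.isIso, ?_, ?_⟩
    · rw [h.bdryPart.bdry_eq, ← e.map_bdry, Set.preimage_comp, Equiv.preimage_image]
    · rw [h.bdryPart.root_eq, ← Set.image_compl_eq e.toEquiv.bijective, Set.preimage_comp,
        Equiv.preimage_image]
  rootPart := by
    refine ⟨?_, ?_, ?_⟩
    · rw [← Set.image_compl_eq e.toEquiv.bijective]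
      exact h.rootPart.isPart.iso_comp e.isIso
    · rw [h.rootPart.bdry_eq, Set.preimage_comp, Equiv.preimage_image]
    · rw [h.rootPart.root_eq, ← e.map_root, Set.preimage_comp, Equiv.preimage_image]
  mark₁ := by rw [h.mark₁, ← e.map_mark, Set.preimage_comp, Equiv.preimage_image]
  mark₂ := by
    rw [h.mark₂]
    ext y
    simp only [Function.comp_apply, e.isIso.sameOrigin_iff, Set.mem_ofPred_eq]

theorem Decomp.comp (h : Decomp κ d A N₁ N₂ S φ₁ φ₂) (hκ : IsCoMarking p d κ)
    (hN : N₁'.IsMarkedAnnular p d) (α : Iso N₁' N₁) (β : Iso N₂' N₂) :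
    Decomp κ d A N₁' N₂' S (φ₁ ∘ α.toEquiv) (φ₂ ∘ β.toEquiv) where
  region := h.region
  bdryPart := by
    refine ⟨h.bdryPart.isPart.comp_iso α.isIso, ?_, ?_⟩
    · rw [Set.preimage_comp, ← h.bdryPart.bdry_eq, ← α.map_bdry, Equiv.preimage_image]
    · rw [Set.preimage_comp, ← h.bdryPart.root_eq, ← α.map_root, Equiv.preimage_image]
  rootPart := by
    refine ⟨h.rootPart.isPart.comp_iso β.isIso, ?_, ?_⟩
    · rw [Set.preimage_comp, ← h.rootPart.bdry_eq, ← β.map_bdry, Equiv.preimage_image]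
    · rw [Set.preimage_comp, ← h.rootPart.root_eq, ← β.map_root, Equiv.preimage_image]
  mark₁ := by rw [Set.preimage_comp, ← h.mark₁, ← α.map_mark, Equiv.preimage_image]
  mark₂ := by
    have h1 : N₂'.mark = β.toEquiv ⁻¹' N₂.mark := by rw [← β.map_mark, Equiv.preimage_image]
    rw [h1, h.mark₂, ← hκ.natural _ _ α hN]
    ext y
    simp only [Set.mem_preimage, Set.mem_ofPred_eq, Set.exists_mem_image, Function.comp_apply]

theorem Decomp.unique {φ₁' : N₁'.Dart → A.Dart} {φ₂' : N₂'.Dart → A.Dart}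
    (h : Decomp κ d A N₁ N₂ S φ₁ φ₂) (h' : Decomp κ d A N₁' N₂' S φ₁' φ₂') (hκ : IsCoMarking p d κ)
    (hN : N₁.IsMarkedAnnular p d) : Nonempty (Iso N₁ N₁') ∧ Nonempty (Iso N₂ N₂') := by
  obtain ⟨c, hc⟩ := h.region.isCycle.exists_contour h.region.faceInv
  obtain ⟨e₁, he₁, h1⟩ := h.bdryPart.isPart.exists_iso h'.bdryPart.isPart hc
  obtain ⟨e₂, he₂, h2⟩ := h.rootPart.isPart.exists_iso h'.rootPart.isPart hc.compl
  have hcomp₁ : ∀ X : Set A.Dart, e₁ '' (φ₁ ⁻¹' X) = φ₁' ⁻¹' X := by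
    intro X
    rw [show φ₁ = φ₁' ∘ e₁ from (funext h1).symm, Set.preimage_comp, Equiv.image_preimage]
  have hcomp₂ : ∀ X : Set A.Dart, e₂ '' (φ₂ ⁻¹' X) = φ₂' ⁻¹' X := by
    intro X
    rw [show φ₂ = φ₂' ∘ e₂ from (funext h2).symm, Set.preimage_comp, Equiv.image_preimage]
  let α : Iso N₁ N₁' := ⟨e₁, he₁.map_rot, he₁.map_opp,
    by rw [h.bdryPart.bdry_eq, h'.bdryPart.bdry_eq, hcomp₁],
    by rw [h.bdryPart.root_eq, h'.bdryPart.root_eq, hcomp₁],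
    by rw [h.mark₁, h'.mark₁, hcomp₁]⟩
  refine ⟨⟨α⟩, ⟨⟨e₂, he₂.map_rot, he₂.map_opp,
    by rw [h.rootPart.bdry_eq, h'.rootPart.bdry_eq, hcomp₂],
    by rw [h.rootPart.root_eq, h'.rootPart.root_eq, hcomp₂], ?_⟩⟩⟩
  have hα : ∀ x, φ₁' (α.toEquiv x) = φ₁ x := h1
  rw [h.mark₂, h'.mark₂, ← hκ.natural _ _ α hN]
  ext y
  obtain ⟨z, rfl⟩ := e₂.surjective y
  rw [e₂.injective.mem_set_image]
  simp only [Set.mem_ofPred_eq, Set.exists_mem_image, hα, h2]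

/-- The co-marked vertex, seen from the two parts. -/
theorem Decomp.exists_comark (h : Decomp κ d A N₁ N₂ S φ₁ φ₂) (hκ : IsCoMarking p d κ)
    (hN : N₁.IsMarkedAnnular p d) : ∃ x y, φ₁ x ∉ S ∧ φ₁ x = φ₂ y ∧
      ∀ x', x' ∈ κ N₁ ↔ N₁.SameOrigin x x' := by
  obtain ⟨x, hx, hxr⟩ := hκ.outer _ hN
  obtain ⟨a, ha⟩ := hκ.vertex _ hN
  rw [h.bdryPart.root_eq] at hxr
  obtain ⟨y, hy⟩ := h.rootPart.isPart.surj _ hxr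
  refine ⟨x, y, hxr, hy.symm, fun x' => ?_⟩
  rw [ha] at hx ⊢
  exact ⟨fun h => SameOrigin.trans (SameOrigin.symm hx) h, fun h => SameOrigin.trans hx h⟩

theorem Decomp.mem_mark₂ (h : Decomp κ d A N₁ N₂ S φ₁ φ₂) {x : N₁.Dart}
    (hx : ∀ x', x' ∈ κ N₁ ↔ N₁.SameOrigin x x') (y : N₂.Dart) :
    y ∈ N₂.mark ↔ A.SameOrigin (φ₁ x) (φ₂ y) := by
  rw [h.mark₂]
  constructor
  · rintro ⟨x', hx', h'⟩
    exact (h.bdryPart.isPart.sameOrigin ((hx x').mp hx')).trans h'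
  · exact fun h' => ⟨x, (hx x).mpr (.refl x), h'⟩

theorem Decomp.isMarkedAnnular₁ (h : Decomp κ d A N₁ N₂ S φ₁ φ₂) (hA : A.IsMarkedAnnular p d) :
    N₁.IsMarkedAnnular p d := by
  obtain ⟨c, hc⟩ := h.region.isCycle.exists_contour h.region.faceInv
  obtain ⟨z, hz, hzb⟩ := hA.mark_bdry
  obtain ⟨x, rfl⟩ := h.bdryPart.isPart.surj z (h.region.bdry_subset hzb)
  obtain ⟨a, ha⟩ := hA.mark_vertex
  refine ⟨h.bdryPart.isAnnular hA.annular h.region, ⟨x, ?_⟩, ⟨x, ?_, ?_⟩⟩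
  · rw [h.mark₁]
    rw [ha] at hz ⊢
    ext x'
    have h1 := h.bdryPart.isPart.sameOrigin_iff hc (x := x) (y := x')
    refine Iff.trans ⟨fun h' => ?_, fun h' => ?_⟩ h1.symm
    · exact SameOrigin.trans (SameOrigin.symm hz) h'
    · exact SameOrigin.trans hz h'
  · rwa [h.mark₁]
  · rwa [h.bdryPart.bdry_eq]

theorem Decomp.isMarkedAnnular₂ (h : Decomp κ d A N₁ N₂ S φ₁ φ₂) (hκ : IsCoMarking p d κ)
    (hA : A.IsMarkedAnnular p d) : N₂.IsMarkedAnnular d d := by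
  obtain ⟨c, hc⟩ := h.region.isCycle.exists_contour h.region.faceInv
  obtain ⟨x, y, hxS, hxy, hx⟩ := h.exists_comark hκ (h.isMarkedAnnular₁ hA)
  have hmark := h.mem_mark₂ hx
  obtain ⟨i, hi⟩ := hc.surj _ (h.bdryPart.isPart.opp_mem hxS) (by rwa [A.opp_opp])
  obtain ⟨u, hu⟩ := h.rootPart.isPart.exists_of_opp_mem (z := c (i + 1)) (hc.opp_notMem _)
  refine ⟨h.rootPart.isAnnular hA.annular h.region, ⟨y, ?_⟩, ⟨u, ?_, ?_⟩⟩
  · ext y'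
    rw [hmark, hxy]
    exact (h.rootPart.isPart.sameOrigin_iff hc.compl).symm
  · rw [hmark, hu]
    have := hc.next i
    rwa [hi, A.opp_opp] at this
  · rw [h.rootPart.bdry_eq, Set.mem_preimage, hu]
    exact hc.mem _

/-- A marked map is determined by its two marked parts. -/
theorem Decomp.injective (h : Decomp κ d A N₁ N₂ S φ₁ φ₂) (h' : Decomp κ d B N₁ N₂ S' ψ₁ ψ₂)
    (hκ : IsCoMarking p d κ) (hA : A.IsMarkedAnnular p d) (hB : B.IsMarkedAnnular p d) :
    Nonempty (Iso A B) := by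
  obtain ⟨c, hc⟩ := h.region.isCycle.exists_contour h.region.faceInv
  obtain ⟨c', hc'⟩ := h'.region.isCycle.exists_contour h'.region.faceInv
  have : NeZero d := ⟨h.region.isCycle.1.ne'⟩
  have hR : ∀ x, φ₁ x ∈ S ↔ ψ₁ x ∈ S' := fun x =>
    not_iff_not.mp (Set.ext_iff.mp (h.bdryPart.root_eq.symm.trans h'.bdryPart.root_eq) x)
  have hR₂ : ∀ y, φ₂ y ∈ S ↔ ψ₂ y ∈ S' := fun y =>
    Set.ext_iff.mp (h.rootPart.bdry_eq.symm.trans h'.rootPart.bdry_eq) y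
  obtain ⟨x, y, hxS, hxy, hx⟩ := h.exists_comark hκ (h.isMarkedAnnular₁ hA)
  have hxy' : ψ₁ x = ψ₂ y := by
    have h1 : y ∈ N₂.mark := (h.mem_mark₂ hx y).mpr (hxy ▸ .refl _)
    have h2 := (h'.mem_mark₂ hx y).mp h1
    have hxS' : ψ₁ x ∉ S' := mt (hR x).mpr hxS
    refine hc'.eq_of_sameOrigin' hxS' (h'.bdryPart.isPart.opp_mem hxS') ?_ ?_ h2
    · rw [← hR₂, ← hxy]
      exact hxS
    · rw [← h'.rootPart.isPart.map_opp, ← hR₂, h.rootPart.isPart.map_opp, ← hxy]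
      exact h.bdryPart.isPart.opp_mem hxS
  obtain ⟨e, he, he₁, he₂⟩ := exists_iso_of_parts h.bdryPart.isPart h.rootPart.isPart
    h'.bdryPart.isPart h'.rootPart.isPart hR hR₂
    (h.bdryPart.isPart.common_iff h.rootPart.isPart h'.bdryPart.isPart h'.rootPart.isPart hc hc' hR
      hxS hxy hxy')
  refine ⟨⟨e, he.map_rot, he.map_opp, ?_, ?_, ?_⟩⟩
  · have h1 : A.bdry = φ₁ '' N₁.bdry := by
      rw [h.bdryPart.bdry_eq, Set.image_preimage_eq_of_subset]
      exact fun z hz => h.bdryPart.isPart.surj z (h.region.bdry_subset hz)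
    have h2 : B.bdry = ψ₁ '' N₁.bdry := by
      rw [h'.bdryPart.bdry_eq, Set.image_preimage_eq_of_subset]
      exact fun z hz => h'.bdryPart.isPart.surj z (h'.region.bdry_subset hz)
    rw [h1, h2, ← Set.image_comp]
    exact Set.image_congr fun x _ => he₁ x
  · have h1 : A.root = φ₂ '' N₂.root := by
      rw [h.rootPart.root_eq, Set.image_preimage_eq_of_subset]
      exact fun z hz => h.rootPart.isPart.surj z (h.region.root_subset hz)
    have h2 : B.root = ψ₂ '' N₂.root := by
      rw [h'.rootPart.root_eq, Set.image_preimage_eq_of_subset]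
      exact fun z hz => h'.rootPart.isPart.surj z (h'.region.root_subset hz)
    rw [h1, h2, ← Set.image_comp]
    exact Set.image_congr fun x _ => he₂ x
  · obtain ⟨z, hz, hzb⟩ := hA.mark_bdry
    obtain ⟨u, rfl⟩ := h.bdryPart.isPart.surj z (h.region.bdry_subset hzb)
    have hu : ψ₁ u ∈ B.mark := by
      have h1 : u ∈ N₁.mark := h.mark₁ ▸ hz
      exact (h'.mark₁ ▸ h1 : u ∈ ψ₁ ⁻¹' B.mark)
    obtain ⟨a, ha⟩ := hA.mark_vertex
    obtain ⟨b, hb⟩ := hB.mark_vertex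
    rw [ha] at hz ⊢
    rw [hb] at hu ⊢
    ext w
    obtain ⟨v, rfl⟩ := e.surjective w
    rw [e.injective.mem_set_image]
    have h1 : A.SameOrigin (φ₁ u) v ↔ B.SameOrigin (ψ₁ u) (e v) := by
      rw [← he₁, he.sameOrigin_iff]
    constructor
    · exact fun h' => SameOrigin.trans hu (h1.mp (SameOrigin.trans (SameOrigin.symm hz) h'))
    · exact fun h' => SameOrigin.trans hz (h1.mpr (SameOrigin.trans (SameOrigin.symm hu) h'))

end MarkedMap

namespace CombMap

/-! ### Gluing two maps along a face -/

/-- The data for gluing two maps along a face of each of them: the contours `a` and `b` of these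
faces are simple cycles of the same length, and the edge of `a i` is glued to that of `b (s - i)`,
in opposite directions. -/
structure Seam (M₁ M₂ : CombMap) (d : ℕ) where
  r₁ : Set M₁.Dart
  r₂ : Set M₂.Dart
  a : ZMod d → M₁.Dart
  b : ZMod d → M₂.Dart
  s : ZMod d
  faceInv₁ : M₁.FaceInv r₁
  faceInv₂ : M₂.FaceInv r₂
  contour₁ : M₁.Contour r₁ a
  contour₂ : M₂.Contour r₂ b
  opp₁ : ∀ x ∈ r₁, M₁.opp x ∉ r₁
  opp₂ : ∀ x ∈ r₂, M₂.opp x ∉ r₂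

namespace Seam

variable {M₁ M₂ : CombMap} {d : ℕ} (D : Seam M₁ M₂ d)

/-- The same gluing with the roles of the two maps exchanged. -/
def symm : Seam M₂ M₁ d :=
  ⟨D.r₂, D.r₁, D.b, D.a, D.s, D.faceInv₂, D.faceInv₁, D.contour₂, D.contour₁,
  D.opp₂, D.opp₁⟩

theorem exists_a {x : M₁.Dart} (hx : x ∈ D.r₁) : ∃ i, D.a i = x :=
  D.contour₁.surj x hx (D.opp₁ x hx)

/-- The dart of the second map that is glued to a dart of the first face, in opposite directions. -/
noncomputable def glued (x : M₁.Dart) : M₂.Dart := D.b (D.s - Function.invFun D.a x)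

theorem glued_a (i : ZMod d) : D.glued (D.a i) = D.b (D.s - i) := by
  rw [glued, Function.leftInverse_invFun D.contour₁.injective i]

theorem glued_mem (x : M₁.Dart) : D.glued x ∈ D.r₂ := D.contour₂.mem _

theorem symm_glued_glued {x : M₁.Dart} (hx : x ∈ D.r₁) : D.symm.glued (D.glued x) = x := by
  obtain ⟨i, rfl⟩ := D.exists_a hx
  rw [glued_a]
  refine (D.symm.glued_a (D.s - i)).trans ?_
  change D.a (D.s - (D.s - i)) = D.a i
  rw [sub_sub_cancel]

/-- The darts of the glued map: all darts except those of the two faces. -/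
abbrev GluedDart : Type := {x // x ∉ D.r₁} ⊕ {y // y ∉ D.r₂}

open Classical in
/-- The first map inside the glued map. -/
noncomputable def incl₁ (x : M₁.Dart) : D.GluedDart :=
  if h : x ∈ D.r₁ then .inr ⟨M₂.opp (D.glued x), D.opp₂ _ (D.glued_mem x)⟩ else .inl ⟨x, h⟩

/-- The second map inside the glued map. -/
noncomputable def incl₂ (y : M₂.Dart) : D.GluedDart := (D.symm.incl₁ y).swap

theorem incl₁_of_mem {x : M₁.Dart} (h : x ∈ D.r₁) :
    D.incl₁ x = .inr ⟨M₂.opp (D.glued x), D.opp₂ _ (D.glued_mem x)⟩ := dif_pos h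

theorem incl₁_of_notMem {x : M₁.Dart} (h : x ∉ D.r₁) : D.incl₁ x = .inl ⟨x, h⟩ := dif_neg h

theorem incl₂_of_mem {y : M₂.Dart} (h : y ∈ D.r₂) :
    D.incl₂ y = .inl ⟨M₁.opp (D.symm.glued y), D.opp₁ _ (D.symm.glued_mem y)⟩ := by
  rw [incl₂, D.symm.incl₁_of_mem h]
  rfl

theorem incl₂_of_notMem {y : M₂.Dart} (h : y ∉ D.r₂) : D.incl₂ y = .inr ⟨y, h⟩ := by
  rw [incl₂, D.symm.incl₁_of_notMem h]
  rfl

theorem incl₁_injective : Function.Injective D.incl₁ := by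
  intro x y hxy
  by_cases hx : x ∈ D.r₁ <;> by_cases hy : y ∈ D.r₁
  · rw [D.incl₁_of_mem hx, D.incl₁_of_mem hy] at hxy
    have h1 := congrArg Subtype.val (Sum.inr_injective hxy)
    rw [← D.symm_glued_glued hx, M₂.opp.injective h1, D.symm_glued_glued hy]
  · simp [D.incl₁_of_mem hx, D.incl₁_of_notMem hy] at hxy
  · simp [D.incl₁_of_notMem hx, D.incl₁_of_mem hy] at hxy
  · rw [D.incl₁_of_notMem hx, D.incl₁_of_notMem hy] at hxy
    exact congrArg Subtype.val (Sum.inl_injective hxy)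

/-- The opposite of a dart in the glued map. -/
noncomputable def oppFun : D.GluedDart → D.GluedDart :=
  Sum.elim (fun x => D.incl₁ (M₁.opp x.1)) (fun y => D.incl₂ (M₂.opp y.1))

theorem oppFun_incl₁ (x : M₁.Dart) : D.oppFun (D.incl₁ x) = D.incl₁ (M₁.opp x) := by
  by_cases hx : x ∈ D.r₁
  · rw [D.incl₁_of_mem hx, D.incl₁_of_notMem (D.opp₁ x hx)]
    change D.incl₂ (M₂.opp (M₂.opp (D.glued x))) = _
    rw [M₂.opp_opp, D.incl₂_of_mem (D.glued_mem x)]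
    simp only [D.symm_glued_glued hx]
  · rw [D.incl₁_of_notMem hx]
    rfl

theorem symm_oppFun (z : D.GluedDart) : D.symm.oppFun z.swap = (D.oppFun z).swap := by
  rcases z with z | z
  · rfl
  · exact (Sum.swap_swap _).symm

theorem oppFun_incl₂ (y : M₂.Dart) : D.oppFun (D.incl₂ y) = D.incl₂ (M₂.opp y) := by
  rw [incl₂, incl₂, ← D.symm.oppFun_incl₁, ← D.symm.symm_oppFun]
  rfl

theorem oppFun_oppFun (z : D.GluedDart) : D.oppFun (D.oppFun z) = z := by
  rcases z with ⟨x, hx⟩ | ⟨y, hy⟩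
  · rw [← D.incl₁_of_notMem hx, oppFun_incl₁, oppFun_incl₁, M₁.opp_opp]
  · rw [← D.incl₂_of_notMem hy, oppFun_incl₂, oppFun_incl₂, M₂.opp_opp]

theorem oppFun_ne (z : D.GluedDart) : D.oppFun z ≠ z := by
  rcases z with ⟨x, hx⟩ | ⟨y, hy⟩
  · rw [← D.incl₁_of_notMem hx, oppFun_incl₁]
    exact fun h => M₁.opp_ne x (D.incl₁_injective h)
  · rw [← D.incl₂_of_notMem hy, oppFun_incl₂]
    exact fun h => M₂.opp_ne y (D.symm.incl₁_injective (Sum.swap_leftInverse.injective h))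

/-- The face permutation of the glued map. -/
def facePerm : Equiv.Perm D.GluedDart :=
  Equiv.sumCongr (M₁.face.subtypePerm fun x => not_congr (D.faceInv₁ x))
    (M₂.face.subtypePerm fun y => not_congr (D.faceInv₂ y))

/-- The glued map, defined by its faces and its edges. -/
noncomputable def glue : CombMap where
  Dart := D.GluedDart
  finite := inferInstance
  rot := Function.Involutive.toPerm D.oppFun D.oppFun_oppFun * D.facePerm⁻¹
  opp := Function.Involutive.toPerm D.oppFun D.oppFun_oppFun
  opp_opp := D.oppFun_oppFun
  opp_ne := D.oppFun_ne

theorem glue_face (z : D.GluedDart) : D.glue.face z = D.facePerm z :=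
  congrArg D.facePerm (D.oppFun_oppFun z)

/-- The first map inside the glued map. -/
noncomputable def map₁ (x : M₁.Dart) : D.glue.Dart := D.incl₁ x

/-- The second map inside the glued map. -/
noncomputable def map₂ (y : M₂.Dart) : D.glue.Dart := D.incl₂ y

/-- The part of the glued map that comes from the first map. -/
def region : Set D.glue.Dart := {z : D.GluedDart | z.isLeft}

theorem map₁_mem_region {x : M₁.Dart} : D.map₁ x ∈ D.region ↔ x ∉ D.r₁ := by
  change (D.incl₁ x).isLeft = true ↔ _
  by_cases hx : x ∈ D.r₁
  · simp [D.incl₁_of_mem hx, hx]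
  · simp [D.incl₁_of_notMem hx, hx]

theorem map₂_mem_region {y : M₂.Dart} : D.map₂ y ∈ D.region ↔ y ∈ D.r₂ := by
  change (D.incl₂ y).isLeft = true ↔ _
  by_cases hy : y ∈ D.r₂
  · simp [D.incl₂_of_mem hy, hy]
  · simp [D.incl₂_of_notMem hy, hy]

theorem exists_map (z : D.glue.Dart) :
    (∃ x ∉ D.r₁, D.map₁ x = z) ∨ ∃ y ∉ D.r₂, D.map₂ y = z := by
  have h : ∀ z : D.GluedDart, (∃ x ∉ D.r₁, D.incl₁ x = z) ∨ ∃ y ∉ D.r₂, D.incl₂ y = z := by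
    rintro (⟨x, hx⟩ | ⟨y, hy⟩)
    · exact .inl ⟨x, hx, D.incl₁_of_notMem hx⟩
    · exact .inr ⟨y, hy, D.incl₂_of_notMem hy⟩
  exact h z

theorem map₁_injective : Function.Injective D.map₁ := D.incl₁_injective

theorem map₁_opp (x : M₁.Dart) : D.map₁ (M₁.opp x) = D.glue.opp (D.map₁ x) :=
  (D.oppFun_incl₁ x).symm

theorem map₁_eq_map₂ {x : M₁.Dart} (hx : x ∈ D.r₁) : D.map₁ x = D.map₂ (M₂.opp (D.glued x)) :=
  (D.incl₁_of_mem hx).trans (D.incl₂_of_notMem _).symm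

theorem map₁_face {x : M₁.Dart} (hx : x ∉ D.r₁) :
    D.map₁ (M₁.face x) = D.glue.face (D.map₁ x) := by
  refine Eq.trans ?_ (D.glue_face (D.incl₁ x)).symm
  rw [D.incl₁_of_notMem hx]
  exact D.incl₁_of_notMem (mt (D.faceInv₁ x).mp hx)

theorem map₁_rot {x : M₁.Dart} (hx : x ∉ D.r₁) :
    D.map₁ (M₁.rot x) = D.glue.rot (D.map₁ x) := by
  obtain ⟨y, rfl⟩ : ∃ y, M₁.face y = x := ⟨M₁.face⁻¹ x, Equiv.Perm.apply_inv_apply _ _⟩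
  rw [D.map₁_face (mt (D.faceInv₁ y).mpr hx), rot_face, rot_face, map₁_opp]

/-- Exchanging the two maps. -/
def swap : D.symm.glue.Dart ≃ D.glue.Dart := Equiv.sumComm _ _

theorem swap_map₁ (y : M₂.Dart) : D.swap (D.symm.map₁ y) = D.map₂ y := rfl

theorem swap_map₂ (x : M₁.Dart) : D.swap (D.symm.map₂ x) = D.map₁ x := Sum.swap_swap _

theorem isIso_swap : IsIso D.symm.glue D.glue D.swap := by
  refine IsIso.of_map_face (fun z => ?_) (fun z => ?_)
  · refine Eq.trans ?_ (D.glue_face _).symm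
    refine (congrArg D.swap (D.symm.glue_face z)).trans ?_
    rcases z with z | z <;> rfl
  · exact (D.symm.symm_oppFun z).symm

theorem faceInv_region : D.glue.FaceInv D.region := by
  have h1 : ∀ {M₁ M₂ : CombMap} (D : Seam M₁ M₂ d), ∀ x ∉ D.r₁,
      (D.glue.face (D.map₁ x) ∈ D.region ↔ D.map₁ x ∈ D.region) := by
    intro M₁ M₂ D x hx
    rw [← D.map₁_face hx, map₁_mem_region, map₁_mem_region, D.faceInv₁]
  have h2 : ∀ z, D.swap z ∈ D.region ↔ z ∉ D.symm.region := by
    intro z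
    rcases D.symm.exists_map z with ⟨y, hy, rfl⟩ | ⟨x, hx, rfl⟩
    · rw [swap_map₁, map₂_mem_region, map₁_mem_region, not_not]
      rfl
    · rw [swap_map₂, map₁_mem_region, map₂_mem_region]
      rfl
  intro z
  rcases D.exists_map z with ⟨x, hx, rfl⟩ | ⟨y, hy, rfl⟩
  · exact h1 D x hx
  · rw [← swap_map₁, ← D.isIso_swap.map_face, h2, h2, h1 D.symm y hy]

theorem isPart₁ : IsPart M₁ D.glue D.region D.map₁ where
  faceInv := D.faceInv_region
  inj := D.map₁_injective
  map_opp := D.map₁_opp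
  edge x := by
    rw [← map₁_opp, map₁_mem_region, map₁_mem_region, or_iff_not_imp_left, not_not]
    exact D.opp₁ x
  surj z hz := by
    rcases D.exists_map z with ⟨x, -, rfl⟩ | ⟨y, hy, rfl⟩
    · exact ⟨x, rfl⟩
    · exact absurd (D.map₂_mem_region.mp hz) hy
  map_face x hx := D.map₁_face (D.map₁_mem_region.mp hx)
  face_notMem x hx := by
    rw [map₁_mem_region, D.faceInv₁, ← map₁_mem_region]
    exact hx
  face_sameOrigin x hx := by
    rw [map₁_mem_region, not_not] at hx
    -- turning around the vertex in the first map, the glued face is met at `face x` only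
    obtain ⟨z, hz, hQ, hs⟩ := Equiv.Perm.SameCycle.exists_first_mem (T := D.r₁)
      (Q := fun z => D.glue.SameOrigin (D.glue.opp (D.map₁ x)) (D.map₁ z))
      (sameOrigin_opp_face x) (by
        rw [← map₁_opp]
        exact .refl _) ((D.faceInv₁ x).mpr hx) (fun z hQ hz => by
          rw [D.map₁_rot hz]
          exact Equiv.Perm.sameCycle_apply_right.mpr hQ)
    have h1 : M₁.face x ∈ D.r₁ := (D.faceInv₁ x).mpr hx
    rwa [← D.contour₁.eq_of_sameOrigin hz (D.opp₁ _ hz) h1 (D.opp₁ _ h1)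
      (SameOrigin.trans (SameOrigin.symm hs) (sameOrigin_opp_face x))]

theorem isPart₂ : IsPart M₂ D.glue D.regionᶜ D.map₂ := by
  have h := D.symm.isPart₁.iso_comp D.isIso_swap
  have h1 : D.swap '' D.symm.region = D.regionᶜ := by
    ext z
    obtain ⟨z, rfl⟩ := D.swap.surjective z
    rw [D.swap.injective.mem_set_image, Set.mem_compl_iff]
    rcases D.symm.exists_map z with ⟨y, hy, rfl⟩ | ⟨x, hx, rfl⟩
    · rw [swap_map₁, map₂_mem_region, map₁_mem_region]
      rfl
    · rw [swap_map₂, map₁_mem_region, map₂_mem_region, not_not]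
      rfl
  rw [h1] at h
  exact h

/-- The indices of the vertices of the seam at which a dart of the glued map starts. -/
def seamIndex (z : D.glue.Dart) : Set (ZMod d) :=
  Sum.elim (fun x : {x // x ∉ D.r₁} => {i | M₁.SameOrigin x.1 (D.a i)})
    (fun y : {y // y ∉ D.r₂} => {i | M₂.SameOrigin y.1 (D.b (D.s + 1 - i))}) z

theorem seamIndex_map₁ (x : M₁.Dart) : D.seamIndex (D.map₁ x) = {i | M₁.SameOrigin x (D.a i)} := by
  by_cases hx : x ∈ D.r₁
  · obtain ⟨m, rfl⟩ := D.exists_a hx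
    have h0 : D.seamIndex (D.map₁ (D.a m)) =
        {i | M₂.SameOrigin (M₂.opp (D.glued (D.a m))) (D.b (D.s + 1 - i))} := by
      rw [seamIndex, map₁, D.incl₁_of_mem hx]
      rfl
    rw [h0, glued_a]
    ext i
    have h := D.contour₂.next (D.s - m)
    constructor
    · intro h'
      have := D.contour₂.simple _ _ (h.symm.trans h')
      have h2 : m = i := by linear_combination -this
      rw [h2]
      exact .refl _
    · intro h'
      rw [← D.contour₁.simple _ _ h']
      rw [show D.s - m + 1 = D.s + 1 - m by ring] at h
      exact h
  · rw [seamIndex, map₁, D.incl₁_of_notMem hx]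
    rfl

theorem seamIndex_swap (z : D.symm.glue.Dart) (i : ZMod d) :
    i ∈ D.seamIndex (D.swap z) ↔ D.s + 1 - i ∈ D.symm.seamIndex z := by
  rcases z with z | z
  · rfl
  · change M₁.SameOrigin _ _ ↔ M₁.SameOrigin _ (D.a (D.s + 1 - (D.s + 1 - i)))
    rw [sub_sub_cancel]

theorem seamIndex_rot (z : D.glue.Dart) : D.seamIndex (D.glue.rot z) = D.seamIndex z := by
  have key : ∀ {M₁ M₂ : CombMap} (D : Seam M₁ M₂ d), ∀ x ∉ D.r₁,
      D.seamIndex (D.glue.rot (D.map₁ x)) = D.seamIndex (D.map₁ x) := by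
    intro M₁ M₂ D x hx
    rw [← D.map₁_rot hx, seamIndex_map₁, seamIndex_map₁]
    ext i
    exact Equiv.Perm.sameCycle_apply_left
  rcases D.exists_map z with ⟨x, hx, rfl⟩ | ⟨y, hy, rfl⟩
  · exact key D x hx
  · ext i
    rw [← swap_map₁, ← D.isIso_swap.map_rot, seamIndex_swap, seamIndex_swap, key D.symm y hy]

theorem contour_compl_region : D.glue.Contour D.regionᶜ (fun i => D.map₁ (D.a i)) where
  simple i j hij := by
    have h1 : D.seamIndex (D.map₁ (D.a j)) = D.seamIndex (D.map₁ (D.a i)) :=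
      (hij.mem_iff (X := {z | D.seamIndex z = D.seamIndex (D.map₁ (D.a i))}) (fun z => by
        rw [Set.mem_ofPred_eq, Set.mem_ofPred_eq, seamIndex_rot])).mpr rfl
    rw [seamIndex_map₁, seamIndex_map₁] at h1
    have h2 : j ∈ {k | M₁.SameOrigin (D.a j) (D.a k)} := SameOrigin.refl _
    rw [h1] at h2
    exact D.contour₁.simple _ _ h2
  next i := by
    rw [← map₁_opp]
    exact D.isPart₁.sameOrigin (D.contour₁.next i)
  mem i := by
    rw [Set.mem_compl_iff, map₁_mem_region, not_not]
    exact D.contour₁.mem i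
  opp_notMem i := by
    rw [Set.notMem_compl_iff, ← map₁_opp, map₁_mem_region]
    exact D.contour₁.opp_notMem i
  surj z hz hz' := by
    obtain ⟨y, rfl⟩ := D.isPart₂.surj z hz
    rw [Set.notMem_compl_iff, ← D.isPart₂.map_opp, map₂_mem_region] at hz'
    obtain ⟨j, hj⟩ := D.symm.exists_a hz'
    have hj' : D.b j = M₂.opp y := hj
    refine ⟨D.s - j, ?_⟩
    rw [D.map₁_eq_map₂ (D.contour₁.mem _), glued_a, sub_sub_cancel, hj', M₂.opp_opp]

theorem exists_contour : ∃ c : ZMod d → D.glue.Dart, D.glue.Contour D.region c := by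
  have h := D.contour_compl_region.compl
  rw [compl_compl] at h
  exact ⟨_, h⟩

theorem sameOrigin_seam (m : ZMod d) :
    D.glue.SameOrigin (D.map₁ (D.a m)) (D.map₂ (D.b (D.s - m + 1))) := by
  rw [D.map₁_eq_map₂ (D.contour₁.mem _), glued_a]
  exact D.isPart₂.sameOrigin (D.contour₂.next _)

end Seam

end CombMap

namespace AnnMap

open CombMap

variable {A N₁ N₂ : AnnMap} {p d : ℕ} {S : Set A.Dart}
  {φ₁ : N₁.Dart → A.Dart} {φ₂ : N₂.Dart → A.Dart}
  {c : ZMod d → A.Dart}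

theorem isAnnular_of_parts [NeZero d] (h₁ : IsBdryPart N₁ A S φ₁) (h₂ : IsRootPart N₂ A S φ₂)
    (hc : A.Contour S c) (hb : A.bdry ⊆ S) (hr : A.root ⊆ Sᶜ) (hN₁ : N₁.IsAnnular p d)
    (hN₂ : N₂.IsAnnular d d) : A.IsAnnular p d := by
  have hbe : φ₁ '' N₁.bdry = A.bdry := by
    rw [h₁.bdry_eq, Set.image_preimage_eq_of_subset]
    exact fun z hz => h₁.isPart.surj z (hb hz)
  have hre : φ₂ '' N₂.root = A.root := by
    rw [h₂.root_eq, Set.image_preimage_eq_of_subset]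
    exact fun z hz => h₂.isPart.surj z (hr hz)
  have hconn := isConnected_of_parts h₁.isPart h₂.isPart hc hN₁.planar.1 hN₂.planar.1
  have : Nonempty A.Dart := ⟨c 0⟩
  have hrf : A.IsFace A.root := by
    have := h₂.isPart.image_isFace hN₂.root_face (hre ▸ hr)
    rwa [hre] at this
  refine ⟨⟨hconn, (exact_iff_isEuler hconn).mp
    (exact_of_parts h₁.isPart h₂.isPart hc hN₁.exact hN₂.exact)⟩, ?_, ?_, ?_, hrf, ?_, ?_⟩
  · have := h₁.isPart.image_isFace hN₁.bdry_face (hbe ▸ hb)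
    rwa [hbe] at this
  · rw [← hbe, Set.ncard_image_of_injective _ h₁.isPart.inj, hN₁.bdry_card]
  · rw [← hbe]
    rintro _ ⟨x, hx, rfl⟩ _ ⟨y, hy, rfl⟩ hxy
    rw [hN₁.bdry_simple x hx y hy ((h₁.isPart.sameOrigin_iff hc).mpr hxy)]
  · intro h
    obtain ⟨z, hz⟩ := hrf.nonempty
    exact hr hz (hb (h ▸ hz))
  · intro f hf hfb
    obtain ⟨z, hz⟩ := hf.nonempty
    by_cases hzS : z ∈ S
    · have hfS := hf.subset h₁.isPart.faceInv hz hzS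
      rw [← h₁.isPart.ncard_preimage hfS]
      refine hN₁.face_card _ (h₁.isPart.preimage_isFace hf hfS) fun h => hfb ?_
      rw [← hbe, ← h, Set.image_preimage_eq_of_subset]
      exact fun z hz => h₁.isPart.surj z (hfS hz)
    · have hfS := hf.subset h₂.isPart.faceInv hz hzS
      rw [← h₂.isPart.ncard_preimage hfS]
      refine hN₂.face_card _ (h₂.isPart.preimage_isFace hf hfS) fun h => ?_
      obtain ⟨y, rfl⟩ := h₂.isPart.surj z hzS
      rw [h₂.bdry_eq] at h
      exact hzS (h ▸ hz : y ∈ φ₂ ⁻¹' S)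

/-! ### The girth of the glued map -/

/-- Gluing preserves the girth: a cycle bounds a region `X`, and if `X` is on neither side of the
seam then the boundaries of `X ∩ S` and of `X ∪ S`, each of length at least `d`, have together at
most the length of the cycle plus `d`. -/
theorem hasGirth_of_parts [NeZero d] (h₁ : IsBdryPart N₁ A S φ₁) (h₂ : IsRootPart N₂ A S φ₂)
    (hc : A.Contour S c) (hA : A.IsAnnular p d) (hg₁ : N₁.HasGirth d) (hg₂ : N₂.HasGirth d) :
    A.HasGirth d := by
  have key : ∀ {N : CombMap} {R : Set A.Dart} {φ : N.Dart → A.Dart}, IsPart N A.toCombMap R φ →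
      N.HasGirth d → ∀ Y, A.FaceInv Y → Y ⊆ R → (A.bd Y).Nonempty → 2 * d ≤ (A.bd Y).ncard := by
    intro N R φ h hg Y hY hYR hne
    rw [← h.image_bd_preimage hYR] at hne ⊢
    rw [Set.ncard_image_of_injective _ h.inj]
    exact (h.faceInv_preimage hY hYR).two_mul_le_ncard_bd hg.2 (Set.image_nonempty.mp hne)
  refine ⟨⟨_, hc.isCycle (NeZero.pos d)⟩, fun C k hC => ?_⟩
  obtain ⟨X, hX, rfl⟩ := hA.exact.exists_region hC
  have hk := hC.ncard_eq
  have hne : (A.bd X).Nonempty := by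
    rw [← Set.ncard_pos, hk]
    have := hC.1
    omega
  have hS := h₁.isPart.faceInv
  rcases (X ∩ S).eq_empty_or_nonempty with h | h
  · have := key h₂.isPart hg₂ X hX (fun z hz hzS => (h ▸ ⟨hz, hzS⟩ : z ∈ (∅ : Set _))) hne
    omega
  rcases ((X ∪ S)ᶜ).eq_empty_or_nonempty with h' | h'
  · have := key h₁.isPart hg₁ Xᶜ hX.compl (fun z hz => by
      have hz' : z ∈ X ∪ S := Set.compl_empty_iff.mp h' ▸ Set.mem_univ z
      exact hz'.resolve_left hz) (by rwa [bd_compl])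
    rw [bd_compl] at this
    omega
  have h1 := key h₁.isPart hg₁ (X ∩ S) (hX.inter hS) Set.inter_subset_right
    (hA.planar.1.bd_nonempty (hX.inter hS) h
      (h'.mono (Set.compl_subset_compl.mpr (Set.inter_subset_right.trans Set.subset_union_right))))
  have h2 := key h₂.isPart hg₂ (X ∪ S)ᶜ (hX.union hS).compl
    (Set.compl_subset_compl.mpr Set.subset_union_right) (by
      rw [bd_compl]
      exact hA.planar.1.bd_nonempty (hX.union hS) (h.mono (Set.inter_subset_left.trans
        Set.subset_union_left)) h')
  rw [bd_compl] at h2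
  have h3 := ncard_bd_inter_add_union X S
  have h4 := (hc.isCycle (NeZero.pos d)).ncard_eq
  omega

end AnnMap

namespace MarkedMap

open CombMap AnnMap

variable {κ : (A : MarkedMap) → Set A.Dart} {p d : ℕ} {N₁ N₂ : MarkedMap}

/-- Every pair of marked maps with matching parameters is obtained by decomposing a marked map, in
which the co-marked vertex of the first one is glued to the marked vertex of the second one. -/
theorem exists_decomp (hκ : IsCoMarking p d κ) (hN₁ : N₁.IsMarkedAnnular p d)
    (hg₁ : N₁.HasGirth d) (hN₂ : N₂.IsMarkedAnnular d d) (hg₂ : N₂.HasGirth d) :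
    ∃ (A : MarkedMap) (S : Set A.Dart) (φ₁ : N₁.Dart → A.Dart) (φ₂ : N₂.Dart → A.Dart),
      A.IsMarkedAnnular p d ∧ A.HasGirth d ∧ Decomp κ d A N₁ N₂ S φ₁ φ₂ := by
  obtain ⟨hC, hopp₁, a, ha⟩ := hN₁.annular.root_contour hg₁
  have : NeZero d := ⟨hC.1.ne'⟩
  obtain ⟨-, hopp₂, b, hb⟩ := hN₂.annular.bdry_face.exists_contour hN₂.annular.planar.1 hg₂.2
    hN₂.annular.bdry_card (hN₂.annular.root_nonempty.mono
      (Set.subset_compl_comm.mp hN₂.annular.bdry_subset_compl_root))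
  obtain ⟨x, hxκ, hxr⟩ := hκ.outer _ hN₁
  obtain ⟨m, rfl⟩ := ha.surj _ hxr (hopp₁ _ hxr)
  obtain ⟨y, hyκ, hyb⟩ := hN₂.mark_bdry
  obtain ⟨n, rfl⟩ := hb.surj _ hyb (hopp₂ _ hyb)
  -- With this shift the edge of `a m` is glued to that of `b (n - 1)`, with the opposite direction:
  -- the origin of `a m` becomes the end of `b (n - 1)`, which is the origin of `b n`.
  let D : Seam N₁.toCombMap N₂.toCombMap d := ⟨N₁.root, N₂.bdry, a, b, n + m - 1,
    hN₁.annular.root_face.faceInv, hN₂.annular.bdry_face.faceInv, ha, hb, hopp₁, hopp₂⟩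
  obtain ⟨c, hc⟩ := D.exists_contour
  have hp₁ := D.isPart₁
  have hp₂ := D.isPart₂
  let A : MarkedMap :=
    { toCombMap := D.glue
      bdry := D.map₁ '' N₁.bdry
      root := D.map₂ '' N₂.root
      mark := {z | ∃ x ∈ N₁.mark, D.glue.SameOrigin (D.map₁ x) z} }
  have hbS : D.map₁ '' N₁.bdry ⊆ D.region := by
    rintro _ ⟨x, hx, rfl⟩
    rw [D.map₁_mem_region]
    exact hN₁.annular.bdry_subset_compl_root hx
  have hrS : D.map₂ '' N₂.root ⊆ D.regionᶜ := by
    rintro _ ⟨y, hy, rfl⟩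
    have hy' : y ∉ D.r₂ := fun h => hN₂.annular.bdry_subset_compl_root h hy
    exact mt D.map₂_mem_region.mp hy'
  have h₁ : IsBdryPart N₁.toAnnMap A.toAnnMap D.region D.map₁ := by
    refine ⟨hp₁, (Set.preimage_image_eq _ hp₁.inj).symm, ?_⟩
    ext x
    exact (not_not.symm.trans (not_congr D.map₁_mem_region.symm))
  have h₂ : IsRootPart N₂.toAnnMap A.toAnnMap D.region D.map₂ :=
    ⟨hp₂, Set.ext fun y => D.map₂_mem_region.symm, (Set.preimage_image_eq _ hp₂.inj).symm⟩
  have hA : A.IsAnnular p d := isAnnular_of_parts h₁ h₂ hc hbS hrS hN₁.annular hN₂.annular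
  have hg : A.HasGirth d := hasGirth_of_parts h₁ h₂ hc hA hg₁ hg₂
  have hso : D.glue.SameOrigin (D.map₁ (a m)) (D.map₂ (b n)) := by
    have h := D.sameOrigin_seam m
    have h1 : D.s - m + 1 = n := by
      change n + m - 1 - m + 1 = n
      ring
    rw [h1] at h
    exact h
  obtain ⟨v, hv⟩ := hN₁.mark_vertex
  obtain ⟨w, hw⟩ := hN₂.mark_vertex
  obtain ⟨u, hu⟩ := hκ.vertex _ hN₁
  refine ⟨A, D.region, D.map₁, D.map₂, ⟨hA, ⟨D.map₁ v, ?_⟩, ?_⟩, hg,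
    ⟨⟨hp₁.faceInv, hbS, hrS, hc.isCycle (NeZero.pos d)⟩, h₁, h₂, ?_, ?_⟩⟩
  · ext z
    constructor
    · rintro ⟨x, hx, hxz⟩
      rw [hv] at hx
      exact SameOrigin.trans (hp₁.sameOrigin hx) hxz
    · exact fun h => ⟨v, hv ▸ .refl _ _, h⟩
  · obtain ⟨x, hx, hxb⟩ := hN₁.mark_bdry
    exact ⟨D.map₁ x, ⟨x, hx, .refl _⟩, ⟨x, hxb, rfl⟩⟩
  · ext x
    constructor
    · exact fun hx => ⟨x, hx, .refl _⟩
    · rintro ⟨x', hx', h⟩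
      rw [hv] at hx' ⊢
      exact SameOrigin.trans hx' ((hp₁.sameOrigin_iff hc).mpr h)
  · ext y
    rw [hu] at hxκ ⊢
    rw [hw] at hyκ ⊢
    constructor
    · intro hy
      exact ⟨a m, hxκ, hso.trans (hp₂.sameOrigin (SameOrigin.trans (SameOrigin.symm hyκ) hy))⟩
    · rintro ⟨x', hx', h⟩
      have h1 : D.glue.SameOrigin (D.map₁ (a m)) (D.map₁ x') :=
        hp₁.sameOrigin (SameOrigin.trans (SameOrigin.symm hxκ) hx')
      have h2 := hso.symm.trans (h1.trans h)
      exact SameOrigin.trans hyκ ((hp₂.sameOrigin_iff hc.compl).mpr h2)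

end MarkedMap

namespace MarkedMap

open CombMap AnnMap

variable {κ : (A : MarkedMap) → Set A.Dart} {p d : ℕ} {A B N₁ N₂ N₁' N₂' : MarkedMap}

/-! ### The decomposition along the distinguished cycle -/

/-- `N₁` and `N₂` are the two parts of the marked annular map `A`, cut along the pseudo-separating
cycle of length `d` that is closest to the boundary face. -/
def Decomposes (κ : (A : MarkedMap) → Set A.Dart) (p d : ℕ) (A N₁ N₂ : MarkedMap) : Prop :=
  A.IsMarkedAnnular p d ∧ A.HasGirth d ∧ ∃ S φ₁ φ₂, Decomp κ d A N₁ N₂ S φ₁ φ₂ ∧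
    ∀ S', A.IsRegion d S' → S ⊆ S'

theorem Decomposes.congr (hκ : IsCoMarking p d κ) (h : Decomposes κ p d A N₁ N₂)
    (h' : Decomposes κ p d B N₁' N₂') (e : Iso A B) :
    Nonempty (Iso N₁ N₁') ∧ Nonempty (Iso N₂ N₂') := by
  obtain ⟨hA, -, S, φ₁, φ₂, hD, hmin⟩ := h
  obtain ⟨-, -, S', φ₁', φ₂', hD', hmin'⟩ := h'
  have hS : e.toEquiv '' S = S' := by
    refine Set.Subset.antisymm ?_ (hmin' _ (hD.region.image e))
    have h1 := hmin _ (hD'.region.image e.symm)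
    have h2 : e.toEquiv '' (e.symm.toEquiv '' S') = S' := Equiv.image_symm_image _ _
    rw [← h2]
    exact Set.image_mono h1
  have hDe := hD.map e
  rw [hS] at hDe
  exact hDe.unique hD' hκ (hD.isMarkedAnnular₁ hA)

open Classical in
/-- The decomposition of (isomorphism classes of) marked annular maps into two parts; the value on a
class that is not decomposed is irrelevant. -/
noncomputable def decomposition (κ : (A : MarkedMap) → Set A.Dart) (p d : ℕ) (q : Class) :
    Class × Class :=
  if h : ∃ A N₁ N₂, Decomposes κ p d A N₁ N₂ ∧ q = Quotient.mk _ A then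
    (Quotient.mk _ h.choose_spec.choose, Quotient.mk _ h.choose_spec.choose_spec.choose)
  else (q, q)

theorem Decomposes.decomposition_eq (hκ : IsCoMarking p d κ) (h : Decomposes κ p d A N₁ N₂) :
    decomposition κ p d (Quotient.mk _ A) = (Quotient.mk _ N₁, Quotient.mk _ N₂) := by
  have hex : ∃ B N₁' N₂', Decomposes κ p d B N₁' N₂' ∧
      (Quotient.mk isoSetoid A : Class) = Quotient.mk _ B := ⟨A, N₁, N₂, h, rfl⟩
  rw [decomposition, dif_pos hex]
  obtain ⟨hB, hAB⟩ := hex.choose_spec.choose_spec.choose_spec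
  obtain ⟨e⟩ : Nonempty (Iso hex.choose A) := Quotient.exact hAB.symm
  obtain ⟨h1, h2⟩ := hB.congr hκ h e
  exact Prod.ext (Quotient.sound h1) (Quotient.sound h2)

/-- The distinguished cycle yields the decomposition. -/
theorem decomposes_of_cycle (hA : A.IsMarkedAnnular p d) (hg : A.HasGirth d) {C : Set A.Dart}
    (hC : A.IsPseudoSeparating C d) (hns : (A.bdryPart C).NonSeparated d) :
    Decomposes κ p d A (A.bdryPartMarked C) (A.rootPartMarked κ C) := by
  obtain ⟨S, hS, rfl⟩ := (hA.annular.isPseudoSeparating_iff hg).mp hC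
  exact ⟨hA, hg, S, _, _, decomp_parts hA.annular hS,
    ((hS.isBdryPart hA.annular).nonSeparated_iff hA.annular hg hS).mp hns⟩

theorem exists_decomposes (κ : (A : MarkedMap) → Set A.Dart) (hA : A.IsMarkedAnnular p d)
    (hg : A.HasGirth d) : ∃ N₁ N₂, Decomposes κ p d A N₁ N₂ := by
  obtain ⟨C, ⟨hC, hns⟩, -⟩ := hA.annular.existsUnique_cycle hg
  exact ⟨_, _, decomposes_of_cycle hA hg hC hns⟩

theorem decomposition_bijOn (hκ : IsCoMarking p d κ) :
    Set.BijOn (decomposition κ p d) (annularClasses p d)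
      (nonSeparatedClasses p d ×ˢ annularClasses d d) := by
  refine ⟨?_, ?_, ?_⟩
  · rintro _ ⟨A, hA, hg, rfl⟩
    obtain ⟨N₁, N₂, h⟩ := exists_decomposes κ hA hg
    rw [h.decomposition_eq hκ]
    obtain ⟨-, -, S, φ₁, φ₂, hD, hmin⟩ := h
    exact ⟨⟨N₁, hD.isMarkedAnnular₁ hA, hD.bdryPart.hasGirth hg hD.region,
      (hD.bdryPart.nonSeparated_iff hA.annular hg hD.region).mpr hmin, rfl⟩,
      ⟨N₂, hD.isMarkedAnnular₂ hκ hA, hD.rootPart.hasGirth hg hD.region, rfl⟩⟩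
  · rintro _ ⟨A, hA, hg, rfl⟩ _ ⟨B, hB, hgB, rfl⟩ hAB
    obtain ⟨N₁, N₂, h⟩ := exists_decomposes κ hA hg
    obtain ⟨N₁', N₂', h'⟩ := exists_decomposes κ hB hgB
    rw [h.decomposition_eq hκ, h'.decomposition_eq hκ] at hAB
    obtain ⟨α⟩ : Nonempty (Iso N₁ N₁') := Quotient.exact (congrArg Prod.fst hAB)
    obtain ⟨β⟩ : Nonempty (Iso N₂ N₂') := Quotient.exact (congrArg Prod.snd hAB)
    obtain ⟨-, -, S, φ₁, φ₂, hD, -⟩ := h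
    obtain ⟨-, -, S', ψ₁, ψ₂, hD', -⟩ := h'
    exact Quotient.sound (hD.injective (hD'.comp hκ (hD.isMarkedAnnular₁ hA) α β) hκ hA hB)
  · rintro ⟨_, _⟩ ⟨⟨N₁, hN₁, hg₁, hns, rfl⟩, ⟨N₂, hN₂, hg₂, rfl⟩⟩
    obtain ⟨A, S, φ₁, φ₂, hA, hg, hD⟩ := exists_decomp hκ hN₁ hg₁ hN₂ hg₂
    exact ⟨Quotient.mk _ A, ⟨A, hA, hg, rfl⟩, Decomposes.decomposition_eq hκ ⟨hA, hg, S, φ₁, φ₂, hD,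
      (hD.bdryPart.nonSeparated_iff hA.annular hg hD.region).mp hns⟩⟩

end MarkedMap

theorem proposition5p5 (p d : ℕ) (hd : 3 ≤ d) (hp : d ≤ p) :
    -- the two parts are annular `d`-angulations of girth `d`
    (∀ A : AnnMap, A.IsAnnular p d → A.HasGirth d →
      ∀ C, A.IsPseudoSeparating C d →
        ((A.bdryPart C).IsAnnular p d ∧ (A.bdryPart C).HasGirth d) ∧
        ((A.rootPart C).IsAnnular d d ∧ (A.rootPart C).HasGirth d)) ∧
    -- the distinguished pseudo-separating cycle
    (∀ A : AnnMap, A.IsAnnular p d → A.HasGirth d →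
      ∃! C : Set A.Dart, A.IsPseudoSeparating C d ∧ (A.bdryPart C).NonSeparated d) ∧
    -- for every co-marking convention, the decomposition is a bijection
    (∀ κ : (A : MarkedMap) → Set A.Dart, MarkedMap.IsCoMarking p d κ →
      ∃ Δ : MarkedMap.Class → MarkedMap.Class × MarkedMap.Class,
        (∀ A : MarkedMap, A.IsMarkedAnnular p d → A.HasGirth d →
          ∀ C, A.IsPseudoSeparating C d → (A.bdryPart C).NonSeparated d →
            Δ (Quotient.mk _ A) =
              (Quotient.mk _ (A.bdryPartMarked C), Quotient.mk _ (A.rootPartMarked κ C))) ∧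
        Set.BijOn Δ (MarkedMap.annularClasses p d)
          (MarkedMap.nonSeparatedClasses p d ×ˢ MarkedMap.annularClasses d d)) := by
  refine ⟨fun A hA hg C hC => ?_, fun A hA hg => hA.existsUnique_cycle hg, fun κ hκ => ?_⟩
  · obtain ⟨S, hS, rfl⟩ := (hA.isPseudoSeparating_iff hg).mp hC
    have h₁ := hS.isBdryPart hA
    have h₂ := hS.isRootPart hA
    exact ⟨⟨h₁.isAnnular hA hS, h₁.hasGirth hg hS⟩, ⟨h₂.isAnnular hA hS, h₂.hasGirth hg hS⟩⟩
  · exact ⟨MarkedMap.decomposition κ p d, fun A hA hg C hC hns =>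
      (MarkedMap.decomposes_of_cycle hA hg hC hns).decomposition_eq hκ,
      MarkedMap.decomposition_bijOn hκ⟩
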